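/- Let $N$ be an integer or a half-integer. Consider functions $\psi(z,\bar z,q)$ of a point $z\in\mathbb C$ and of a parameter $q>0$, and write $T=z\partial_z$, $\bar T=\bar z\partial_{\bar z}$, so that $q^{aT+b\bar T}$ acts by $\psi(z,\bar z,q)\mapsto\psi(q^az,q^b\bar z,q)$; let $[x]_q=\frac{q^x-q^{-x}}{q-q^{-1}}$ (with $[x]_1=x$) for numbers and operators $x$, and $[n]_q!=[n]_q\cdots[1]_q$, $[0]_q!=1$. For $q\neq1$ the Rideau–Winternitz realization of $su_q(2)$ is $$H_3=-T+\bar T-N,\qquad H_+=-z^{-1}[T]_q\,q^{\bar T-N/2}-q^{T+N/2}\,\bar z\,[\bar T-N]_q,\qquad H_-=z\,[T+N]_q\,q^{\bar T-N/2}+q^{T+N/2}\,\bar z^{-1}[\bar T]_q .$$ In every expression evaluated at $q$, only the values of $\psi$ at the parameters $q$ and $q^{-1}$ matter. Call $\psi$ admissible at $q$ if, for each of these two parameters, at every fixed $|z|>0$ it continues analytically to all complex values of the angle $\arg z$ (so that $z$ and $\bar z$ may be dilated independently), is bounded, uniformly in $|z|>0$, when the imaginary part of the angle is bounded, and is measurable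 on the plane (also after independent dilations of $z$ and $\bar z$ by positive factors). For $q>0$, $q\ne1$, put, with $dz\,d\bar z=\rho\,d\rho\,d\phi$ for $z=\rho e^{i\phi}$, $$\langle\psi_1|\psi_2\rangle_q=\frac{q-q^{-1}}{2\ln q}\int dz\,d\bar z\left(\overline{\psi_1(z,\bar z,q^{-1})}\,\frac{q^{-1}}{(1+z\bar z)(1+q^{-2}z\bar z)}\,\psi_2(q^{-1}z,q^{-1}\bar z,q)+\overline{\psi_1(z,\bar z,q)}\,\frac{q}{(1+z\bar z)(1+q^{2}z\bar z)}\,\psi_2(qz,q\bar z,q^{-1})\right).$$ For $J\in\{|N|,|N|+1,\dots\}$, $M\in\{-J,-J+1,\dots,J\}$ and $\eta=z\bar z$ let $$\Psi^J_{MNq}(z,\bar z)=\frac1{\sqrt{2\pi}}\left(\frac{[J+N]_q!\,[2J+1]_q!}{[J-N]_q!}\right)^{1/2}\left(\frac{[J+M]_q!}{[J-M]_q!\,[2J]_q!}\right)^{1/2}Q_{Jq}(\eta)\,q^{-NM/2}\,R^J_{MNq}(\eta)\,\bar z^{\,M+N},$$ $$R^J_{MNq}(\eta)=\sum_k\frac{[J-N]_q!\,[J-M]_q!\,(-\eta)^k}{[k]_q!\,[J-M-k]_q!\,[J-N-k]_q!\,[M+N+k]_q!},$$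 where $k$ runs over the integers for which all arguments of the factorials in the denominator are nonnegative, and $$Q_{Jq}(\eta)=\prod_{k=0}^\infty\frac{1+q^{2k}\eta}{1+q^{-2J+2k}\eta}\ (q<1),\qquad Q_{Jq}(\eta)=\prod_{k=0}^\infty\frac{1+q^{-2J-2k-2}\eta}{1+q^{-2k-2}\eta}\ (q>1),\qquad Q_{J1}(\eta)=(1+\eta)^{-J}.$$ Let $V_N$ be the complex linear span (with coefficients independent of $q$) of the functions $\Psi^J_{MN}:(z,\bar z,q)\mapsto\Psi^J_{MNq}(z,\bar z)$ for the fixed $N$. Then, for every $q>0$, $q\neq1$: 1. $\langle\cdot|\cdot\rangle_q$ is a convergent Hermitian sesquilinear form on the functions admissible at $q$. 2. For all functions $\psi_1,\psi_2$ admissible at $q$, the integrals below converge and $\langle\psi_1|H_3\psi_2\rangle_q=\langle H_3\psi_1|\psi_2\rangle_q$, $\langle\psi_1|H_+\psi_2\rangle_q=\langle H_-\psi_1|\psi_2\rangle_q$, $\langle\psi_1|H_-\psi_2\rangle_q=\langle H_+\psi_1|\psi_2\rangle_q$. 3. All elements of $V_N$ are admissible at $q$; $H_3,H_+,H_-$ map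 $V_N$ into itself (comparing functions at $z\neq0$ and the parameters $q$, $q^{-1}$); and $\langle v|v\rangle_q>0$ for every nonzero $v\in V_N$. Thus the form is a scalar product on $V_N$ that unitarizes the realization. 4. For the fixed $N$ the functions $\Psi^J_{MN}$, $J=|N|,|N|+1,\dots$, $M=-J,\dots,J$, are orthonormal: $\langle\Psi^J_{MN}|\Psi^{J'}_{M'N}\rangle_q=\delta_{JJ'}\delta_{MM'}$. Moreover, as $q\to1$, $q\neq 1$, $\langle\psi_1|\psi_2\rangle_q$ tends to the classical scalar product $2\int\frac{dz\,d\bar z}{(1+z\bar z)^2}\,\overline{\psi_1(z,\bar z,1)}\,\psi_2(z,\bar z,1)$ whenever $\psi_1,\psi_2$ are measurable in $z$ and uniformly bounded for parameters near $1$ and, for almost every $z$, are jointly continuous in the parameter and the point of the plane at $(1,z)$; and also whenever $\psi_1,\psi_2\in V_N$. -/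

import Mathlib

open scoped ComplexConjugate ComplexOrder Topology

noncomputable section

namespace SUq2

/-- A `q`-dependent function `ψ(z, z̄, q)` on the plane.  The value `ψ p z w` is the one at
parameter `p`, with `w` in the place of `z̄`, so that `z` and `w` can be dilated independently.
The plane is `w = conj z`; the operators below only involve points with `0 < z * w`, that is
`z = ρ e^{iφ}`, `w = ρ e^{-iφ}` with `ρ > 0` and a complex angle `φ`. -/
abbrev Family : Type := ℝ → ℂ → ℂ → ℂ

/-! ### The generators -/

/-- The operator `q^{aT + bT̄}`, where `T = z∂_z` and `T̄ = z̄∂_{z̄}`. -/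
def dil (a b : ℝ) (ψ : Family) : Family :=
  fun p z w => ψ p (((p ^ a : ℝ) : ℂ) * z) (((p ^ b : ℝ) : ℂ) * w)

/-- Multiplication by the scalar `q^a`. -/
def scal (a : ℝ) (ψ : Family) : Family :=
  fun p z w => ((p ^ a : ℝ) : ℂ) * ψ p z w

/-- `[T + c]_q = (q^{T+c} - q^{-T-c}) / (q - q⁻¹)`. -/
def bracketT (c : ℝ) (ψ : Family) : Family :=
  fun p z w => (scal c (dil 1 0 ψ) p z w - scal (-c) (dil (-1) 0 ψ) p z w) / ((p - p⁻¹ : ℝ) : ℂ)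

/-- `[T̄ + c]_q = (q^{T̄+c} - q^{-T̄-c}) / (q - q⁻¹)`. -/
def bracketTbar (c : ℝ) (ψ : Family) : Family :=
  fun p z w => (scal c (dil 0 1 ψ) p z w - scal (-c) (dil 0 (-1) ψ) p z w) / ((p - p⁻¹ : ℝ) : ℂ)

/-- `H₃ = -T + T̄ - N`.  The derivation `-T + T̄` generates
`(z, w) ↦ (e^{-s} z, e^{s} w)`, which for `s = -iθ` is the rotation by the angle `θ`. -/
def H3 (N : ℝ) (ψ : Family) : Family :=
  fun p z w =>
    deriv (fun s : ℂ => ψ p (Complex.exp (-s) * z) (Complex.exp s * w)) 0 - (N : ℂ) * ψ p z w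

/-- `H₊ = - z⁻¹ [T]_q q^{T̄ - N/2} - q^{T + N/2} z̄ [T̄ - N]_q`. -/
def Hplus (N : ℝ) (ψ : Family) : Family :=
  fun p z w =>
    - (z⁻¹ * bracketT 0 (scal (-(N / 2)) (dil 0 1 ψ)) p z w)
      - scal (N / 2) (dil 1 0 (fun p' z' w' => w' * bracketTbar (-N) ψ p' z' w')) p z w

/-- `H₋ = z [T + N]_q q^{T̄ - N/2} + q^{T + N/2} z̄⁻¹ [T̄]_q`. -/
def Hminus (N : ℝ) (ψ : Family) : Family :=
  fun p z w =>
    z * bracketT N (scal (-(N / 2)) (dil 0 1 ψ)) p z w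
      + scal (N / 2) (dil 1 0 (fun p' z' w' => w'⁻¹ * bracketTbar 0 ψ p' z' w')) p z w

/-! ### The basis functions -/

/-- The `q`-number `[x]_q`, with its limiting value `x` at `q = 1`. -/
def qnum (p x : ℝ) : ℝ :=
  if p = 1 then x else (p ^ x - p ^ (-x)) / (p - p⁻¹)

/-- The `q`-factorial `[x]_q!`, used for natural numbers `x` only. -/
def qfact (p x : ℝ) : ℝ :=
  ∏ i ∈ Finset.range ⌊x⌋₊, qnum p ((i : ℝ) + 1)

/-- The polynomial `R^J_{MNq}(η)`; `k` runs over all values for which the arguments of the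
`q`-factorials in the denominator are nonnegative. -/
def R (J M N p η : ℝ) : ℝ :=
  ∑ k ∈ (Finset.range (⌊J - M⌋₊ + 1)).filter
      (fun k : ℕ => 0 ≤ J - N - (k : ℝ) ∧ 0 ≤ M + N + (k : ℝ)),
    (qfact p (J - N) * qfact p (J - M) * (-η) ^ k) /
      (qfact p (k : ℝ) * qfact p (J - M - k) * qfact p (J - N - k) * qfact p (M + N + k))

/-- The function `Q_{Jq}(η)`, equal to `(1 + η)^{-J}` at `q = 1`. -/
def Q (J p η : ℝ) : ℝ :=
  if p < 1 then
    ∏' k : ℕ, (1 + p ^ (2 * (k : ℝ)) * η) / (1 + p ^ (-2 * J + 2 * (k : ℝ)) * η)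
  else if p = 1 then
    (1 + η) ^ (-J)
  else
    ∏' k : ℕ, (1 + p ^ (-2 * J - 2 * (k : ℝ) - 2) * η) / (1 + p ^ (-2 * (k : ℝ) - 2) * η)

/-- The constant `N^J_{MNq}`, with the normalization `γ(J, N, q) = 1`. -/
def normConst (J M N p : ℝ) : ℝ :=
  1 / √(2 * Real.pi) * √(qfact p (J + N) * qfact p (2 * J + 1) / qfact p (J - N)) *
    √(qfact p (J + M) / (qfact p (J - M) * qfact p (2 * J)))

/-- `Ψ^J_{MNq}(z, z̄) = N^J_{MNq} Q_{Jq}(η) q^{-NM/2} R^J_{MNq}(η) z̄^{M+N}`, `η = z z̄`. -/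
def Psi (J M N : ℝ) : Family :=
  fun p z w =>
    ((normConst J M N p * Q J p (z * w).re * p ^ (-(N * M / 2)) * R J M N p (z * w).re : ℝ) : ℂ)
      * w ^ ⌊M + N⌋

/-- `J ∈ {|N|, |N| + 1, …}` and `M ∈ {-J, -J + 1, …, J}`. -/
def IsLabel (N J M : ℝ) : Prop :=
  (∃ k : ℕ, J = |N| + k) ∧ (∃ k : ℕ, M = -J + k) ∧ M ≤ J

/-- The complex span of the `Ψ^J_{MN}` for a fixed `N`, with coefficients independent of `q`. -/
def basisSpan (N : ℝ) : Submodule ℂ Family :=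
  Submodule.span ℂ {ψ | ∃ J M : ℝ, IsLabel N J M ∧ ψ = Psi J M N}

/-! ### The forms -/

/-- The integrand of `⟨ψ₁ | ψ₂⟩_q`, without the constant in front of the integral. -/
def formIntegrand (q : ℝ) (ψ₁ ψ₂ : Family) (z : ℂ) : ℂ :=
  conj (ψ₁ q⁻¹ z (conj z))
      * ((q⁻¹ / ((1 + ‖z‖ ^ 2) * (1 + (q ^ 2)⁻¹ * ‖z‖ ^ 2)) : ℝ) : ℂ)
      * ψ₂ q ((q : ℂ)⁻¹ * z) ((q : ℂ)⁻¹ * conj z)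
    + conj (ψ₁ q z (conj z))
      * ((q / ((1 + ‖z‖ ^ 2) * (1 + q ^ 2 * ‖z‖ ^ 2)) : ℝ) : ℂ)
      * ψ₂ q⁻¹ ((q : ℂ) * z) ((q : ℂ) * conj z)

/-- The form `⟨ψ₁ | ψ₂⟩_q`; `dz dz̄` is the area element `ρ dρ dφ`. -/
def form (q : ℝ) (ψ₁ ψ₂ : Family) : ℂ :=
  (((q - q⁻¹) / (2 * Real.log q) : ℝ) : ℂ) * ∫ z : ℂ, formIntegrand q ψ₁ ψ₂ z

/-- The classical scalar product `2 ∫ dz dz̄ (1 + z z̄)⁻² conj ψ₁ ψ₂`. -/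
def classicalForm (ψ₁ ψ₂ : ℂ → ℂ → ℂ) : ℂ :=
  2 * ∫ z : ℂ, (((1 + ‖z‖ ^ 2) ^ 2)⁻¹ : ℝ) * conj (ψ₁ z (conj z)) * ψ₂ z (conj z)

/-- The functions on which the form and the generators at `q` are considered.  At the
parameters `q` and `q⁻¹` they continue analytically to complex angles (this is what gives a
meaning to independent dilations of `z` and `z̄`), are bounded for bounded imaginary part of
the angle, and are measurable. -/
structure IsAdmissible (q : ℝ) (ψ : Family) : Prop where
  holo : ∀ p : ℝ, p = q ∨ p = q⁻¹ → ∀ η : ℝ, 0 < η →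
    DifferentiableOn ℂ (fun z : ℂ => ψ p z ((η : ℂ) / z)) {z | z ≠ 0}
  bdd : ∀ p : ℝ, p = q ∨ p = q⁻¹ → ∀ r : ℝ, ∃ C : ℝ, ∀ z w : ℂ,
    0 < z * w → ‖z‖ ≤ r * ‖w‖ → ‖w‖ ≤ r * ‖z‖ → ‖ψ p z w‖ ≤ C
  meas : ∀ p : ℝ, p = q ∨ p = q⁻¹ → ∀ s t : ℝ, 0 < s → 0 < t →
    MeasureTheory.AEStronglyMeasurable (fun z : ℂ => ψ p ((s : ℂ) * z) ((t : ℂ) * conj z))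

/-- Functions with a classical limit: near the parameter `1` they are measurable and uniformly
bounded on the plane, and at almost every point of the plane they are jointly continuous at the
parameter `1`. -/
structure HasClassicalLimit (ψ : Family) : Prop where
  meas : ∀ᶠ p in 𝓝 (1 : ℝ), MeasureTheory.AEStronglyMeasurable (fun z : ℂ => ψ p z (conj z))
  bdd : ∃ C : ℝ, ∀ᶠ p in 𝓝 (1 : ℝ), ∀ z : ℂ, z ≠ 0 → ‖ψ p z (conj z)‖ ≤ C
  cont : ∀ᵐ z : ℂ, ContinuousAt (fun x : ℝ × ℂ => ψ x.1 x.2 (conj x.2)) (1, z)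

/-- `A ψ₂` and `B ψ₁` are adjoint to each other: both integrals converge and
`⟨ψ₁ | A ψ₂⟩_q = ⟨B ψ₁ | ψ₂⟩_q`. -/
def AdjointAt (q : ℝ) (A B : Family → Family) (ψ₁ ψ₂ : Family) : Prop :=
  MeasureTheory.Integrable (formIntegrand q ψ₁ (A ψ₂)) ∧
    MeasureTheory.Integrable (formIntegrand q (B ψ₁) ψ₂) ∧
    form q ψ₁ (A ψ₂) = form q (B ψ₁) ψ₂

/-- `A` maps `V` into itself at the deformation parameter `q`: functions are compared at the
parameters `q`, `q⁻¹` that enter the form, and at the points with `0 < z * w`. -/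
def MapsSpan (q : ℝ) (A : Family → Family) (V : Submodule ℂ Family) : Prop :=
  ∀ v ∈ V, ∃ v' ∈ V, ∀ p : ℝ, p = q ∨ p = q⁻¹ → ∀ z w : ℂ, 0 < z * w → A v p z w = v' p z w

end SUq2

end

namespace SUq2

open MeasureTheory

/-! ### Invariance of plane integrals under independent dilations -/

/-! The form is a constant times the sum of two halves, one for `q` and one for `q⁻¹` (`half`). The
substitution `z ↦ p z` followed by complex conjugation exchanges them with their arguments swapped
(`conj_half_scale`), because the Jacobian turns the weight at `p` into the weight at `p⁻¹`. This
gives the Hermitian symmetry.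

Adjointness already holds for each half. A generator `H₊` or `H₋` is a combination of three
dilations of `(z, z̄)`. One dilates both variables equally and is moved to the other argument by a
change of variables in the plane. The other two act as `(a, a⁻¹)`: they fix `η = z z̄` and shift the
angle by an imaginary amount. On each circle such a shift changes the radius of a contour integral
of a function holomorphic off the origin, so Cauchy's theorem makes the plane integral invariant
(`integral_dil_inv`, `Regular.integral_weight`). `H₃` generates this flow, and integration by parts
for it is the limit of the same invariance (`Regular.integral_angDeriv`).

On the basis functions, `Q` satisfies a first-order `q`-difference equation (`Q_dilate`) and the
polynomials satisfy two contiguity relations (`poly_raise`, `poly_lower`), which reduce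
coefficientwise to the addition rule `qnum_add`. Hence `H₊` and `H₋` act as ladder operators with
the usual square-root matrix elements. With adjointness, all inner products follow from those at the
top of the ladders: different `M` are separated by the eigenvalues of `H₃`; for different `J`,
raising both arguments ends at a highest vector, which `H₊` annihilates; and norms do not change
along a ladder. For `M = J` the infinite products cancel down to a finite one (`Q_inv_mul_Q`), and
the norm is a `q`-beta integral (`betaInt_eq`), found by recursion from one elementary integral
whose logarithm is compensated by the prefactor of the form. Positivity is then Parseval's identity.

For the classical limit the prefactor tends to `1` and dominated convergence applies to each half,
with majorant a multiple of `(1 + |z|²)⁻²`. The basis functions qualify because `Q²` lies between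
two explicit expressions that both tend to `(1 + η)^{-2J}` (`Q_sq_bounds`). -/

theorem integrableOn_comp_polarCoord_symm {f : ℂ → ℂ} (hf : Integrable f) :
    IntegrableOn (fun p : ℝ × ℝ => p.1 • f (Complex.polarCoord.symm p)) polarCoord.target := by
  have h1 : Integrable (fun p : ℝ × ℝ => f (Complex.measurableEquivRealProd.symm p)) :=
    (Complex.volume_preserving_equiv_real_prod.symm.integrable_comp_emb
      Complex.measurableEquivRealProd.symm.measurableEmbedding).2 hf
  have h2 : IntegrableOn (fun p : ℝ × ℝ => f (Complex.measurableEquivRealProd.symm p))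
      (polarCoord.symm '' polarCoord.target) := h1.integrableOn
  rw [integrableOn_image_iff_integrableOn_abs_det_fderiv_smul volume
    polarCoord.open_target.measurableSet
    (fun p _ => (hasFDerivAt_polarCoord_symm p).hasFDerivWithinAt) polarCoord.symm.injOn] at h2
  refine h2.congr_fun (fun p hp => ?_) polarCoord.open_target.measurableSet
  simp only [det_fderivPolarCoordSymm, Complex.measurableEquivRealProd_symm_polarCoord_symm_apply]
  rw [abs_of_pos hp.1]

theorem integral_polar {f : ℂ → ℂ} (hf : Integrable f) :
    ∫ z, f z = ∫ ρ in Set.Ioi (0 : ℝ), ρ • ∫ θ in (-Real.pi)..Real.pi, f (circleMap 0 ρ θ) := by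
  rw [← Complex.integral_comp_polarCoord_symm]
  have h := integrableOn_comp_polarCoord_symm hf
  rw [show polarCoord.target = Set.Ioi (0 : ℝ) ×ˢ Set.Ioo (-Real.pi) Real.pi from rfl] at h ⊢
  rw [Measure.volume_eq_prod] at h ⊢
  rw [setIntegral_prod _ h]
  refine setIntegral_congr_fun measurableSet_Ioi (fun ρ _ => ?_)
  simp only [integral_smul]
  rw [intervalIntegral.integral_of_le (by linarith [Real.pi_pos]), integral_Ioc_eq_integral_Ioo]
  congr 1
  refine setIntegral_congr_fun measurableSet_Ioo (fun θ _ => ?_)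
  simp only [Complex.polarCoord_symm_apply, circleMap, Complex.exp_mul_I, Complex.ofReal_cos,
    Complex.ofReal_sin, zero_add]

/-- The mean over a circle is, up to a constant, the contour integral of `f(z)/z`, which does not
depend on the radius by Cauchy's theorem on the annulus. No regularity at the origin is needed. -/
theorem integral_circleMap_eq {f : ℂ → ℂ} (hf : DifferentiableOn ℂ f {z | z ≠ 0}) {r s : ℝ}
    (hr : 0 < r) (hs : 0 < s) :
    ∫ θ in (-Real.pi)..Real.pi, f (circleMap 0 r θ)
      = ∫ θ in (-Real.pi)..Real.pi, f (circleMap 0 s θ) := by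
  have key : ∀ t : ℝ, 0 < t → (∮ z in C(0, t), (z - 0)⁻¹ • f z)
      = Complex.I * ∫ θ in (-Real.pi)..Real.pi, f (circleMap 0 t θ) := by
    intro t ht
    have hper : Function.Periodic (fun θ => f (circleMap 0 t θ)) (2 * Real.pi) := fun θ => by
      simp only [periodic_circleMap 0 t θ]
    -- Polar coordinates use angles in `(-π, π)`, circle integrals use `[0, 2π]`; periodicity
    -- reconciles them.
    have h := hper.intervalIntegral_add_eq (-Real.pi) 0
    rw [show -Real.pi + 2 * Real.pi = Real.pi by ring, zero_add] at h
    rw [h, circleIntegral, ← intervalIntegral.integral_const_mul]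
    refine intervalIntegral.integral_congr (fun θ _ => ?_)
    have h0 : circleMap 0 t θ ≠ 0 := by simp [circleMap, ht.ne']
    simp only [deriv_circleMap, sub_zero, smul_eq_mul]
    field_simp
  have main : ∀ r s : ℝ, 0 < r → r ≤ s →
      (∮ z in C(0, s), (z - 0)⁻¹ • f z) = ∮ z in C(0, r), (z - 0)⁻¹ • f z := by
    intro r s hr hrs
    have hopen : IsOpen {z : ℂ | z ≠ 0} := isOpen_ne
    refine Complex.circleIntegral_sub_center_inv_smul_eq_of_differentiable_on_annulus_off_countable
      hr hrs Set.countable_empty (hf.continuousOn.mono ?_) ?_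
    · rintro z ⟨-, hz⟩ rfl
      exact hz (Metric.mem_ball_self hr)
    · rintro z ⟨⟨-, hz⟩, -⟩
      refine (hf z ?_).differentiableAt (hopen.mem_nhds ?_) <;>
      · rintro rfl
        exact hz (Metric.mem_closedBall_self hr.le)
  have h : (∮ z in C(0, r), (z - 0)⁻¹ • f z) = ∮ z in C(0, s), (z - 0)⁻¹ • f z := by
    rcases le_total r s with h | h
    · exact (main r s hr h).symm
    · exact main s r hs h
  rw [key r hr, key s hs] at h
  exact mul_left_cancel₀ Complex.I_ne_zero h

/-- With the product `z w = ρ²` kept fixed, enlarging the circle of `z` by `c` is the dilation `(c,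
c⁻¹)` of the pair `(z, z̄)`. -/
theorem div_circleMap {c ρ : ℝ} (hc : 0 < c) (hρ : 0 < ρ) (θ : ℝ) :
    ((ρ ^ 2 : ℝ) : ℂ) / circleMap 0 (c * ρ) θ = (c : ℂ)⁻¹ * conj (circleMap 0 ρ θ) := by
  have h0 : circleMap 0 ρ θ ≠ 0 := by simp [circleMap, hρ.ne']
  have hc' : (c : ℂ) ≠ 0 := by exact_mod_cast hc.ne'
  have h1 : circleMap 0 (c * ρ) θ = c * circleMap 0 ρ θ := by simp [circleMap]; ring
  have h2 : circleMap 0 ρ θ * conj (circleMap 0 ρ θ) = ((ρ ^ 2 : ℝ) : ℂ) := by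
    rw [Complex.mul_conj, Complex.normSq_eq_norm_sq, norm_circleMap_zero, sq_abs]
  rw [h1, ← h2]
  field_simp

/-- Plane integrals are invariant under `(z, z̄) ↦ (a z, a⁻¹ z̄)`. -/
theorem integral_dil_inv {F : ℂ → ℂ → ℂ} {a : ℝ} (ha : 0 < a)
    (holo : ∀ η : ℝ, 0 < η → DifferentiableOn ℂ (fun z : ℂ => F z ((η : ℂ) / z)) {z | z ≠ 0})
    (h1 : Integrable fun z : ℂ => F z (conj z))
    (h2 : Integrable fun z : ℂ => F ((a : ℂ) * z) ((a : ℂ)⁻¹ * conj z)) :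
    ∫ z : ℂ, F ((a : ℂ) * z) ((a : ℂ)⁻¹ * conj z) = ∫ z : ℂ, F z (conj z) := by
  rw [integral_polar h1, integral_polar h2]
  refine setIntegral_congr_fun measurableSet_Ioi (fun ρ hρ => ?_)
  have hρ : 0 < ρ := hρ
  congr 1
  -- At fixed `|z| = ρ` both integrands are values of `z ↦ F z (ρ²/z)`, on the circles of radius `a
  -- ρ` and `ρ`.
  have h := integral_circleMap_eq (holo (ρ ^ 2) (by positivity)) (mul_pos ha hρ)
    (mul_pos one_pos hρ)
  simp only [div_circleMap ha hρ, div_circleMap one_pos hρ] at h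
  convert h using 4 with θ
  · simp [circleMap]; ring
  · simp
  · simp

theorem integral_scale {f : ℂ → ℂ} {a : ℝ} (ha : 0 < a) :
    ∫ z : ℂ, f ((a : ℂ) * z) = ((a : ℂ) ^ 2)⁻¹ * ∫ z, f z := by
  have h := Measure.integral_comp_smul (volume : Measure ℂ) f a
  simp only [Complex.finrank_real_complex, Complex.real_smul] at h
  rw [h, abs_of_pos (by positivity)]
  push_cast
  rfl

theorem integrable_scale {f : ℂ → ℂ} {a : ℝ} (ha : 0 < a) :
    Integrable (fun z : ℂ => f ((a : ℂ) * z)) ↔ Integrable f := by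
  have h := integrable_comp_smul_iff (volume : Measure ℂ) f ha.ne'
  simpa only [Complex.real_smul] using h

theorem aestronglyMeasurable_scale {f : ℂ → ℂ} {a : ℝ} (ha : 0 < a)
    (hf : AEStronglyMeasurable f) : AEStronglyMeasurable fun z : ℂ => f ((a : ℂ) * z) := by
  have : Measure.QuasiMeasurePreserving (fun z : ℂ => a • z) volume volume :=
    Measure.quasiMeasurePreserving_smul volume ha.ne'
  simpa only [Complex.real_smul, Function.comp_def] using hf.comp_quasiMeasurePreserving this

theorem ae_ne_zero : ∀ᵐ z : ℂ, z ≠ 0 := by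
  simp [ae_iff]

/-! ### Functions that continue analytically to complex angles -/

/-- The condition of `IsAdmissible` at a single parameter. -/
structure Regular (F : ℂ → ℂ → ℂ) : Prop where
  holo : ∀ η : ℝ, 0 < η → DifferentiableOn ℂ (fun z : ℂ => F z ((η : ℂ) / z)) {z | z ≠ 0}
  bdd : ∀ r : ℝ, ∃ C : ℝ, ∀ z w : ℂ, 0 < z * w → ‖z‖ ≤ r * ‖w‖ → ‖w‖ ≤ r * ‖z‖ → ‖F z w‖ ≤ C
  meas : ∀ s t : ℝ, 0 < s → 0 < t →
    AEStronglyMeasurable (fun z : ℂ => F ((s : ℂ) * z) ((t : ℂ) * conj z))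

theorem isAdmissible_iff {q : ℝ} {ψ : Family} :
    IsAdmissible q ψ ↔ Regular (ψ q) ∧ Regular (ψ q⁻¹) := by
  constructor
  · intro h
    exact ⟨⟨h.holo q (.inl rfl), h.bdd q (.inl rfl), h.meas q (.inl rfl)⟩,
      ⟨h.holo _ (.inr rfl), h.bdd _ (.inr rfl), h.meas _ (.inr rfl)⟩⟩
  · rintro ⟨h1, h2⟩
    constructor
    · rintro p (rfl | rfl)
      exacts [h1.holo, h2.holo]
    · rintro p (rfl | rfl)
      exacts [h1.bdd, h2.bdd]
    · rintro p (rfl | rfl)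
      exacts [h1.meas, h2.meas]

namespace Regular

variable {F G : ℂ → ℂ → ℂ}

theorem mul (hF : Regular F) (hG : Regular G) : Regular fun z w => F z w * G z w where
  holo η hη := (hF.holo η hη).mul (hG.holo η hη)
  bdd r := by
    obtain ⟨C, hC⟩ := hF.bdd r
    obtain ⟨D, hD⟩ := hG.bdd r
    refine ⟨C * D, fun z w h1 h2 h3 => ?_⟩
    rw [norm_mul]
    exact mul_le_mul (hC z w h1 h2 h3) (hD z w h1 h2 h3) (norm_nonneg _)
      ((norm_nonneg _).trans (hC z w h1 h2 h3))
  meas s t hs ht := (hF.meas s t hs ht).mul (hG.meas s t hs ht)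

theorem add (hF : Regular F) (hG : Regular G) : Regular fun z w => F z w + G z w where
  holo η hη := (hF.holo η hη).add (hG.holo η hη)
  bdd r := by
    obtain ⟨C, hC⟩ := hF.bdd r
    obtain ⟨D, hD⟩ := hG.bdd r
    exact ⟨C + D, fun z w h1 h2 h3 =>
      (norm_add_le _ _).trans (add_le_add (hC z w h1 h2 h3) (hD z w h1 h2 h3))⟩
  meas s t hs ht := (hF.meas s t hs ht).add (hG.meas s t hs ht)

theorem const (c : ℂ) : Regular fun _ _ => c where
  holo _ _ := differentiableOn_const c
  bdd _ := ⟨‖c‖, fun _ _ _ _ _ => le_rfl⟩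
  meas _ _ _ _ := aestronglyMeasurable_const

theorem dil (hF : Regular F) {a b : ℝ} (ha : 0 < a) (hb : 0 < b) :
    Regular fun z w => F ((a : ℂ) * z) ((b : ℂ) * w) where
  holo η hη := by
    have ha' : (a : ℂ) ≠ 0 := by exact_mod_cast ha.ne'
    have h := (hF.holo (a * b * η) (by positivity)).comp
      (f := fun z : ℂ => (a : ℂ) * z) (s := {z | z ≠ 0}) (by fun_prop)
      (fun z hz => mul_ne_zero ha' hz)
    refine h.congr (fun z hz => ?_)
    have hz : z ≠ 0 := hz
    simp only [Function.comp]
    congr 1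
    push_cast
    field_simp
  bdd r := by
    -- The dilation changes the ratio of the moduli by `a / b` or its inverse; the sum covers both,
    -- and `|r|` keeps the constant nonnegative.
    obtain ⟨C, hC⟩ := hF.bdd (|r| * (a / b + b / a))
    refine ⟨C, fun z w h1 h2 h3 => hC _ _ ?_ ?_ ?_⟩
    · have hab : (0 : ℂ) < ((a * b : ℝ) : ℂ) := by exact_mod_cast mul_pos ha hb
      have := mul_pos hab h1
      push_cast at this
      convert this using 1
      ring
    · simp only [norm_mul, Complex.norm_real, Real.norm_eq_abs, abs_of_pos ha, abs_of_pos hb]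
      have h4 : a * ‖z‖ ≤ a * (|r| * ‖w‖) := by
        gcongr
        exact h2.trans (by gcongr; exact le_abs_self r)
      refine h4.trans ?_
      have : |r| * (a / b + b / a) * (b * ‖w‖) = a * (|r| * ‖w‖) + |r| * (b / a) * (b * ‖w‖) := by
        field_simp
      rw [this]
      have : 0 ≤ |r| * (b / a) * (b * ‖w‖) := by positivity
      linarith
    · simp only [norm_mul, Complex.norm_real, Real.norm_eq_abs, abs_of_pos ha, abs_of_pos hb]
      have h4 : b * ‖w‖ ≤ b * (|r| * ‖z‖) := by
        gcongr
        exact h3.trans (by gcongr; exact le_abs_self r)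
      refine h4.trans ?_
      have : |r| * (a / b + b / a) * (a * ‖z‖) = b * (|r| * ‖z‖) + |r| * (a / b) * (a * ‖z‖) := by
        field_simp
        ring
      rw [this]
      have : 0 ≤ |r| * (a / b) * (a * ‖z‖) := by positivity
      linarith
  meas s t hs ht := by
    have h := hF.meas (a * s) (b * t) (mul_pos ha hs) (mul_pos hb ht)
    simpa only [Complex.ofReal_mul, mul_assoc] using h

/-- On the plane `w = conj z` this is the pointwise conjugate of `F`. Exchanging the two variables
is what makes its continuation holomorphic in the angle instead of antiholomorphic. -/
theorem star (hF : Regular F) : Regular fun z w => conj (F (conj w) (conj z)) where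
  holo η hη z hz := by
    have hz : z ≠ 0 := hz
    have hη' : (η : ℂ) ≠ 0 := by exact_mod_cast hη.ne'
    set G : ℂ → ℂ := fun z => F z ((η : ℂ) / z) with hG
    have hopen : IsOpen {z : ℂ | z ≠ 0} := isOpen_ne
    have h1 : DifferentiableAt ℂ G (conj ((η : ℂ) / z)) :=
      (hF.holo η hη).differentiableAt
        (hopen.mem_nhds (by simpa using ⟨hη.ne', hz⟩))
    have h2 : DifferentiableAt ℂ (conj ∘ G ∘ conj) ((η : ℂ) / z) := by
      have := h1.conj_conj
      rwa [Complex.conj_conj] at this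
    have h3 : DifferentiableAt ℂ (fun z : ℂ => (η : ℂ) / z) z := by fun_prop (disch := exact hz)
    have h4 := (h2.comp z h3).differentiableWithinAt (s := {z | z ≠ 0})
    refine h4.congr (fun y hy => ?_) ?_
    · have hy : conj y ≠ 0 := (map_ne_zero _).2 hy
      simp only [Function.comp, hG, map_div₀, Complex.conj_ofReal]
      congr 2
      field_simp
    · have hy : conj z ≠ 0 := (map_ne_zero _).2 hz
      simp only [Function.comp, hG, map_div₀, Complex.conj_ofReal]
      congr 2
      field_simp
  bdd r := by
    obtain ⟨C, hC⟩ := hF.bdd r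
    refine ⟨C, fun z w h1 h2 h3 => ?_⟩
    rw [Complex.norm_conj]
    refine hC _ _ ?_ ?_ ?_
    · rw [← map_mul, mul_comm]
      rw [Complex.pos_iff] at h1 ⊢
      rw [Complex.conj_re, Complex.conj_im, ← h1.2]
      exact ⟨h1.1, neg_zero.symm⟩
    · simpa only [Complex.norm_conj] using h3
    · simpa only [Complex.norm_conj] using h2
  meas s t hs ht := by
    have h := Complex.continuous_conj.comp_aestronglyMeasurable (hF.meas t s ht hs)
    simpa only [map_mul, Complex.conj_ofReal, Complex.conj_conj] using h

theorem aestronglyMeasurable (hF : Regular F) :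
    AEStronglyMeasurable fun z : ℂ => F z (conj z) := by
  simpa using hF.meas 1 1 one_pos one_pos

theorem exists_bound (hF : Regular F) : ∃ C : ℝ, ∀ z : ℂ, z ≠ 0 → ‖F z (conj z)‖ ≤ C := by
  obtain ⟨C, hC⟩ := hF.bdd 1
  refine ⟨C, fun z hz => hC _ _ ?_ (by simp) (by simp)⟩
  rw [Complex.mul_conj]
  exact_mod_cast Complex.normSq_pos.2 hz

theorem integrable (hF : Regular F) {g : ℂ → ℂ} (hg : Integrable g) :
    Integrable fun z : ℂ => g z * F z (conj z) := by
  obtain ⟨C, hC⟩ := hF.exists_bound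
  exact hg.mul_bdd hF.aestronglyMeasurable (ae_ne_zero.mono hC)

/-- Dilation by `(a, a⁻¹)` in the presence of a radial weight and a power of `z`. -/
theorem integral_weight (hF : Regular F) {K : ℝ → ℝ} {e : ℤ}
    (hK : Integrable fun z : ℂ => (K (‖z‖ ^ 2) : ℂ) * z ^ e) {a : ℝ} (ha : 0 < a) :
    ∫ z : ℂ, (K (‖z‖ ^ 2) : ℂ) * z ^ e * F ((a : ℂ) * z) ((a : ℂ)⁻¹ * conj z)
      = ((a : ℂ) ^ e)⁻¹ * ∫ z : ℂ, (K (‖z‖ ^ 2) : ℂ) * z ^ e * F z (conj z) := by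
  have ha' : (a : ℂ) ≠ 0 := by exact_mod_cast ha.ne'
  have hdil := hF.dil ha (inv_pos.2 ha)
  -- The weight depends on `z w` only, so it is constant along each contour; the power of `z` is
  -- holomorphic off the origin and contributes the factor `a ^ e`.
  have h := integral_dil_inv (F := fun z w => (K (z * w).re : ℂ) * z ^ e * F z w) ha ?_ ?_ ?_
  · have e1 : ∀ z : ℂ, ((a : ℂ) * z * ((a : ℂ)⁻¹ * conj z)).re = ‖z‖ ^ 2 := fun z => by
      rw [show (a : ℂ) * z * ((a : ℂ)⁻¹ * conj z) = z * conj z by field_simp,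
        Complex.mul_conj, Complex.normSq_eq_norm_sq, Complex.ofReal_re]
    have e2 : ∀ z : ℂ, (z * conj z).re = ‖z‖ ^ 2 := fun z => by
      rw [Complex.mul_conj, Complex.normSq_eq_norm_sq, Complex.ofReal_re]
    simp only [e1, e2] at h
    rw [← h, ← integral_const_mul]
    congr 1
    ext z
    rw [mul_zpow]
    have := zpow_ne_zero e ha'
    field_simp
  · intro η hη z hz
    have hz : z ≠ 0 := hz
    have h1 : DifferentiableWithinAt ℂ (fun z : ℂ => (K η : ℂ) * z ^ e * F z ((η : ℂ) / z))
        {z | z ≠ 0} z :=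
      ((differentiableAt_zpow.2 (.inl hz)).differentiableWithinAt.const_mul _).mul
        (hF.holo η hη z hz)
    refine h1.congr (fun y hy => ?_) ?_
    · have hy : y ≠ 0 := hy
      simp [mul_div_cancel₀ (η : ℂ) hy]
    · simp [mul_div_cancel₀ (η : ℂ) hz]
  · have := hF.integrable hK
    simpa only [Complex.mul_conj, Complex.normSq_eq_norm_sq, Complex.ofReal_re] using this
  · have := (hdil.integrable hK).const_mul ((a : ℂ) ^ e)
    refine this.congr (Filter.Eventually.of_forall fun z => ?_)
    simp only
    rw [show (a : ℂ) * z * ((a : ℂ)⁻¹ * conj z) = z * conj z by field_simp,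
        Complex.mul_conj, Complex.normSq_eq_norm_sq, Complex.ofReal_re, mul_zpow]
    push_cast
    ring

end Regular

/-! ### Radial weights -/

theorem integrable_inv_one_add_sq_sq :
    Integrable fun z : ℂ => ((1 + ‖z‖ ^ 2) ^ 2)⁻¹ := by
  rw [integrable_fun_norm_addHaar (volume : Measure ℂ) (f := fun y : ℝ => ((1 + y ^ 2) ^ 2)⁻¹)]
  rw [Complex.finrank_real_complex]
  refine Integrable.mono' integrable_inv_one_add_sq.integrableOn
    (by fun_prop : Measurable fun y : ℝ => y ^ (2 - 1) • ((1 + y ^ 2) ^ 2)⁻¹).aestronglyMeasurable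
    (Filter.Eventually.of_forall fun y => ?_)
  have h : (0 : ℝ) < 1 + y ^ 2 := by positivity
  rw [smul_eq_mul, pow_one, norm_mul, Real.norm_eq_abs, norm_inv, norm_pow, Real.norm_eq_abs,
    abs_of_pos h, ← div_eq_mul_inv, div_le_iff₀ (by positivity), inv_mul_eq_div, sq (1 + y ^ 2),
    mul_div_assoc, div_self h.ne', mul_one]
  nlinarith [sq_abs y, sq_nonneg (|y| - 1)]

/-- Serves the terms of the generators containing `z⁻¹`: the singularity at the origin is absorbed
by the area element `ρ dρ`. -/
theorem integrable_inv_norm_mul :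
    Integrable fun z : ℂ => ‖z‖⁻¹ * (1 + ‖z‖ ^ 2)⁻¹ := by
  rw [integrable_fun_norm_addHaar (volume : Measure ℂ) (f := fun y : ℝ => y⁻¹ * (1 + y ^ 2)⁻¹)]
  rw [Complex.finrank_real_complex]
  refine (integrable_inv_one_add_sq.integrableOn (s := Set.Ioi 0)).congr_fun
    (fun y hy => ?_) measurableSet_Ioi
  have hy : (0 : ℝ) < y := hy
  simp only [smul_eq_mul]
  field_simp
  norm_num

theorem integrable_weight_zero {K : ℝ → ℝ} (hm : Measurable K) {C : ℝ}
    (hK : ∀ η, 0 ≤ η → |K η| ≤ C * ((1 + η) ^ 2)⁻¹) :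
    Integrable fun z : ℂ => (K (‖z‖ ^ 2) : ℂ) * z ^ (0 : ℤ) := by
  refine (integrable_inv_one_add_sq_sq.const_mul C).mono'
    (Measurable.aestronglyMeasurable (by fun_prop)) (Filter.Eventually.of_forall fun z => ?_)
  simpa using hK (‖z‖ ^ 2) (by positivity)

theorem integrable_weight_neg_one {K : ℝ → ℝ} (hm : Measurable K) {C : ℝ}
    (hK : ∀ η, 0 ≤ η → |K η| ≤ C * (1 + η)⁻¹) :
    Integrable fun z : ℂ => (K (‖z‖ ^ 2) : ℂ) * z ^ (-1 : ℤ) := by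
  refine (integrable_inv_norm_mul.const_mul C).mono'
    (Measurable.aestronglyMeasurable (by simp only [zpow_neg_one]; fun_prop))
    (Filter.Eventually.of_forall fun z => ?_)
  have h := mul_le_mul_of_nonneg_left (hK (‖z‖ ^ 2) (by positivity)) (inv_nonneg.2 (norm_nonneg z))
  simp only [norm_mul, Complex.norm_real, Real.norm_eq_abs, zpow_neg_one, norm_inv]
  linarith

/-- The weight in the first half of the form. -/
noncomputable def weight (p η : ℝ) : ℝ := p⁻¹ / ((1 + η) * (1 + (p ^ 2)⁻¹ * η))

theorem measurable_weight (p : ℝ) : Measurable (weight p) := by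
  unfold weight; fun_prop

theorem one_add_le {p η : ℝ} (hp : 0 < p) (hη : 0 ≤ η) :
    1 + η ≤ (1 + p ^ 2) * (1 + (p ^ 2)⁻¹ * η) := by
  have h1 : (1 + p ^ 2) * (1 + (p ^ 2)⁻¹ * η) = 1 + η + (p ^ 2 + (p ^ 2)⁻¹ * η) := by
    field_simp; ring
  have : 0 ≤ p ^ 2 + (p ^ 2)⁻¹ * η := by positivity
  linarith

theorem abs_weight_le {p η : ℝ} (hp : 0 < p) (hη : 0 ≤ η) :
    |weight p η| ≤ p⁻¹ * (1 + p ^ 2) * ((1 + η) ^ 2)⁻¹ := by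
  have h := one_add_le hp hη
  have h2 : 0 < 1 + (p ^ 2)⁻¹ * η := by positivity
  unfold weight
  rw [abs_of_nonneg (by positivity), div_le_iff₀ (by positivity)]
  have e : p⁻¹ * (1 + p ^ 2) * ((1 + η) ^ 2)⁻¹ * ((1 + η) * (1 + (p ^ 2)⁻¹ * η))
    = p⁻¹ * ((1 + p ^ 2) * (1 + (p ^ 2)⁻¹ * η) / (1 + η)) := by field_simp
  rw [e]
  refine le_mul_of_one_le_right (by positivity) ?_
  rwa [one_le_div (by positivity)]

theorem abs_weight_le' {p η : ℝ} (hp : 0 < p) (hη : 0 ≤ η) :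
    |weight p η| ≤ p⁻¹ * (1 + p ^ 2) * (1 + η)⁻¹ := by
  refine (abs_weight_le hp hη).trans ?_
  gcongr
  nlinarith

theorem abs_mul_weight_le {p η : ℝ} (hp : 0 < p) (hη : 0 ≤ η) :
    |η * weight p η| ≤ p⁻¹ * (1 + p ^ 2) * (1 + η)⁻¹ := by
  rw [abs_mul, abs_of_nonneg hη]
  refine (mul_le_mul_of_nonneg_left (abs_weight_le hp hη) hη).trans ?_
  have e : η * (p⁻¹ * (1 + p ^ 2) * ((1 + η) ^ 2)⁻¹)
    = p⁻¹ * (1 + p ^ 2) * (1 + η)⁻¹ * (η / (1 + η)) := by field_simp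
  rw [e]
  refine mul_le_of_le_one_right (by positivity) ?_
  rw [div_le_one (by positivity)]
  linarith

theorem integrable_weight {p : ℝ} (hp : 0 < p) :
    Integrable fun z : ℂ => (weight p (‖z‖ ^ 2) : ℂ) := by
  have := integrable_weight_zero (measurable_weight p) (fun η hη => abs_weight_le hp hη)
  simpa using this

/-! ### The two halves of the form -/

/-- The first term of `formIntegrand`; the second one is `half q⁻¹`. -/
noncomputable def half (p : ℝ) (ψ₁ ψ₂ : Family) (z : ℂ) : ℂ :=
  conj (ψ₁ p⁻¹ z (conj z)) * (weight p (‖z‖ ^ 2) : ℂ)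
    * ψ₂ p ((p : ℂ)⁻¹ * z) ((p : ℂ)⁻¹ * conj z)

theorem formIntegrand_eq (q : ℝ) (ψ₁ ψ₂ : Family) (z : ℂ) :
    formIntegrand q ψ₁ ψ₂ z = half q ψ₁ ψ₂ z + half q⁻¹ ψ₁ ψ₂ z := by
  simp [formIntegrand, half, weight]

/-- The constant in front of the form. -/
noncomputable def formConst (q : ℝ) : ℝ := (q - q⁻¹) / (2 * Real.log q)

theorem form_eq {q : ℝ} {ψ₁ ψ₂ : Family} (h1 : Integrable (half q ψ₁ ψ₂))
    (h2 : Integrable (half q⁻¹ ψ₁ ψ₂)) :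
    form q ψ₁ ψ₂
      = (formConst q : ℂ) * ((∫ z : ℂ, half q ψ₁ ψ₂ z) + ∫ z : ℂ, half q⁻¹ ψ₁ ψ₂ z) := by
  simp only [form, formIntegrand_eq]
  rw [integral_add h1 h2]
  rfl

theorem integrable_formIntegrand {q : ℝ} {ψ₁ ψ₂ : Family} (h1 : Integrable (half q ψ₁ ψ₂))
    (h2 : Integrable (half q⁻¹ ψ₁ ψ₂)) : Integrable (formIntegrand q ψ₁ ψ₂) := by
  have : formIntegrand q ψ₁ ψ₂ = fun z => half q ψ₁ ψ₂ z + half q⁻¹ ψ₁ ψ₂ z :=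
    funext fun z => formIntegrand_eq q ψ₁ ψ₂ z
  rw [this]
  exact h1.add h2

/-- The halves are exchanged, and the prefactor is a quotient of two functions odd under inversion
of `q`. Norms thus need to be computed for `q < 1` only. -/
theorem form_inv (q : ℝ) (ψ₁ ψ₂ : Family) : form q⁻¹ ψ₁ ψ₂ = form q ψ₁ ψ₂ := by
  have h : formIntegrand q⁻¹ ψ₁ ψ₂ = formIntegrand q ψ₁ ψ₂ := by
    funext z
    rw [formIntegrand_eq, formIntegrand_eq, inv_inv, add_comm]
  have h2 : (q⁻¹ - q⁻¹⁻¹) / (2 * Real.log q⁻¹) = (q - q⁻¹) / (2 * Real.log q) := by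
    rw [inv_inv, Real.log_inv, mul_neg, div_neg, ← neg_div, neg_sub]
  simp only [form, h, h2]

theorem weight_scale {p η : ℝ} (hp : 0 < p) : p ^ 2 * weight p (p ^ 2 * η) = weight p⁻¹ η := by
  unfold weight
  rw [inv_pow, inv_inv, inv_inv, inv_mul_cancel_left₀ (by positivity)]
  field_simp

/-- The substitution `z ↦ p z` undoes the dilation of the right argument and applies one to the left
argument; conjugation then restores the shape of a half, at the inverse parameter. The factor `p ^
2` is the Jacobian and is used up by `weight_scale`. -/
theorem conj_half_scale {p : ℝ} (hp : 0 < p) (ψ φ : Family) (z : ℂ) :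
    (p : ℂ) ^ 2 * conj (half p ψ φ ((p : ℂ) * z)) = half p⁻¹ φ ψ z := by
  have hp' : (p : ℂ) ≠ 0 := by exact_mod_cast hp.ne'
  have e : ‖(p : ℂ) * z‖ ^ 2 = p ^ 2 * ‖z‖ ^ 2 := by
    rw [norm_mul, Complex.norm_real, Real.norm_eq_abs, mul_pow, sq_abs]
  simp only [half, map_mul, Complex.conj_conj, Complex.conj_ofReal, e, inv_inv,
    inv_mul_cancel_left₀ hp', ← weight_scale hp, Complex.ofReal_inv]
  push_cast
  ring

theorem integrable_half_symm {p : ℝ} (hp : 0 < p) {ψ φ : Family}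
    (h : Integrable (half p ψ φ)) : Integrable (half p⁻¹ φ ψ) := by
  have h1 := (integrable_scale hp).2 h
  have h2 : Integrable fun z : ℂ => conj (half p ψ φ ((p : ℂ) * z)) :=
    (LinearIsometryEquiv.integrable_comp_iff Complex.conjLIE).2 h1
  refine (h2.const_mul ((p : ℂ) ^ 2)).congr (Filter.Eventually.of_forall fun z => ?_)
  exact conj_half_scale hp ψ φ z

theorem integral_half_symm {p : ℝ} (hp : 0 < p) (ψ φ : Family) :
    ∫ z, half p⁻¹ φ ψ z = conj (∫ z, half p ψ φ z) := by
  have hp' : (p : ℂ) ≠ 0 := by exact_mod_cast hp.ne'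
  simp only [← conj_half_scale hp ψ φ]
  rw [integral_const_mul, integral_conj, integral_scale hp, map_mul, map_inv₀, map_pow,
    Complex.conj_ofReal, mul_inv_cancel_left₀ (pow_ne_zero 2 hp')]

theorem form_conj {q : ℝ} (hq : 0 < q) {ψ φ : Family} (h1 : Integrable (half q ψ φ))
    (h2 : Integrable (half q⁻¹ ψ φ)) : form q φ ψ = conj (form q ψ φ) := by
  have h1' := integrable_half_symm hq h1
  have h2' := integrable_half_symm (inv_pos.2 hq) h2
  have e2 := integral_half_symm (inv_pos.2 hq) ψ φ
  rw [inv_inv] at h2' e2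
  rw [form_eq h1 h2, form_eq h2' h1', e2, integral_half_symm hq ψ φ, map_mul, map_add,
    Complex.conj_ofReal, add_comm]

theorem integrable_half {p : ℝ} (hp : 0 < p) {ψ φ : Family} (hψ : Regular (ψ p⁻¹))
    (hφ : Regular (φ p)) : Integrable (half p ψ φ) := by
  have h := (hψ.star.mul (hφ.dil (inv_pos.2 hp) (inv_pos.2 hp))).integrable (integrable_weight hp)
  refine h.congr (Filter.Eventually.of_forall fun z => ?_)
  simp only [half, Complex.conj_conj, Complex.ofReal_inv]
  ring

/-! ### Adjointness of the raising and lowering generators -/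

/-- Expanding the brackets gives four dilated values, two of which sit at the same point `(p z, p
w)`. Writing everything in `c = p^{N/2}` leaves integer powers only, so that algebra applies. -/
theorem Hplus_apply (N : ℝ) (ψ : Family) {p : ℝ} (hp : 0 < p) (z w : ℂ) {c : ℝ}
    (hc : c = p ^ (N / 2)) :
    Hplus N ψ p z w
      = -((c : ℂ)⁻¹ * (z⁻¹ + w) * ψ p (p * z) (p * w) - (c : ℂ)⁻¹ * z⁻¹ * ψ p ((p : ℂ)⁻¹ * z) (p * w)
          - (c : ℂ) ^ 3 * w * ψ p (p * z) ((p : ℂ)⁻¹ * w)) / ((p : ℂ) - (p : ℂ)⁻¹) := by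
  have hN : p ^ N = c ^ 2 := by
    rw [hc, ← Real.rpow_natCast, ← Real.rpow_mul hp.le]; norm_num
  have hc0 : (c : ℂ) ≠ 0 := by
    rw [hc]; exact_mod_cast (Real.rpow_pos_of_pos hp _).ne'
  simp only [Hplus, bracketT, bracketTbar, scal, dil, neg_neg, neg_zero, Real.rpow_zero,
    Real.rpow_one, Real.rpow_neg hp.le, ← hc, hN, Complex.ofReal_one, one_mul, Complex.ofReal_inv,
    Complex.ofReal_sub, Complex.ofReal_pow]
  field_simp
  ring

theorem Hminus_apply (N : ℝ) (ψ : Family) {p : ℝ} (hp : 0 < p) (z w : ℂ) {c : ℝ}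
    (hc : c = p ^ (N / 2)) :
    Hminus N ψ p z w
      = ((c : ℂ) * (z + w⁻¹) * ψ p (p * z) (p * w)
          - ((c : ℂ)⁻¹) ^ 3 * z * ψ p ((p : ℂ)⁻¹ * z) (p * w)
          - (c : ℂ) * w⁻¹ * ψ p (p * z) ((p : ℂ)⁻¹ * w)) / ((p : ℂ) - (p : ℂ)⁻¹) := by
  have hN : p ^ N = c ^ 2 := by
    rw [hc, ← Real.rpow_natCast, ← Real.rpow_mul hp.le]; norm_num
  have hc0 : (c : ℂ) ≠ 0 := by
    rw [hc]; exact_mod_cast (Real.rpow_pos_of_pos hp _).ne'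
  simp only [Hminus, bracketT, bracketTbar, scal, dil, neg_zero, Real.rpow_zero,
    Real.rpow_one, Real.rpow_neg hp.le, ← hc, hN, Complex.ofReal_one, one_mul, Complex.ofReal_inv,
    Complex.ofReal_sub, Complex.ofReal_pow]
  field_simp
  ring

theorem integral_lin_comb {A B C H : ℂ → ℂ} (hA : Integrable A) (hB : Integrable B)
    (hC : Integrable C) (a b c : ℂ) (h : ∀ᵐ z, a * A z + b * B z + c * C z = H z) :
    Integrable H ∧ ∫ z, H z = a * (∫ z, A z) + b * (∫ z, B z) + c * ∫ z, C z := by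
  have hA' := hA.const_mul a
  have hB' := hB.const_mul b
  have hC' := hC.const_mul c
  have hAB : Integrable fun z => a * A z + b * B z := hA'.add hB'
  refine ⟨(hAB.add hC').congr h, ?_⟩
  rw [← integral_congr_ae h, integral_add hAB hC', integral_add hA' hB', integral_const_mul,
    integral_const_mul, integral_const_mul]

/-- In the jointly dilated term the prefactor is `p z⁻¹ (1 + p⁻² η)`, which cancels one factor of
the weight. Each of the three terms becomes a radial kernel times `z⁻¹` times a regular function. -/
theorem half_Hplus_terms {p η : ℝ} (hp : 0 < p) (hη : 0 ≤ η) {z w : ℂ} (hz : z ≠ 0)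
    (hzw : z * w = η) (c d f g₁ g₂ g₃ : ℂ) :
    -(c⁻¹ * p / d) * (((p⁻¹ * (1 + η)⁻¹ : ℝ) : ℂ) * z ^ (-1 : ℤ) * (f * g₁))
      + c⁻¹ * p / d * (((weight p η : ℝ) : ℂ) * z ^ (-1 : ℤ) * (f * g₂))
      + c ^ 3 * (p : ℂ)⁻¹ / d * (((η * weight p η : ℝ) : ℂ) * z ^ (-1 : ℤ) * (f * g₃))
    = f * (weight p η : ℂ) * (-(c⁻¹ * (((p : ℂ)⁻¹ * z)⁻¹ + (p : ℂ)⁻¹ * w) * g₁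
      - c⁻¹ * ((p : ℂ)⁻¹ * z)⁻¹ * g₂ - c ^ 3 * ((p : ℂ)⁻¹ * w) * g₃) / d) := by
  have hp' : (p : ℂ) ≠ 0 := by exact_mod_cast hp.ne'
  have hw : w = η / z := by rw [← hzw]; field_simp
  have e1 : p⁻¹ * (1 + η)⁻¹ = weight p η * (1 + (p ^ 2)⁻¹ * η) := by
    unfold weight
    have : 0 < 1 + (p ^ 2)⁻¹ * η := by positivity
    have : 0 < 1 + η := by positivity
    rw [div_mul_eq_mul_div, eq_div_iff (by positivity)]
    field_simp
  rw [e1, hw]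
  push_cast
  generalize (weight p η : ℂ) = k
  rw [zpow_neg_one, mul_inv, inv_inv]
  simp only [div_eq_mul_inv]
  generalize d⁻¹ = d'
  generalize c⁻¹ = c'
  field_simp
  ring

/-- Here the prefactor is `z⁻¹ (1 + η)` and cancels the other factor of the weight, so the first
kernel is the one of `half_Hplus_terms` taken at `p⁻¹ z`. The sign of `d` reflects that the left
argument is taken at `p⁻¹`. -/
theorem half_Hminus_terms {p η : ℝ} (hp : 0 < p) (hη : 0 ≤ η) {z w : ℂ} (hz : z ≠ 0)
    (hzw : z * w = η) (c d f₁ f₂ f₃ g : ℂ) :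
    -(c⁻¹ * (p : ℂ)⁻¹ / d) * (((p⁻¹ * (1 + (p ^ 2)⁻¹ * η)⁻¹ : ℝ) : ℂ) * ((p : ℂ)⁻¹ * z) ^ (-1 : ℤ)
        * (f₁ * g))
      + c⁻¹ / d * (((weight p η : ℝ) : ℂ) * z ^ (-1 : ℤ) * (f₂ * g))
      + c ^ 3 / d * (((η * weight p η : ℝ) : ℂ) * z ^ (-1 : ℤ) * (f₃ * g))
    = (c⁻¹ * (w + z⁻¹) * f₁ - c ^ 3 * w * f₃ - c⁻¹ * z⁻¹ * f₂) / (-d) * (weight p η : ℂ) * g := by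
  have hp' : (p : ℂ) ≠ 0 := by exact_mod_cast hp.ne'
  have hw : w = η / z := by rw [← hzw]; field_simp
  have e1 : p⁻¹ * (1 + (p ^ 2)⁻¹ * η)⁻¹ = weight p η * (1 + η) := by
    unfold weight
    have : 0 < 1 + (p ^ 2)⁻¹ * η := by positivity
    have : 0 < 1 + η := by positivity
    rw [div_mul_eq_mul_div, eq_div_iff (by positivity)]
    field_simp
  rw [e1, hw]
  push_cast
  generalize (weight p η : ℂ) = k
  rw [zpow_neg_one, zpow_neg_one, mul_inv, inv_inv, div_neg]
  simp only [div_eq_mul_inv]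
  generalize d⁻¹ = d'
  generalize c⁻¹ = c'
  field_simp
  ring

/-- The three terms on the two sides correspond one to one. The first pair is related by the change
of variables `z ↦ p⁻¹ z`, the other two by the dilations `(p, p⁻¹)` and `(p⁻¹, p)`, which leave the
radial kernels alone and multiply `z⁻¹` by a constant. -/
theorem half_Hplus_Hminus (N : ℝ) {p : ℝ} (hp : 0 < p) {ψ φ : Family} (hψ : Regular (ψ p⁻¹))
    (hφ : Regular (φ p)) :
    Integrable (half p ψ (Hplus N φ)) ∧ Integrable (half p (Hminus N ψ) φ) ∧
      ∫ z, half p ψ (Hplus N φ) z = ∫ z, half p (Hminus N ψ) φ z := by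
  have hp' : (p : ℂ) ≠ 0 := by exact_mod_cast hp.ne'
  have hpi : 0 < p⁻¹ := inv_pos.2 hp
  obtain ⟨c, hc⟩ : ∃ c, c = p ^ (N / 2) := ⟨_, rfl⟩
  have hci : c⁻¹ = p⁻¹ ^ (N / 2) := by rw [hc, Real.inv_rpow hp.le]
  obtain ⟨d, hd⟩ : ∃ d : ℂ, d = (p : ℂ) - (p : ℂ)⁻¹ := ⟨_, rfl⟩
  obtain ⟨f, hf⟩ : ∃ f : ℂ → ℂ → ℂ, f = fun z w => conj (ψ p⁻¹ (conj w) (conj z)) := ⟨_, rfl⟩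
  have hfR : Regular f := hf ▸ hψ.star
  have hzz : ∀ z : ℂ, z * conj z = ((‖z‖ ^ 2 : ℝ) : ℂ) := fun z => by
    rw [Complex.mul_conj, Complex.normSq_eq_norm_sq]
  have hK1 : Integrable fun z : ℂ => ((p⁻¹ * (1 + ‖z‖ ^ 2)⁻¹ : ℝ) : ℂ) * z ^ (-1 : ℤ) :=
    integrable_weight_neg_one (K := fun η => p⁻¹ * (1 + η)⁻¹) (C := p⁻¹) (by fun_prop)
      fun η hη => (abs_of_nonneg (by positivity)).le
  have hK2 : Integrable fun z : ℂ => ((weight p (‖z‖ ^ 2) : ℝ) : ℂ) * z ^ (-1 : ℤ) :=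
    integrable_weight_neg_one (measurable_weight p) fun η hη => abs_weight_le' hp hη
  have hK3 : Integrable fun z : ℂ =>
      ((‖z‖ ^ 2 * weight p (‖z‖ ^ 2) : ℝ) : ℂ) * z ^ (-1 : ℤ) :=
    integrable_weight_neg_one (K := fun η => η * weight p η)
      (measurable_id.mul (measurable_weight p)) fun η hη => abs_mul_weight_le hp hη
  have hF1 : Regular fun z w => f z w * φ p z w := hfR.mul hφ
  -- After the dilation by `(p, p⁻¹)` the second factor sits at `(p⁻¹ z, p⁻¹ w)`, where the right
  -- argument is evaluated in the other integrand; the third term behaves likewise with `z` and `w`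
  -- exchanged.
  have hF2 := hfR.mul (hφ.dil (mul_pos hpi hpi) one_pos)
  have hF3 := hfR.mul (hφ.dil one_pos (mul_pos hpi hpi))
  have i1 := hF1.integrable hK1
  have i1' := (integrable_scale hpi).2 i1
  have i2' := (hF2.dil hp hpi).integrable hK2
  have i3' := (hF3.dil hpi hp).integrable hK3
  have j1 := integral_scale (f := fun z : ℂ => ((p⁻¹ * (1 + ‖z‖ ^ 2)⁻¹ : ℝ) : ℂ) * z ^ (-1 : ℤ)
    * (f z (conj z) * φ p z (conj z))) hpi
  have j2 := hF2.integral_weight hK2 hp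
  have j3 := hF3.integral_weight (K := fun η => η * weight p η) hK3 hpi
  obtain ⟨IL, EL⟩ := integral_lin_comb (H := half p ψ (Hplus N φ))
    i1 (hF2.integrable hK2) (hF3.integrable hK3)
    (-((c : ℂ)⁻¹ * p / d) : ℂ) ((c : ℂ)⁻¹ * p / d) ((c : ℂ) ^ 3 * (p : ℂ)⁻¹ / d) (by
      filter_upwards [ae_ne_zero] with z hz
      refine (half_Hplus_terms hp (sq_nonneg ‖z‖) hz (hzz z) c d _ _ _ _).trans ?_
      rw [half, Hplus_apply N φ hp _ _ hc, ← hd]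
      simp only [hf, Complex.conj_conj, mul_inv_cancel_left₀ hp', Complex.ofReal_one, one_mul,
        Complex.ofReal_mul, Complex.ofReal_inv, mul_assoc])
  obtain ⟨IR, ER⟩ := integral_lin_comb (H := half p (Hminus N ψ) φ) i1' i2' i3'
    (-((c : ℂ)⁻¹ * (p : ℂ)⁻¹ / d) : ℂ) ((c : ℂ)⁻¹ / d) ((c : ℂ) ^ 3 / d) (by
      filter_upwards [ae_ne_zero] with z hz
      refine Eq.trans ?_ ((half_Hminus_terms hp (sq_nonneg ‖z‖) hz (hzz z) c d
        (conj (ψ p⁻¹ ((p : ℂ)⁻¹ * z) ((p : ℂ)⁻¹ * conj z)))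
        (conj (ψ p⁻¹ ((p : ℂ)⁻¹ * z) ((p : ℂ) * conj z)))
        (conj (ψ p⁻¹ ((p : ℂ) * z) ((p : ℂ)⁻¹ * conj z)))
        (φ p ((p : ℂ)⁻¹ * z) ((p : ℂ)⁻¹ * conj z))).trans ?_)
      · simp only [hf, map_mul, Complex.conj_conj, Complex.ofReal_one, one_mul,
          Complex.conj_ofReal, Complex.ofReal_mul, Complex.ofReal_inv, mul_assoc, norm_mul,
          norm_inv, Complex.norm_real, mul_pow, inv_pow, map_inv₀, inv_mul_cancel_left₀ hp',
          Real.norm_eq_abs, sq_abs]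
      · rw [half, Hminus_apply N ψ hpi _ _ hci]
        have hd' : (p : ℂ)⁻¹ - p = -d := by rw [hd]; ring
        have hd2 : conj (-d) = -d := by simp [hd]
        simp only [map_div₀, map_sub, map_mul, map_add, map_inv₀, map_pow, Complex.conj_conj,
          Complex.conj_ofReal, Complex.ofReal_inv, inv_inv, hd', hd2])
  refine ⟨IL, IR, ?_⟩
  rw [EL, ER]
  simp only [Complex.ofReal_inv, inv_inv] at j1 j2 j3 ⊢
  rw [j1, j2, j3]
  -- What remains is to match the powers of `p` from the Jacobian and from the dilated `z⁻¹` with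
  -- the coefficients.
  have comb : ∀ x y t : ℂ, -((c : ℂ)⁻¹ * p / d) * x + (c : ℂ)⁻¹ * p / d * y
        + (c : ℂ) ^ 3 * (p : ℂ)⁻¹ / d * t
      = -((c : ℂ)⁻¹ * (p : ℂ)⁻¹ / d) * (((p : ℂ)⁻¹ ^ 2)⁻¹ * x)
        + (c : ℂ)⁻¹ / d * (((p : ℂ) ^ (-1 : ℤ))⁻¹ * y)
        + (c : ℂ) ^ 3 / d * (((p : ℂ)⁻¹ ^ (-1 : ℤ))⁻¹ * t) := by
    intro x y t
    simp only [zpow_neg_one, inv_inv, inv_pow]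
    field_simp
  exact comb _ _ _

/-! ### Adjointness of the Cartan generator -/

/-- The derivation `-T + T̄`. -/
noncomputable def angDeriv (F : ℂ → ℂ → ℂ) (z w : ℂ) : ℂ :=
  deriv (fun s : ℂ => F (Complex.exp (-s) * z) (Complex.exp s * w)) 0

namespace Regular

variable {F G : ℂ → ℂ → ℂ}

theorem differentiable_flow (hF : Regular F) {z w : ℂ} (h : 0 < z * w) :
    Differentiable ℂ fun s : ℂ => F (Complex.exp (-s) * z) (Complex.exp s * w) := by
  have hz : z ≠ 0 := by rintro rfl; simp at h
  obtain ⟨η, hη, hzw⟩ : ∃ η : ℝ, 0 < η ∧ z * w = η := by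
    rw [Complex.pos_iff] at h
    exact ⟨(z * w).re, h.1, Complex.ext rfl (by simpa using h.2.symm)⟩
  have hopen : IsOpen {z : ℂ | z ≠ 0} := isOpen_ne
  intro s
  have hne : Complex.exp (-s) * z ≠ 0 := mul_ne_zero (Complex.exp_ne_zero _) hz
  have h1 : DifferentiableAt ℂ (fun z : ℂ => F z ((η : ℂ) / z)) (Complex.exp (-s) * z) :=
    (hF.holo η hη).differentiableAt (hopen.mem_nhds hne)
  have h2 : DifferentiableAt ℂ (fun s : ℂ => Complex.exp (-s) * z) s := by fun_prop
  refine (h1.comp s h2).congr_of_eventuallyEq (Filter.Eventually.of_forall fun t => ?_)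
  simp only [Function.comp]
  congr 1
  rw [← hzw, Complex.exp_neg]
  field_simp [Complex.exp_ne_zero]

theorem exists_bound_flow (hF : Regular F) : ∃ C : ℝ, ∀ z : ℂ, z ≠ 0 → ∀ s : ℂ, ‖s‖ ≤ 2 →
    ‖F (Complex.exp (-s) * z) (Complex.exp s * conj z)‖ ≤ C := by
  -- Along the flow the ratio of the two moduli is `exp (∓2 Re s)`, which is at most `exp 4` for
  -- `‖s‖ ≤ 2`.
  obtain ⟨C, hC⟩ := hF.bdd (Real.exp 4)
  refine ⟨C, fun z hz s hs => hC _ _ ?_ ?_ ?_⟩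
  · rw [show Complex.exp (-s) * z * (Complex.exp s * conj z)
      = (Complex.exp (-s) * Complex.exp s) * (z * conj z) by ring, ← Complex.exp_add,
      neg_add_cancel, Complex.exp_zero, one_mul, Complex.mul_conj]
    exact_mod_cast Complex.normSq_pos.2 hz
  · have h := (Complex.abs_re_le_norm s).trans hs
    rw [norm_mul, norm_mul, Complex.norm_exp, Complex.norm_exp, Complex.norm_conj, ← mul_assoc,
      ← Real.exp_add, Complex.neg_re]
    gcongr
    linarith [abs_le.1 h]
  · have h := (Complex.abs_re_le_norm s).trans hs
    rw [norm_mul, norm_mul, Complex.norm_exp, Complex.norm_exp, Complex.norm_conj, ← mul_assoc,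
      ← Real.exp_add, Complex.neg_re]
    gcongr
    linarith [abs_le.1 h]

theorem mul_conj_pos {z : ℂ} (hz : z ≠ 0) : 0 < z * conj z := by
  rw [Complex.mul_conj]
  exact_mod_cast Complex.normSq_pos.2 hz

/-- Cauchy's estimate on unit discs centred in the unit disc, all of which lie in `‖s‖ ≤ 2`, makes
the flow Lipschitz with a constant independent of `z`. This is the domination needed to
differentiate under the integral. -/
theorem exists_lipschitz_flow (hF : Regular F) : ∃ C : ℝ, ∀ z : ℂ, z ≠ 0 →
    ‖angDeriv F z (conj z)‖ ≤ C ∧ ∀ t : ℝ, 0 ≤ t → t ≤ 1 →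
    ‖F (Complex.exp (-t) * z) (Complex.exp t * conj z) - F z (conj z)‖ ≤ C * t := by
  obtain ⟨C, hC⟩ := hF.exists_bound_flow
  refine ⟨C, fun z hz => ?_⟩
  have hd := hF.differentiable_flow (mul_conj_pos hz)
  have hderiv : ∀ s ∈ Metric.closedBall (0 : ℂ) 1,
      ‖deriv (fun s : ℂ => F (Complex.exp (-s) * z) (Complex.exp s * conj z)) s‖ ≤ C := by
    intro s hs
    have := Complex.norm_deriv_le_of_forall_mem_sphere_norm_le (c := s) one_pos hd.diffContOnCl
      (C := C) (fun u hu => hC z hz u ?_)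
    · simpa using this
    · rw [mem_closedBall_zero_iff] at hs
      rw [mem_sphere_iff_norm] at hu
      calc ‖u‖ = ‖(u - s) + s‖ := by rw [sub_add_cancel]
        _ ≤ ‖u - s‖ + ‖s‖ := norm_add_le _ _
        _ ≤ 2 := by linarith
  refine ⟨hderiv 0 (by simp), fun t ht ht1 => ?_⟩
  have h := (convex_closedBall (0 : ℂ) 1).norm_image_sub_le_of_norm_deriv_le
    (fun x _ => hd x) hderiv (x := 0) (y := (t : ℂ)) (by simp)
    (by simpa [abs_of_nonneg ht] using ht1)
  simpa [abs_of_nonneg ht] using h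

theorem tendsto_flow (hF : Regular F) {z : ℂ} (hz : z ≠ 0) :
    Filter.Tendsto (fun n : ℕ => ((n : ℂ) + 1) *
      (F (Complex.exp (-(((n : ℝ) + 1)⁻¹ : ℝ)) * z) (Complex.exp (((n : ℝ) + 1)⁻¹ : ℝ) * conj z)
        - F z (conj z))) Filter.atTop (𝓝 (angDeriv F z (conj z))) := by
  have h := (hF.differentiable_flow (mul_conj_pos hz) 0).hasDerivAt.tendsto_slope_zero
  have ht : Filter.Tendsto (fun n : ℕ => ((((n : ℝ) + 1)⁻¹ : ℝ) : ℂ)) Filter.atTop (𝓝[≠] 0) := by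
    refine tendsto_nhdsWithin_iff.2 ⟨?_, Filter.Eventually.of_forall fun n => ?_⟩
    · have := (Complex.continuous_ofReal.tendsto 0).comp
        (tendsto_one_div_add_atTop_nhds_zero_nat (𝕜 := ℝ))
      simpa [Function.comp_def] using this
    · have : ((n : ℝ) + 1)⁻¹ ≠ 0 := by positivity
      exact Complex.ofReal_ne_zero.2 this
  refine (h.comp ht).congr fun n => ?_
  simp

theorem aestronglyMeasurable_flow (hF : Regular F) (t : ℝ) :
    AEStronglyMeasurable fun z : ℂ => F (Complex.exp (-t) * z) (Complex.exp t * conj z) := by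
  have := hF.meas (Real.exp (-t)) (Real.exp t) (Real.exp_pos _) (Real.exp_pos _)
  simpa using this

/-- The derivative is a limit of difference quotients at real flow times, and those are measurable
because admissibility includes measurability after independent positive dilations. -/
theorem aestronglyMeasurable_angDeriv (hF : Regular F) :
    AEStronglyMeasurable fun z : ℂ => angDeriv F z (conj z) := by
  refine aestronglyMeasurable_of_tendsto_ae Filter.atTop
    (f := fun (n : ℕ) (z : ℂ) => ((n : ℂ) + 1) *
      (F (Complex.exp (-(((n : ℝ) + 1)⁻¹ : ℝ)) * z) (Complex.exp (((n : ℝ) + 1)⁻¹ : ℝ) * conj z)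
        - F z (conj z))) (fun n => ?_) (ae_ne_zero.mono fun z hz => hF.tendsto_flow hz)
  exact ((hF.aestronglyMeasurable_flow _).sub hF.aestronglyMeasurable).const_mul _

theorem integrable_angDeriv (hF : Regular F) {g : ℂ → ℂ} (hg : Integrable g) :
    Integrable fun z : ℂ => g z * angDeriv F z (conj z) := by
  obtain ⟨C, hC⟩ := hF.exists_lipschitz_flow
  exact hg.mul_bdd hF.aestronglyMeasurable_angDeriv (ae_ne_zero.mono fun z hz => (hC z hz).1)

/-- Each difference quotient of the flow integrates to zero against a radial weight, since the flow
preserves such integrals. The limit is taken by dominated convergence. -/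
theorem integral_angDeriv (hF : Regular F) {K : ℝ → ℝ}
    (hK : Integrable fun z : ℂ => (K (‖z‖ ^ 2) : ℂ)) :
    ∫ z : ℂ, (K (‖z‖ ^ 2) : ℂ) * angDeriv F z (conj z) = 0 := by
  obtain ⟨C, hC⟩ := hF.exists_lipschitz_flow
  have hK' : Integrable fun z : ℂ => (K (‖z‖ ^ 2) : ℂ) * z ^ (0 : ℤ) := by simpa using hK
  set D : ℕ → ℂ → ℂ := fun n z => ((n : ℂ) + 1) *
      (F (Complex.exp (-(((n : ℝ) + 1)⁻¹ : ℝ)) * z) (Complex.exp (((n : ℝ) + 1)⁻¹ : ℝ) * conj z)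
        - F z (conj z)) with hD
  have hzero : ∀ n, ∫ z : ℂ, (K (‖z‖ ^ 2) : ℂ) * D n z = 0 := by
    intro n
    set t : ℝ := ((n : ℝ) + 1)⁻¹
    have h := hF.integral_weight hK' (Real.exp_pos (-t))
    have hi := (hF.dil (Real.exp_pos (-t)) (Real.exp_pos t)).integrable hK
    have e : ((Real.exp (-t) : ℝ) : ℂ)⁻¹ = ((Real.exp t : ℝ) : ℂ) := by
      rw [Real.exp_neg, Complex.ofReal_inv, inv_inv]
    simp only [e, zpow_zero, mul_one, inv_one, one_mul] at h
    have e2 : ∀ z, (K (‖z‖ ^ 2) : ℂ) * D n z = ((n : ℂ) + 1) *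
        ((K (‖z‖ ^ 2) : ℂ) * F (((Real.exp (-t) : ℝ) : ℂ) * z) (((Real.exp t : ℝ) : ℂ) * conj z)
          - (K (‖z‖ ^ 2) : ℂ) * F z (conj z)) := fun z => by
      simp only [hD, Complex.ofReal_exp, Complex.ofReal_neg]
      ring
    simp only [e2]
    rw [integral_const_mul, integral_sub hi (hF.integrable hK), h, sub_self, mul_zero]
  have hlim : Filter.Tendsto (fun n => ∫ z : ℂ, (K (‖z‖ ^ 2) : ℂ) * D n z) Filter.atTop
      (𝓝 (∫ z : ℂ, (K (‖z‖ ^ 2) : ℂ) * angDeriv F z (conj z))) := by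
    refine tendsto_integral_of_dominated_convergence (fun z => C * ‖(K (‖z‖ ^ 2) : ℂ)‖)
      (fun n => ?_) (hK.norm.const_mul C) (fun n => ?_) ?_
    · exact hK.aestronglyMeasurable.mul
        (((hF.aestronglyMeasurable_flow _).sub hF.aestronglyMeasurable).const_mul _)
    · filter_upwards [ae_ne_zero] with z hz
      have hn : (0 : ℝ) < (n : ℝ) + 1 := by positivity
      have h := (hC z hz).2 ((n : ℝ) + 1)⁻¹ (by positivity)
        (inv_le_one_of_one_le₀ (by linarith [n.cast_nonneg (α := ℝ)]))
      have en : ‖(n : ℂ) + 1‖ = (n : ℝ) + 1 := by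
        rw [show (n : ℂ) + 1 = (((n : ℝ) + 1 : ℝ) : ℂ) by push_cast; rfl, Complex.norm_real,
          Real.norm_eq_abs, abs_of_pos hn]
      rw [norm_mul, mul_comm]
      gcongr
      rw [hD, norm_mul, en]
      calc _ ≤ ((n : ℝ) + 1) * (C * ((n : ℝ) + 1)⁻¹) := by gcongr
        _ = C := by field_simp
    · filter_upwards [ae_ne_zero] with z hz
      exact (hF.tendsto_flow hz).const_mul _
  simp only [hzero] at hlim
  exact tendsto_nhds_unique hlim tendsto_const_nhds

theorem angDeriv_mul (hF : Regular F) (hG : Regular G) {z : ℂ} (hz : z ≠ 0) :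
    angDeriv (fun z w => F z w * G z w) z (conj z)
      = angDeriv F z (conj z) * G z (conj z) + F z (conj z) * angDeriv G z (conj z) := by
  have h := deriv_fun_mul (hF.differentiable_flow (mul_conj_pos hz) 0)
    (hG.differentiable_flow (mul_conj_pos hz) 0)
  simpa [angDeriv] using h

/-- Exchanging `z` and `w` reverses the flow. This sign cancels the one from integration by parts,
which makes `H₃` symmetric. -/
theorem angDeriv_star (hF : Regular F) {z : ℂ} (hz : z ≠ 0) :
    angDeriv (fun z w => conj (F (conj w) (conj z))) z (conj z)
      = -conj (angDeriv F z (conj z)) := by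
  have h1 := (hF.differentiable_flow (mul_conj_pos hz) 0).hasDerivAt.conj_conj
  rw [map_zero] at h1
  have h2 := HasDerivAt.scomp (0 : ℂ) (g₁ := _) (h := fun s : ℂ => -s) (by rw [neg_zero]; exact h1)
    (hasDerivAt_neg (0 : ℂ))
  have h3 := h2.deriv
  rw [neg_one_smul] at h3
  refine Eq.trans ?_ h3
  unfold angDeriv
  congr 1
  funext s
  simp only [Function.comp, map_mul, ← Complex.exp_conj, map_neg, Complex.conj_conj, neg_neg]

end Regular

theorem angDeriv_dil (F : ℂ → ℂ → ℂ) (a b z w : ℂ) :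
    angDeriv (fun z w => F (a * z) (b * w)) z w = angDeriv F (a * z) (b * w) := by
  simp only [angDeriv, mul_left_comm]

theorem half_H3 (N : ℝ) {p : ℝ} (hp : 0 < p) {ψ φ : Family} (hψ : Regular (ψ p⁻¹))
    (hφ : Regular (φ p)) :
    Integrable (half p ψ (H3 N φ)) ∧ Integrable (half p (H3 N ψ) φ) ∧
      ∫ z, half p ψ (H3 N φ) z = ∫ z, half p (H3 N ψ) φ z := by
  have hpi : 0 < p⁻¹ := inv_pos.2 hp
  have hg := hφ.dil hpi hpi
  have hf := hψ.star
  have hW := integrable_weight hp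
  have i1 := hg.integrable_angDeriv (hf.integrable hW)
  have i2 := hf.integrable_angDeriv (hg.integrable hW)
  have i3 := (hf.mul hg).integrable hW
  have hzero := (hf.mul hg).integral_angDeriv hW
  obtain ⟨IL, EL⟩ := integral_lin_comb (H := half p ψ (H3 N φ)) i1 i2 i3 1 0 (-(N : ℂ)) (by
    filter_upwards [] with z
    rw [angDeriv_dil]
    simp only [half, H3, angDeriv, Complex.conj_conj, Complex.ofReal_inv]
    ring)
  obtain ⟨IR, ER⟩ := integral_lin_comb (H := half p (H3 N ψ) φ) i1 i2 i3 0 (-1) (-(N : ℂ)) (by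
    filter_upwards [ae_ne_zero] with z hz
    rw [hψ.angDeriv_star hz]
    simp only [half, H3, angDeriv, Complex.conj_conj, Complex.ofReal_inv, map_sub, map_mul,
      Complex.conj_ofReal]
    ring)
  -- Integration by parts: the derivative of the product has zero integral, and the product rule
  -- splits it into the two terms to be compared.
  obtain ⟨-, ES⟩ := integral_lin_comb (H := fun z => (weight p (‖z‖ ^ 2) : ℂ) *
      angDeriv (fun z w => conj (ψ p⁻¹ (conj w) (conj z))
        * φ p (((p⁻¹ : ℝ) : ℂ) * z) (((p⁻¹ : ℝ) : ℂ) * w)) z (conj z)) i1 i2 i3 1 1 0 (by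
    filter_upwards [ae_ne_zero] with z hz
    have e := hf.angDeriv_mul hg hz
    rw [e]
    ring)
  refine ⟨IL, IR, ?_⟩
  rw [EL, ER]
  linear_combination hzero - ES

/-! ### The form on admissible functions -/

section Form

variable {q : ℝ} {ψ φ χ : Family}

theorem IsAdmissible.integrable_half (hq : 0 < q) (hψ : IsAdmissible q ψ)
    (hφ : IsAdmissible q φ) : Integrable (half q ψ φ) ∧ Integrable (half q⁻¹ ψ φ) := by
  rw [isAdmissible_iff] at hψ hφ
  refine ⟨SUq2.integrable_half hq hψ.2 hφ.1, SUq2.integrable_half (inv_pos.2 hq) ?_ hφ.2⟩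
  rw [inv_inv]
  exact hψ.1

theorem form_conj_of_isAdmissible (hq : 0 < q) (hψ : IsAdmissible q ψ) (hφ : IsAdmissible q φ) :
    form q φ ψ = conj (form q ψ φ) :=
  form_conj hq (hψ.integrable_half hq hφ).1 (hψ.integrable_half hq hφ).2

theorem half_smul_add (p : ℝ) (ψ φ χ : Family) (c : ℂ) (z : ℂ) :
    half p ψ (c • φ + χ) z = c * half p ψ φ z + half p ψ χ z := by
  simp only [half, Pi.add_apply, Pi.smul_apply, smul_eq_mul]
  ring

theorem form_smul_add (hq : 0 < q) (hψ : IsAdmissible q ψ) (hφ : IsAdmissible q φ)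
    (hχ : IsAdmissible q χ) (c : ℂ) :
    form q ψ (c • φ + χ) = c * form q ψ φ + form q ψ χ := by
  obtain ⟨i1, i2⟩ := hψ.integrable_half hq hφ
  obtain ⟨j1, j2⟩ := hψ.integrable_half hq hχ
  have e : ∀ p, half p ψ (c • φ + χ) = fun z => c * half p ψ φ z + half p ψ χ z := fun p =>
    funext (half_smul_add p ψ φ χ c)
  rw [form_eq, form_eq i1 i2, form_eq j1 j2, e, e, integral_add (i1.const_mul c) j1,
    integral_add (i2.const_mul c) j2, integral_const_mul, integral_const_mul]
  · ring
  · rw [e]; exact (i1.const_mul c).add j1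
  · rw [e]; exact (i2.const_mul c).add j2

/-- Adjointness of both halves of the form. -/
theorem adjointAt_of_half {A B : Family → Family}
    (h1 : Integrable (half q ψ (A φ)) ∧ Integrable (half q (B ψ) φ) ∧
      ∫ z, half q ψ (A φ) z = ∫ z, half q (B ψ) φ z)
    (h2 : Integrable (half q⁻¹ ψ (A φ)) ∧ Integrable (half q⁻¹ (B ψ) φ) ∧
      ∫ z, half q⁻¹ ψ (A φ) z = ∫ z, half q⁻¹ (B ψ) φ z) : AdjointAt q A B ψ φ := by
  refine ⟨integrable_formIntegrand h1.1 h2.1, integrable_formIntegrand h1.2.1 h2.2.1, ?_⟩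
  rw [form_eq h1.1 h2.1, form_eq h1.2.1 h2.2.1, h1.2.2, h2.2.2]

theorem adjointAt_H3 (N : ℝ) (hq : 0 < q) (hψ : IsAdmissible q ψ) (hφ : IsAdmissible q φ) :
    AdjointAt q (H3 N) (H3 N) ψ φ := by
  rw [isAdmissible_iff] at hψ hφ
  refine adjointAt_of_half (half_H3 N hq hψ.2 hφ.1) (half_H3 N (inv_pos.2 hq) ?_ hφ.2)
  rw [inv_inv]
  exact hψ.1

theorem adjointAt_Hplus (N : ℝ) (hq : 0 < q) (hψ : IsAdmissible q ψ) (hφ : IsAdmissible q φ) :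
    AdjointAt q (Hplus N) (Hminus N) ψ φ := by
  rw [isAdmissible_iff] at hψ hφ
  refine adjointAt_of_half (half_Hplus_Hminus N hq hψ.2 hφ.1)
    (half_Hplus_Hminus N (inv_pos.2 hq) ?_ hφ.2)
  rw [inv_inv]
  exact hψ.1

/-- Conjugate the relation for `H₊` at the inverse parameter, with the two functions exchanged. -/
theorem half_Hminus_Hplus (N : ℝ) {p : ℝ} (hp : 0 < p) (hψ : Regular (ψ p⁻¹))
    (hφ : Regular (φ p)) :
    Integrable (half p ψ (Hminus N φ)) ∧ Integrable (half p (Hplus N ψ) φ) ∧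
      ∫ z, half p ψ (Hminus N φ) z = ∫ z, half p (Hplus N ψ) φ z := by
  have hpi : 0 < p⁻¹ := inv_pos.2 hp
  obtain ⟨i1, i2, h⟩ := half_Hplus_Hminus N hpi (ψ := φ) (φ := ψ) (by rwa [inv_inv]) hψ
  have j1 := integrable_half_symm hpi i1
  have j2 := integrable_half_symm hpi i2
  have e1 := integral_half_symm hpi φ (Hplus N ψ)
  have e2 := integral_half_symm hpi (Hminus N φ) ψ
  rw [inv_inv] at j1 j2 e1 e2
  exact ⟨j2, j1, by rw [e1, e2, h]⟩

theorem adjointAt_Hminus (N : ℝ) (hq : 0 < q) (hψ : IsAdmissible q ψ) (hφ : IsAdmissible q φ) :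
    AdjointAt q (Hminus N) (Hplus N) ψ φ := by
  rw [isAdmissible_iff] at hψ hφ
  refine adjointAt_of_half (half_Hminus_Hplus N hq hψ.2 hφ.1)
    (half_Hminus_Hplus N (inv_pos.2 hq) ?_ hφ.2)
  rw [inv_inv]
  exact hψ.1

end Form

/-! ### The function `Q` -/

/-- The `q`-Pochhammer symbol `(-x; u)_∞`. -/
noncomputable def qPoch (u x : ℝ) : ℝ := ∏' k : ℕ, (1 + u ^ k * x)

section qPoch

variable {u x : ℝ}

theorem multipliable_qPoch (h0 : 0 < u) (h1 : u < 1) (x : ℝ) :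
    Multipliable fun k : ℕ => 1 + u ^ k * x :=
  Real.multipliable_one_add_of_summable ((summable_geometric_of_lt_one h0.le h1).mul_right x)

theorem tendsto_qPoch (h0 : 0 < u) (h1 : u < 1) (x : ℝ) :
    Filter.Tendsto (fun n => ∏ k ∈ Finset.range n, (1 + u ^ k * x)) Filter.atTop
      (𝓝 (qPoch u x)) :=
  (multipliable_qPoch h0 h1 x).hasProd.tendsto_prod_nat

theorem one_le_qPoch (h0 : 0 < u) (h1 : u < 1) (hx : 0 ≤ x) : 1 ≤ qPoch u x :=
  ge_of_tendsto' (tendsto_qPoch h0 h1 x) fun n => by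
    simpa using Finset.prod_le_prod (s := Finset.range n) (f := fun _ => (1 : ℝ))
      (fun k _ => zero_le_one) fun k _ => le_add_of_nonneg_right (by positivity : 0 ≤ u ^ k * x)

theorem qPoch_pos (h0 : 0 < u) (h1 : u < 1) (hx : 0 ≤ x) : 0 < qPoch u x :=
  one_pos.trans_le (one_le_qPoch h0 h1 hx)

theorem qPoch_eq_mul (h0 : 0 < u) (h1 : u < 1) (x : ℝ) :
    qPoch u x = (1 + x) * qPoch u (u * x) := by
  have h := (tendsto_qPoch h0 h1 x).comp (Filter.tendsto_add_atTop_nat 1)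
  have h' := (tendsto_qPoch h0 h1 (u * x)).const_mul (1 + x)
  refine tendsto_nhds_unique h (h'.congr fun n => ?_)
  simp only [Function.comp, Finset.prod_range_succ']
  rw [pow_zero, one_mul, mul_comm]
  simp only [pow_succ, mul_assoc]

theorem qPoch_eq_prod_mul (h0 : 0 < u) (h1 : u < 1) (x : ℝ) (n : ℕ) :
    qPoch u x = (∏ k ∈ Finset.range n, (1 + u ^ k * x)) * qPoch u (u ^ n * x) := by
  induction n with
  | zero => simp
  | succ n ih =>
    rw [ih, Finset.prod_range_succ, qPoch_eq_mul h0 h1 (u ^ n * x), pow_succ]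
    ring_nf

/-- The quotient `(-x; u)_∞ / (-a x; u)_∞` decreases for `a ≥ 1`. -/
theorem qPoch_div_antitone (h0 : 0 < u) (h1 : u < 1) {a : ℝ} (ha : 1 ≤ a) {x y : ℝ}
    (hx : 0 ≤ x) (hxy : x ≤ y) :
    qPoch u y / qPoch u (a * y) ≤ qPoch u x / qPoch u (a * x) := by
  have hy := hx.trans hxy
  have ha0 : 0 < a := by linarith
  refine le_of_tendsto_of_tendsto'
    ((tendsto_qPoch h0 h1 y).div (tendsto_qPoch h0 h1 (a * y))
      (qPoch_pos h0 h1 (by positivity)).ne')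
    ((tendsto_qPoch h0 h1 x).div (tendsto_qPoch h0 h1 (a * x))
      (qPoch_pos h0 h1 (by positivity)).ne') fun n => ?_
  simp only [Pi.div_apply]
  rw [← Finset.prod_div_distrib, ← Finset.prod_div_distrib]
  -- Already each factor `(1 + u^k x) / (1 + u^k a x)` decreases in `x` when `a ≥ 1`.
  refine Finset.prod_le_prod (fun k _ => by positivity) fun k _ => ?_
  have hu : 0 < u ^ k := by positivity
  rw [div_le_div_iff₀ (by positivity) (by positivity)]
  have h2 : 0 ≤ u ^ k * ((a - 1) * (y - x)) :=
    mul_nonneg hu.le (mul_nonneg (by linarith) (by linarith))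
  nlinarith

end qPoch

section Q

variable {J p η : ℝ} {n : ℕ}

theorem Q_eq_qPoch_div (hp : 0 < p) (hp1 : p < 1) (hJ : 2 * J = n) (hη : 0 ≤ η) :
    Q J p η = qPoch (p ^ 2) η / qPoch (p ^ 2) ((p ^ n)⁻¹ * η) := by
  have h0 : 0 < p ^ 2 := by positivity
  have h1 : p ^ 2 < 1 := by nlinarith
  rw [Q, if_pos hp1, qPoch, qPoch, ← (multipliable_qPoch h0 h1 η).tprod_div₀
    (multipliable_qPoch h0 h1 _) (qPoch_pos h0 h1 (by positivity)).ne']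
  refine tprod_congr fun k => ?_
  have e1 : p ^ (2 * (k : ℝ)) = (p ^ 2) ^ k := by
    rw [← pow_mul, ← Real.rpow_natCast]; push_cast; rfl
  have e2 : p ^ (-2 * J + 2 * (k : ℝ)) = (p ^ 2) ^ k * (p ^ n)⁻¹ := by
    rw [Real.rpow_add hp, e1, show -2 * J = -(n : ℝ) by rw [← hJ]; ring, Real.rpow_neg hp.le,
      Real.rpow_natCast, mul_comm]
  rw [e1, e2, mul_assoc]

/-- The product for parameters above `1` is the one below `1` with the argument scaled by
`p^{2J+2}`. Every statement about `Q` is thereby reduced to parameters below `1`. -/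
theorem Q_inv (hp : 0 < p) (hp1 : p < 1) (hJ : 2 * J = n) :
    Q J p⁻¹ η = Q J p (p ^ (n + 2) * η) := by
  have h1 : 1 < p⁻¹ := (one_lt_inv₀ hp).2 hp1
  rw [Q, if_neg h1.not_gt, if_neg h1.ne', Q, if_pos hp1]
  refine tprod_congr fun k => ?_
  have hn : (2 : ℝ) * J + 2 = ((n + 2 : ℕ) : ℝ) := by rw [hJ]; push_cast; rfl
  rw [Real.inv_rpow hp.le, Real.inv_rpow hp.le, ← Real.rpow_neg hp.le, ← Real.rpow_neg hp.le,
    ← Real.rpow_natCast p (n + 2), ← hn, ← mul_assoc, ← mul_assoc, ← Real.rpow_add hp,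
    ← Real.rpow_add hp]
  ring_nf

theorem Q_pos_of_lt_one (hp : 0 < p) (hp1 : p < 1) (hJ : 2 * J = n) (hη : 0 ≤ η) :
    0 < Q J p η := by
  rw [Q_eq_qPoch_div hp hp1 hJ hη]
  have h1 : p ^ 2 < 1 := by nlinarith
  exact div_pos (qPoch_pos (by positivity) h1 hη) (qPoch_pos (by positivity) h1 (by positivity))

theorem Q_antitone_of_lt_one (hp : 0 < p) (hp1 : p < 1) (hJ : 2 * J = n) {x y : ℝ} (hx : 0 ≤ x)
    (hxy : x ≤ y) : Q J p y ≤ Q J p x := by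
  have h1 : p ^ 2 < 1 := by nlinarith
  rw [Q_eq_qPoch_div hp hp1 hJ hx, Q_eq_qPoch_div hp hp1 hJ (hx.trans hxy)]
  exact qPoch_div_antitone (by positivity) h1
    (one_le_inv_iff₀.2 ⟨by positivity, pow_le_one₀ hp.le hp1.le⟩) hx hxy

/-- The denominator of the first quotient is the numerator of the second, and the two products left
over differ by `n = 2J` factors. An infinite product thus becomes the inverse of a polynomial, from
which the decay of `Q` is read off. -/
theorem Q_mul_Q (hp : 0 < p) (hp1 : p < 1) (hJ : 2 * J = n) (hη : 0 ≤ η) :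
    Q J p η * Q J p ((p ^ n)⁻¹ * η)
      = (∏ i ∈ Finset.range n, (1 + (p ^ 2) ^ i * ((p ^ n)⁻¹ * ((p ^ n)⁻¹ * η))))⁻¹ := by
  have h0 : 0 < p ^ 2 := by positivity
  have h1 : p ^ 2 < 1 := by nlinarith
  rw [Q_eq_qPoch_div hp hp1 hJ hη, Q_eq_qPoch_div hp hp1 hJ (by positivity),
    div_mul_div_cancel₀ (qPoch_pos h0 h1 (by positivity)).ne',
    qPoch_eq_prod_mul h0 h1 ((p ^ n)⁻¹ * ((p ^ n)⁻¹ * η)) n]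
  have e : (p ^ 2) ^ n * ((p ^ n)⁻¹ * ((p ^ n)⁻¹ * η)) = η := by
    field_simp
    ring
  rw [e, div_mul_cancel_right₀ (qPoch_pos h0 h1 hη).ne']

/-- By monotonicity `Q(η)²` lies between `Q(η) Q(p⁻ⁿ η)` and `Q(pⁿ η) Q(η)`, and both are finite
products by `Q_mul_Q`. -/
theorem Q_sq_bounds_of_lt_one (hp : 0 < p) (hp1 : p < 1) (hJ : 2 * J = n) (hη : 0 ≤ η) :
    ((1 + (p⁻¹) ^ (2 * n) * η) ^ n)⁻¹ ≤ Q J p η ^ 2 ∧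
      Q J p η ^ 2 ≤ ((1 + p ^ n * η) ^ n)⁻¹ := by
  have hn : p ^ n ≤ 1 := pow_le_one₀ hp.le hp1.le
  have hni : 1 ≤ (p ^ n)⁻¹ := one_le_inv_iff₀.2 ⟨by positivity, hn⟩
  have hQ := fun {x : ℝ} (hx : 0 ≤ x) => (Q_pos_of_lt_one hp hp1 hJ hx).le
  constructor
  · have h1 : Q J p η * Q J p ((p ^ n)⁻¹ * η) ≤ Q J p η ^ 2 := by
      rw [sq]
      exact mul_le_mul_of_nonneg_left
        (Q_antitone_of_lt_one hp hp1 hJ hη (le_mul_of_one_le_left hη hni)) (hQ hη)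
    refine le_trans ?_ h1
    rw [Q_mul_Q hp hp1 hJ hη]
    refine inv_anti₀ (Finset.prod_pos fun i _ => by positivity) ?_
    have h3 : ∏ i ∈ Finset.range n, (1 + (p ^ 2) ^ i * ((p ^ n)⁻¹ * ((p ^ n)⁻¹ * η)))
        ≤ ∏ i ∈ Finset.range n, (1 + (p⁻¹) ^ (2 * n) * η) := by
      refine Finset.prod_le_prod (fun i _ => by positivity) fun i _ => ?_
      have e : (p⁻¹) ^ (2 * n) * η = (p ^ n)⁻¹ * ((p ^ n)⁻¹ * η) := by
        rw [inv_pow, two_mul, pow_add, mul_inv, mul_assoc]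
      rw [e]
      exact add_le_add le_rfl (mul_le_of_le_one_left (by positivity)
        (pow_le_one₀ (sq_nonneg p) (pow_le_one₀ hp.le hp1.le)))
    simpa using h3
  · have e : (p ^ n)⁻¹ * (p ^ n * η) = η := inv_mul_cancel_left₀ (by positivity) η
    have h1 : Q J p η ^ 2 ≤ Q J p (p ^ n * η) * Q J p η := by
      rw [sq]
      exact mul_le_mul_of_nonneg_right
        (Q_antitone_of_lt_one hp hp1 hJ (by positivity) (mul_le_of_le_one_left hη hn)) (hQ hη)
    have h2 := Q_mul_Q hp hp1 hJ (η := p ^ n * η) (by positivity)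
    rw [e] at h2
    rw [h2] at h1
    refine h1.trans (inv_anti₀ (by positivity) ?_)
    have h3 : ∏ i ∈ Finset.range n, (1 + p ^ n * η)
        ≤ ∏ i ∈ Finset.range n, (1 + (p ^ 2) ^ i * ((p ^ n)⁻¹ * η)) := by
      refine Finset.prod_le_prod (fun i _ => by positivity) fun i hi => ?_
      have hi : i ≤ n := (Finset.mem_range.1 hi).le
      have h4 : p ^ n ≤ (p ^ 2) ^ i * (p ^ n)⁻¹ := by
        rw [← div_eq_mul_inv, le_div_iff₀ (by positivity), ← pow_add, ← pow_mul]
        exact pow_le_pow_of_le_one hp.le hp1.le (by omega)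
      rw [← mul_assoc]
      gcongr
    simpa using h3

/-- `max p p⁻¹`. -/
noncomputable def spread (p : ℝ) : ℝ := max p p⁻¹

theorem one_le_spread (hp : 0 < p) : 1 ≤ spread p := by
  rcases le_total 1 p with h | h
  · exact h.trans (le_max_left _ _)
  · exact (one_le_inv_iff₀.2 ⟨hp, h⟩).trans (le_max_right _ _)

/-- Treats both sides of `1` at once: `r` is the smaller of `p` and `p⁻¹`, and the scaling `s` from
`Q_inv` stays between explicit powers of `spread p`. -/
theorem exists_lt_one_Q_eq (hp : 0 < p) (hp1 : p ≠ 1) (hJ : 2 * J = n) :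
    ∃ r, 0 < r ∧ r < 1 ∧ spread p = r⁻¹ ∧ ∃ s, 0 < s ∧ (spread p ^ (n + 2))⁻¹ ≤ s ∧ s ≤ 1 ∧
      ∀ η, Q J p η = Q J r (s * η) := by
  rcases lt_or_gt_of_ne hp1 with h | h
  · have hs : spread p = p⁻¹ := max_eq_right (h.le.trans (one_le_inv_iff₀.2 ⟨hp, h.le⟩))
    refine ⟨p, hp, h, hs, 1, one_pos, ?_, le_rfl, fun η => by rw [one_mul]⟩
    exact inv_le_one_of_one_le₀ (one_le_pow₀ (one_le_spread hp))
  · have hr : 0 < p⁻¹ := inv_pos.2 hp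
    have hr1 : p⁻¹ < 1 := inv_lt_one_of_one_lt₀ h
    have hs : spread p = p := max_eq_left (hr1.le.trans h.le)
    refine ⟨p⁻¹, hr, hr1, by rw [hs, inv_inv], p⁻¹ ^ (n + 2), by positivity, ?_,
      pow_le_one₀ hr.le hr1.le, fun η => ?_⟩
    · rw [hs, inv_pow]
    · conv_lhs => rw [← inv_inv p]
      exact Q_inv hr hr1 hJ

theorem Q_one_sq (hJ : 2 * J = n) (hη : 0 ≤ η) : Q J 1 η ^ 2 = ((1 + η) ^ n)⁻¹ := by
  have : (0 : ℝ) ≤ 1 + η := by positivity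
  rw [Q, if_neg (lt_irrefl _), if_pos rfl, ← Real.rpow_natCast, ← Real.rpow_mul this,
    show -J * ((2 : ℕ) : ℝ) = -(n : ℝ) by rw [← hJ]; push_cast; ring, Real.rpow_neg this,
    Real.rpow_natCast]

theorem Q_pos (hp : 0 < p) (hJ : 2 * J = n) (hη : 0 ≤ η) : 0 < Q J p η := by
  by_cases h : p = 1
  · subst h
    rw [Q, if_neg (lt_irrefl _), if_pos rfl]
    positivity
  · obtain ⟨r, hr, hr1, -, s, hs, -, -, h⟩ := exists_lt_one_Q_eq hp h hJ
    rw [h]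
    exact Q_pos_of_lt_one hr hr1 hJ (by positivity)

theorem Q_antitone (hp : 0 < p) (hJ : 2 * J = n) {x y : ℝ} (hx : 0 ≤ x)
    (hxy : x ≤ y) : Q J p y ≤ Q J p x := by
  by_cases h : p = 1
  · subst h
    rw [← sq_le_sq₀ (Q_pos one_pos hJ (hx.trans hxy)).le (Q_pos one_pos hJ hx).le,
      Q_one_sq hJ hx, Q_one_sq hJ (hx.trans hxy)]
    gcongr
  · obtain ⟨r, hr, hr1, -, s, hs, -, -, h⟩ := exists_lt_one_Q_eq hp h hJ
    rw [h, h]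
    exact Q_antitone_of_lt_one hr hr1 hJ (by positivity) (by gcongr)

/-- Both bounds become `(1 + η)^{-2J}` at `p = 1`, so they replace any analysis of how the infinite
products depend on the parameter. The exponent `2n + 2` collects `n` from the bound below `1` and `n
+ 2` from the scaling. -/
theorem Q_sq_bounds (hp : 0 < p) (hJ : 2 * J = n) (hη : 0 ≤ η) :
    ((1 + spread p ^ (2 * n) * η) ^ n)⁻¹ ≤ Q J p η ^ 2 ∧
      Q J p η ^ 2 ≤ ((1 + (spread p ^ (2 * n + 2))⁻¹ * η) ^ n)⁻¹ := by
  have hS := one_le_spread hp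
  have hS0 : 0 < spread p := by linarith
  by_cases h : p = 1
  · subst h
    have : spread 1 = 1 := by simp [spread]
    rw [Q_one_sq hJ hη, this]
    simp
  · obtain ⟨r, hr, hr1, hrs, s, hs, hs1, hs2, h⟩ := exists_lt_one_Q_eq hp h hJ
    have hb := Q_sq_bounds_of_lt_one hr hr1 hJ (η := s * η) (by positivity)
    have hrs' : r = (spread p)⁻¹ := by rw [hrs, inv_inv]
    rw [h]
    constructor
    · refine le_trans ?_ hb.1
      rw [hrs]
      have : s * η ≤ η := mul_le_of_le_one_left hη hs2
      gcongr
    · refine hb.2.trans ?_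
      rw [hrs', ← mul_assoc]
      have : (spread p ^ (2 * n + 2))⁻¹ ≤ (spread p)⁻¹ ^ n * s := by
        calc (spread p ^ (2 * n + 2))⁻¹ = (spread p)⁻¹ ^ n * (spread p ^ (n + 2))⁻¹ := by
              rw [inv_pow, ← mul_inv, ← pow_add]; congr 2; omega
          _ ≤ _ := by gcongr
      gcongr

/-- `Q` decays like `(1 + η)^{-J}`, locally uniformly in the parameter. -/
theorem Q_sq_mul_le (hp : 0 < p) (hJ : 2 * J = n) (hη : 0 ≤ η) :
    Q J p η ^ 2 * (1 + η) ^ n ≤ (spread p ^ (2 * n + 2)) ^ n := by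
  have hS := one_le_spread hp
  have hS0 : 0 < spread p := by linarith
  refine (mul_le_mul_of_nonneg_right (Q_sq_bounds hp hJ hη).2 (by positivity)).trans ?_
  rw [inv_mul_eq_div, div_le_iff₀ (by positivity), ← mul_pow]
  gcongr
  rw [mul_add, mul_one, mul_inv_cancel_left₀ (by positivity)]
  gcongr
  exact one_le_pow₀ hS

theorem tendsto_spread : Filter.Tendsto spread (𝓝 1) (𝓝 1) := by
  have : ContinuousAt spread 1 :=
    continuousAt_id.max (continuousAt_inv₀ one_ne_zero)
  simpa [ContinuousAt, spread] using this

/-- Squeezing `Q²` between the bounds of `Q_sq_bounds` joins the three cases of the definition at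
the parameter `1`; positivity allows taking the root. -/
theorem continuousAt_Q (hJ : 2 * J = n) {η₀ : ℝ} (hη : 0 < η₀) :
    ContinuousAt (fun x : ℝ × ℝ => Q J x.1 x.2) (1, η₀) := by
  have hS : Filter.Tendsto (fun x : ℝ × ℝ => spread x.1) (𝓝 (1, η₀)) (𝓝 1) :=
    tendsto_spread.comp (continuousAt_fst (p := ((1 : ℝ), η₀)))
  have hE : Filter.Tendsto (fun x : ℝ × ℝ => x.2) (𝓝 (1, η₀)) (𝓝 η₀) :=
    continuousAt_snd (p := ((1 : ℝ), η₀))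
  have hne : (1 + 1 ^ (2 * n) * η₀) ^ n ≠ 0 := by positivity
  have hne' : (1 + (1 ^ (2 * n + 2))⁻¹ * η₀) ^ n ≠ 0 := by positivity
  have hL := (((((hS.pow (2 * n)).mul hE).const_add 1).pow n).inv₀ hne)
  have hU := ((((((hS.pow (2 * n + 2)).inv₀ (by simp)).mul hE).const_add 1).pow n).inv₀ hne')
  simp only [one_pow, one_mul, inv_one] at hL hU
  have hev : ∀ᶠ x : ℝ × ℝ in 𝓝 (1, η₀), 0 < x.1 ∧ 0 < x.2 :=
    (continuousAt_fst.eventually (lt_mem_nhds one_pos)).and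
      (continuousAt_snd.eventually (lt_mem_nhds hη))
  have hsq : Filter.Tendsto (fun x : ℝ × ℝ => Q J x.1 x.2 ^ 2) (𝓝 (1, η₀))
      (𝓝 ((1 + η₀) ^ n)⁻¹) :=
    tendsto_of_tendsto_of_tendsto_of_le_of_le' hL hU
      (hev.mono fun x hx => (Q_sq_bounds hx.1 hJ hx.2.le).1)
      (hev.mono fun x hx => (Q_sq_bounds hx.1 hJ hx.2.le).2)
  have h := hsq.sqrt
  rw [← Q_one_sq hJ hη.le, Real.sqrt_sq (Q_pos one_pos hJ hη.le).le] at h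
  refine h.congr' (hev.mono fun x hx => ?_)
  rw [Real.sqrt_sq (Q_pos hx.1 hJ hx.2.le).le]

/-- Dilating by `p²` shifts the index of both infinite products by one, so only their first factors
change. It lets `Q` drop out of the action of the generators. -/
theorem Q_dilate (hp : 0 < p) (hp1 : p ≠ 1) (hJ : 2 * J = n) (hη : 0 ≤ η) :
    (1 + η) * Q J p (p ^ 2 * η) = (1 + (p ^ n)⁻¹ * η) * Q J p η := by
  have key : ∀ {r x : ℝ}, 0 < r → r < 1 → 0 ≤ x →
      (1 + x) * Q J r (r ^ 2 * x) = (1 + (r ^ n)⁻¹ * x) * Q J r x := by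
    intro r x hr hr1 hx
    have h0 : 0 < r ^ 2 := by positivity
    have h1 : r ^ 2 < 1 := by nlinarith
    rw [Q_eq_qPoch_div hr hr1 hJ hx, Q_eq_qPoch_div hr hr1 hJ (by positivity),
      qPoch_eq_mul h0 h1 x, qPoch_eq_mul h0 h1 ((r ^ n)⁻¹ * x), mul_left_comm (r ^ n)⁻¹ (r ^ 2) x]
    have := (qPoch_pos h0 h1 (x := r ^ 2 * ((r ^ n)⁻¹ * x)) (by positivity)).ne'
    have : 0 < 1 + (r ^ n)⁻¹ * x := by positivity
    field_simp
  rcases lt_or_gt_of_ne hp1 with h | h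
  · exact key hp h hη
  · have hr : 0 < p⁻¹ := inv_pos.2 hp
    have hr1 : p⁻¹ < 1 := inv_lt_one_of_one_lt₀ h
    have e : ∀ x, Q J p x = Q J p⁻¹ (p⁻¹ ^ (n + 2) * x) := fun x => by
      conv_lhs => rw [← inv_inv p]
      exact Q_inv hr hr1 hJ
    rw [e, e]
    -- For `p > 1` this is the same equation at `p⁻¹`, read in the opposite direction; the point is
    -- chosen so that the two arguments of `Q` are exchanged.
    have k := key hr hr1 (x := p⁻¹ ^ (n + 2) * (p ^ 2 * η)) (by positivity)
    have e1 : p⁻¹ ^ 2 * (p⁻¹ ^ (n + 2) * (p ^ 2 * η)) = p⁻¹ ^ (n + 2) * η := by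
      field_simp
    have e2 : p⁻¹ ^ (n + 2) * (p ^ 2 * η) = (p ^ n)⁻¹ * η := by
      rw [inv_pow, pow_add]; field_simp
    have e3 : (p⁻¹ ^ n)⁻¹ * (p⁻¹ ^ (n + 2) * (p ^ 2 * η)) = η := by
      rw [pow_add]; field_simp
    rw [e1, e3, e2] at k
    rw [e2]
    exact k.symm

/-- In the norms the infinite products cancel. -/
theorem Q_inv_mul_Q (hp : 0 < p) (hp1 : p < 1) (hJ : 2 * J = n) (hη : 0 ≤ η) :
    Q J p⁻¹ η * Q J p ((p ^ 2)⁻¹ * η)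
      = (1 + η) * (1 + (p ^ 2)⁻¹ * η) *
        (∏ i ∈ Finset.range (n + 2), (1 + (p ^ 2) ^ i * ((p ^ (n + 2))⁻¹ * η)))⁻¹ := by
  have h0 : 0 < p ^ 2 := by positivity
  have h1 : p ^ 2 < 1 := by nlinarith
  rw [Q_inv hp hp1 hJ, Q_eq_qPoch_div hp hp1 hJ (by positivity),
    Q_eq_qPoch_div hp hp1 hJ (by positivity)]
  have e1 : (p ^ n)⁻¹ * (p ^ (n + 2) * η) = p ^ 2 * η := by rw [pow_add]; field_simp
  have e2 : (p ^ n)⁻¹ * ((p ^ 2)⁻¹ * η) = (p ^ (n + 2))⁻¹ * η := by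
    rw [pow_add]; field_simp
  have e3 : (p ^ 2) ^ (n + 2) * ((p ^ (n + 2))⁻¹ * η) = p ^ (n + 2) * η := by
    have : p ^ (n + 2) ≠ 0 := by positivity
    rw [← pow_mul, mul_comm 2, pow_mul, sq]
    field_simp
  rw [e1, e2, qPoch_eq_prod_mul h0 h1 ((p ^ (n + 2))⁻¹ * η) (n + 2), e3,
    qPoch_eq_mul h0 h1 ((p ^ 2)⁻¹ * η), mul_inv_cancel_left₀ h0.ne', qPoch_eq_mul h0 h1 η]
  have i1 := (qPoch_pos h0 h1 (x := p ^ 2 * η) (by positivity)).ne'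
  have i2 := (qPoch_pos h0 h1 (x := p ^ (n + 2) * η) (by positivity)).ne'
  have i3 : (∏ i ∈ Finset.range (n + 2), (1 + (p ^ 2) ^ i * ((p ^ (n + 2))⁻¹ * η))) ≠ 0 :=
    (Finset.prod_pos fun i _ => by positivity).ne'
  generalize (∏ i ∈ Finset.range (n + 2), (1 + (p ^ 2) ^ i * ((p ^ (n + 2))⁻¹ * η))) = A at *
  generalize qPoch (p ^ 2) (p ^ 2 * η) = B at *
  generalize qPoch (p ^ 2) (p ^ (n + 2) * η) = C at *
  rw [div_mul_div_comm, div_eq_iff (by positivity)]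
  field_simp

end Q

/-! ### `q`-numbers and `q`-factorials -/

section qnum

variable {p : ℝ}

theorem sub_inv_ne_zero (hp : 0 < p) (hp1 : p ≠ 1) : p - p⁻¹ ≠ 0 := by
  intro h
  have h1 : p * p = 1 := by
    rw [sub_eq_zero] at h
    nth_rewrite 2 [h]
    exact mul_inv_cancel₀ hp.ne'
  exact hp1 (by nlinarith)

theorem qnum_mul (hp : 0 < p) (hp1 : p ≠ 1) (n : ℤ) :
    (p - p⁻¹) * qnum p n = p ^ n - p ^ (-n) := by
  rw [qnum, if_neg hp1, mul_div_cancel₀ _ (sub_inv_ne_zero hp hp1), Real.rpow_intCast,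
    ← Int.cast_neg, Real.rpow_intCast]

@[simp] theorem qnum_zero (p : ℝ) : qnum p 0 = 0 := by
  simp [qnum]

/-- This recursion also holds at `p = 1`, so positivity and continuity at the parameter `1` follow
by induction without evaluating a limit of quotients. -/
theorem qnum_natCast_succ (hp : 0 < p) (n : ℕ) :
    qnum p ((n : ℝ) + 1) = p * qnum p n + (p ^ n)⁻¹ := by
  by_cases h : p = 1
  · subst h; simp [qnum]
  · have h1 := qnum_mul hp h ((n : ℤ) + 1)
    have h2 := qnum_mul hp h (n : ℤ)
    push_cast at h1 h2
    refine mul_left_cancel₀ (sub_inv_ne_zero hp h) ?_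
    rw [h1, mul_add, mul_left_comm, h2, neg_add, zpow_add₀ hp.ne', zpow_add₀ hp.ne', zpow_one,
      zpow_neg_one, zpow_natCast, zpow_neg, zpow_natCast]
    ring

theorem qnum_natCast_nonneg (hp : 0 < p) (n : ℕ) : 0 ≤ qnum p n := by
  induction n with
  | zero => simp
  | succ n ih => rw [Nat.cast_succ, qnum_natCast_succ hp]; positivity

theorem qnum_natCast_succ_pos (hp : 0 < p) (n : ℕ) : 0 < qnum p ((n : ℝ) + 1) := by
  have := qnum_natCast_nonneg hp n
  rw [qnum_natCast_succ hp]
  positivity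

theorem continuousAt_qnum (n : ℕ) : ContinuousAt (fun p => qnum p n) 1 := by
  induction n with
  | zero => simpa using continuousAt_const
  | succ n ih =>
    have h : ContinuousAt (fun p : ℝ => p * qnum p n + (p ^ n)⁻¹) 1 :=
      (continuousAt_id.mul ih).add ((continuousAt_id.pow n).inv₀ (by simp))
    refine h.congr ((lt_mem_nhds one_pos).mono fun p hp => ?_)
    simp only [Nat.cast_succ, qnum_natCast_succ hp]

theorem qnum_inv (hp : 0 < p) (x : ℝ) : qnum p⁻¹ x = qnum p x := by
  by_cases h : p = 1
  · subst h; simp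
  · have h' : p⁻¹ ≠ 1 := by simpa using h
    rw [qnum, qnum, if_neg h, if_neg h', Real.inv_rpow hp.le, Real.inv_rpow hp.le,
      ← Real.rpow_neg hp.le, ← Real.rpow_neg hp.le, neg_neg, inv_inv, ← neg_sub, ← neg_sub p,
      neg_div_neg_eq]

/-- `p^a [b] + p^{-b} [a] = [a + b]`. -/
theorem qnum_add (hp : 0 < p) (hp1 : p ≠ 1) (a b : ℤ) :
    p ^ a * qnum p b + p ^ (-b) * qnum p a = qnum p ((a + b : ℤ) : ℝ) := by
  refine mul_left_cancel₀ (sub_inv_ne_zero hp hp1) ?_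
  rw [mul_add, mul_left_comm, mul_left_comm (p - p⁻¹) (p ^ (-b)), qnum_mul hp hp1, qnum_mul hp hp1,
    qnum_mul hp hp1, neg_add, zpow_add₀ hp.ne', zpow_add₀ hp.ne']
  ring

theorem qfact_natCast (p : ℝ) (n : ℕ) :
    qfact p n = ∏ i ∈ Finset.range n, qnum p ((i : ℝ) + 1) := by
  rw [qfact, Nat.floor_natCast]

theorem qfact_natCast_succ (p : ℝ) (n : ℕ) :
    qfact p ((n : ℝ) + 1) = qnum p ((n : ℝ) + 1) * qfact p n := by
  rw [← Nat.cast_succ, qfact_natCast, qfact_natCast, Finset.prod_range_succ, mul_comm,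
    Nat.cast_succ]

theorem qfact_pos (hp : 0 < p) (x : ℝ) : 0 < qfact p x :=
  Finset.prod_pos fun _ _ => qnum_natCast_succ_pos hp _

theorem qfact_inv (hp : 0 < p) (x : ℝ) : qfact p⁻¹ x = qfact p x :=
  Finset.prod_congr rfl fun _ _ => qnum_inv hp _

theorem continuousAt_qfact (x : ℝ) : ContinuousAt (fun p => qfact p x) 1 := by
  unfold qfact
  refine tendsto_finsetProd _ fun i _ => ?_
  have := continuousAt_qnum (i + 1)
  push_cast at this
  exact this

/-- `1 / [n]!`, which vanishes for negative `n`. -/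
noncomputable def invFact (p : ℝ) (n : ℤ) : ℝ := if n < 0 then 0 else (qfact p (n.toNat : ℝ))⁻¹

theorem invFact_of_neg {n : ℤ} (h : n < 0) : invFact p n = 0 := if_pos h

theorem invFact_natCast (p : ℝ) (n : ℕ) : invFact p n = (qfact p n)⁻¹ := by
  simp [invFact]

/-- Valid for all integers because `[0] = 0`; boundary terms of the polynomials then need no
separate treatment. -/
theorem invFact_sub_one (hp : 0 < p) (n : ℤ) :
    invFact p (n - 1) = qnum p n * invFact p n := by
  rcases lt_trichotomy n 0 with h | h | h
  · rw [invFact_of_neg h, invFact_of_neg (by omega), mul_zero]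
  · subst h
    rw [invFact_of_neg (by omega)]
    simp
  · obtain ⟨k, rfl⟩ : ∃ k : ℕ, n = (k : ℤ) + 1 := ⟨(n - 1).toNat, by omega⟩
    have h1 := (qnum_natCast_succ_pos hp k).ne'
    have h2 := (qfact_pos hp k).ne'
    rw [add_sub_cancel_right, invFact_natCast, ← Nat.cast_succ, invFact_natCast]
    push_cast
    rw [qfact_natCast_succ]
    field_simp

end qnum

/-! ### The polynomials `R` -/

/-- The coefficients of `R`, up to the `q`-factorials in front. -/
noncomputable def coeff (p : ℝ) (a b c k : ℤ) : ℝ :=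
  invFact p k * invFact p (a - k) * invFact p (b - k) * invFact p (c + k)

/-- The polynomial `R` without the `q`-factorials in front, with `a = J - M`, `b = J - N`,
`c = M + N`. -/
noncomputable def poly (p : ℝ) (a : ℤ) (b : ℕ) (c : ℤ) (η : ℝ) : ℝ :=
  ∑ k ∈ Finset.range (b + 1), (-η) ^ k * coeff p a b c k

section poly

variable {p : ℝ}

theorem R_eq {J M N : ℝ} {a b : ℕ} {c : ℤ} (ha : J - M = a) (hb : J - N = b) (hc : M + N = c)
    (η : ℝ) : R J M N p η = qfact p b * qfact p a * poly p a b c η := by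
  unfold R poly
  simp only [ha, hb, hc, Nat.floor_natCast]
  rw [Finset.mul_sum]
  refine Finset.sum_subset_zero_on_sdiff ?_ ?_ ?_
  · intro k hk
    simp only [Finset.mem_filter, Finset.mem_range] at hk ⊢
    have : (k : ℝ) ≤ b := by linarith [hk.2.1]
    have : k ≤ b := by exact_mod_cast this
    omega
  · intro k hk
    simp only [Finset.mem_filter, Finset.mem_range, Finset.mem_sdiff, not_and, not_le] at hk
    have hkb : (0 : ℝ) ≤ b - k := by
      have : (k : ℝ) ≤ b := by exact_mod_cast (by omega : k ≤ b)
      linarith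
    unfold coeff
    by_cases hka : k < a + 1
    · have h := hk.2 hka hkb
      have : c + (k : ℤ) < 0 := by exact_mod_cast h
      rw [invFact_of_neg this]
      ring
    · rw [invFact_of_neg (by omega : (a : ℤ) - k < 0)]
      ring
  · intro k hk
    simp only [Finset.mem_filter, Finset.mem_range] at hk
    obtain ⟨h1, h2, h3⟩ := hk
    obtain ⟨u, rfl⟩ : ∃ u : ℕ, a = u + k := ⟨a - k, by omega⟩
    have h2' : (k : ℝ) ≤ b := by linarith
    have h2'' : k ≤ b := by exact_mod_cast h2'
    obtain ⟨v, rfl⟩ : ∃ v : ℕ, b = v + k := ⟨b - k, by omega⟩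
    have h3' : 0 ≤ c + (k : ℤ) := by exact_mod_cast h3
    obtain ⟨t, ht⟩ : ∃ t : ℕ, c + (k : ℤ) = t := ⟨(c + k).toNat, by omega⟩
    have ht' : (c : ℝ) + k = t := by exact_mod_cast ht
    have e1 : (((u + k : ℕ) : ℤ)) - k = u := by omega
    have e2 : (((v + k : ℕ) : ℤ)) - k = v := by omega
    have e3 : (((u + k : ℕ) : ℝ)) - k = u := by push_cast; ring
    have e4 : (((v + k : ℕ) : ℝ)) - k = v := by push_cast; ring
    rw [coeff, e1, e2, e3, e4, ht, ht', invFact_natCast, invFact_natCast, invFact_natCast,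
      invFact_natCast]
    field_simp

theorem sum_range_shift {b : ℕ} {f : ℕ → ℝ} (h0 : f 0 = 0) (hb : f (b + 1) = 0) :
    ∑ k ∈ Finset.range (b + 1), f k = ∑ k ∈ Finset.range (b + 1), f (k + 1) := by
  have h1 := Finset.sum_range_succ f (b + 1)
  have h2 := Finset.sum_range_succ' f (b + 1)
  rw [h0, add_zero] at h2
  rw [hb, add_zero] at h1
  rw [← h1, h2]

/-- Once the reciprocal factorials are reduced to common ones, the identity is the addition rule for
`[b + c + 1] = [(c + j + 1) + (b - j)]`. -/
theorem coeff_raise (hp : 0 < p) (hp1 : p ≠ 1) (a b c j : ℤ) :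
    p ^ c * (p ^ (2 * (j + 1)) - 1) * coeff p a b c (j + 1)
        - (p ^ (2 * j - a - b) - p ^ (a - b)) * coeff p a b c j
      = (p - p⁻¹) * qnum p ((b + c + 1 : ℤ) : ℝ) * coeff p (a - 1) b (c + 1) j := by
  have hp0 := hp.ne'
  have f1 := invFact_sub_one hp (j + 1)
  have f2 := invFact_sub_one hp (a - j)
  have f3 := invFact_sub_one hp (b - j)
  have f4 := invFact_sub_one hp (c + j + 1)
  have n1 := qnum_mul hp hp1 (j + 1)
  have n2 := qnum_mul hp hp1 (a - j)
  have n3 := qnum_add hp hp1 (c + j + 1) (b - j)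
  rw [show c + j + 1 + (b - j) = b + c + 1 by ring] at n3
  unfold coeff
  rw [show a - (j + 1) = a - j - 1 by ring, show b - (j + 1) = b - j - 1 by ring,
    show c + (j + 1) = c + j + 1 by ring, show a - 1 - j = a - j - 1 by ring,
    show c + 1 + j = c + j + 1 by ring, ← n3, f2, f3]
  rw [add_sub_cancel_right] at f1 f4
  rw [f4]
  have e1 : p ^ c * (p ^ (2 * (j + 1)) - 1) = p ^ (c + j + 1) * ((p - p⁻¹) * qnum p ((j + 1 : ℤ) : ℝ)) := by
    rw [n1, mul_sub, mul_sub, ← zpow_add₀ hp0, ← zpow_add₀ hp0, ← zpow_add₀ hp0]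
    ring_nf
  have e2 : p ^ (2 * j - a - b) - p ^ (a - b) = -(p ^ (-(b - j)) * ((p - p⁻¹) * qnum p ((a - j : ℤ) : ℝ))) := by
    rw [n2, mul_sub, ← zpow_add₀ hp0, ← zpow_add₀ hp0]
    ring_nf
  rw [e1, e2, f1]
  ring

/-- The same reduction, ending in the addition rule for `[a + 1] = [k + (a + 1 - k)]`. -/
theorem coeff_lower (hp : 0 < p) (hp1 : p ≠ 1) (a b c k : ℤ) :
    (p ^ (c + 2 * k) - p ^ (-c)) * coeff p a b c k
        - (p ^ (2 * k - 2 - a - b) - p ^ (b - a)) * coeff p a b c (k - 1)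
      = (p - p⁻¹) * qnum p ((a + 1 : ℤ) : ℝ) * coeff p (a + 1) b (c - 1) k := by
  have hp0 := hp.ne'
  have f1 := invFact_sub_one hp k
  have f2 := invFact_sub_one hp (a + 1 - k)
  have f3 := invFact_sub_one hp (b - k + 1)
  have f4 := invFact_sub_one hp (c + k)
  have n1 := qnum_mul hp hp1 (c + k)
  have n2 := qnum_mul hp hp1 (b - k + 1)
  have n3 := qnum_add hp hp1 k (a + 1 - k)
  rw [show k + (a + 1 - k) = a + 1 by ring] at n3
  rw [add_sub_cancel_right] at f3
  unfold coeff
  rw [show a - (k - 1) = a + 1 - k by ring, show b - (k - 1) = b - k + 1 by ring,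
    show c + (k - 1) = c + k - 1 by ring, show a - k = a + 1 - k - 1 by ring,
    show c - 1 + k = c + k - 1 by ring, ← n3, f1, f2, f3, f4]
  have e1 : p ^ (c + 2 * k) - p ^ (-c) = p ^ k * ((p - p⁻¹) * qnum p ((c + k : ℤ) : ℝ)) := by
    rw [n1, mul_sub, ← zpow_add₀ hp0, ← zpow_add₀ hp0]
    ring_nf
  have e2 : p ^ (2 * k - 2 - a - b) - p ^ (b - a)
      = -(p ^ (-(a + 1 - k)) * ((p - p⁻¹) * qnum p ((b - k + 1 : ℤ) : ℝ))) := by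
    rw [n2, mul_sub, ← zpow_add₀ hp0, ← zpow_add₀ hp0]
    ring_nf
  rw [e1, e2]
  ring

theorem coeff_of_gt {a b c k : ℤ} (h : b < k) : coeff p a b c k = 0 := by
  rw [coeff, invFact_of_neg (by omega : b - k < 0)]
  ring

theorem coeff_of_neg {a b c k : ℤ} (h : k < 0) : coeff p a b c k = 0 := by
  rw [coeff, invFact_of_neg h]
  ring

theorem poly_dilate (p : ℝ) (a : ℤ) (b : ℕ) (c : ℤ) (η : ℝ) :
    poly p a b c (p ^ 2 * η)
      = ∑ k ∈ Finset.range (b + 1), (-η) ^ k * (p ^ (2 * (k : ℤ)) * coeff p a b c k) := by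
  refine Finset.sum_congr rfl fun k _ => ?_
  rw [zpow_mul, zpow_natCast, ← mul_neg, mul_pow]
  norm_cast
  ring

/-- The left side is what `H₊` leaves of the polynomial once `Q` is eliminated. Comparing powers of
`η` reduces it to `coeff_raise`; the index shift is harmless because `p^{2k} - 1` vanishes at `k =
0`. -/
theorem poly_raise (hp : 0 < p) (hp1 : p ≠ 1) (a : ℤ) (b : ℕ) (c : ℤ) (η : ℝ) :
    p ^ c * (1 + p ^ (-(a + b + c)) * η) * poly p a b c (p ^ 2 * η)
        - (p ^ c + p ^ (a - b) * η) * poly p a b c η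
      = -((p - p⁻¹) * η * qnum p ((b + c + 1 : ℤ) : ℝ) * poly p (a - 1) b (c + 1) η) := by
  have hp0 := hp.ne'
  have h := sum_range_shift (b := b)
    (f := fun k : ℕ => (-η) ^ k * (p ^ c * (p ^ (2 * (k : ℤ)) - 1) * coeff p a b c k))
    (by simp) (by rw [coeff_of_gt (by push_cast; omega)]; ring)
  rw [poly_dilate p, poly, poly]
  have e : p ^ c * (1 + p ^ (-(a + b + c)) * η)
        * ∑ k ∈ Finset.range (b + 1), (-η) ^ k * (p ^ (2 * (k : ℤ)) * coeff p a b c k)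
      - (p ^ c + p ^ (a - b) * η) * ∑ k ∈ Finset.range (b + 1), (-η) ^ k * coeff p a b c k
      = ∑ k ∈ Finset.range (b + 1),
          (-η) ^ k * (p ^ c * (p ^ (2 * (k : ℤ)) - 1) * coeff p a b c k)
        + ∑ k ∈ Finset.range (b + 1), (-η) ^ k * (η *
          ((p ^ (2 * (k : ℤ) - a - b) - p ^ (a - b)) * coeff p a b c k)) := by
    rw [Finset.mul_sum, Finset.mul_sum, ← Finset.sum_sub_distrib, ← Finset.sum_add_distrib]
    refine Finset.sum_congr rfl fun k _ => ?_
    have e1 : p ^ (2 * (k : ℤ) - a - b) = p ^ c * p ^ (-(a + b + c)) * p ^ (2 * (k : ℤ)) := by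
      rw [← zpow_add₀ hp0, ← zpow_add₀ hp0]
      ring_nf
    rw [e1]
    ring
  rw [e, h, ← Finset.sum_add_distrib, Finset.mul_sum, ← Finset.sum_neg_distrib]
  refine Finset.sum_congr rfl fun k _ => ?_
  have hk := coeff_raise hp hp1 a b c k
  push_cast at hk ⊢
  rw [pow_succ]
  linear_combination (-(-η) ^ k * η) * hk

theorem poly_lower (hp : 0 < p) (hp1 : p ≠ 1) (a : ℤ) (b : ℕ) (c : ℤ) (η : ℝ) :
    p ^ c * (1 + p ^ (-(a + b + c)) * η) * poly p a b c (p ^ 2 * η)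
        - (p ^ (b - a) * η + p ^ (-c)) * poly p a b c η
      = (p - p⁻¹) * qnum p ((a + 1 : ℤ) : ℝ) * poly p (a + 1) b (c - 1) η := by
  have hp0 := hp.ne'
  have h := sum_range_shift (b := b)
    (f := fun k : ℕ => (-η) ^ k *
      ((p ^ (2 * (k : ℤ) - 2 - a - b) - p ^ (b - a)) * coeff p a b c (k - 1)))
    (by rw [coeff_of_neg (by omega)]; ring)
    -- At `k = b + 1` the two powers in the bracket coincide, so the last shifted term vanishes
    -- although its coefficient need not.
    (by
      rw [show 2 * (((b + 1 : ℕ) : ℤ)) - 2 - a - b = b - a by push_cast; ring]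
      ring)
  rw [poly_dilate p, poly, poly]
  have e : p ^ c * (1 + p ^ (-(a + b + c)) * η)
        * ∑ k ∈ Finset.range (b + 1), (-η) ^ k * (p ^ (2 * (k : ℤ)) * coeff p a b c k)
      - (p ^ (b - a) * η + p ^ (-c)) * ∑ k ∈ Finset.range (b + 1), (-η) ^ k * coeff p a b c k
      = ∑ k ∈ Finset.range (b + 1),
          (-η) ^ k * ((p ^ (c + 2 * (k : ℤ)) - p ^ (-c)) * coeff p a b c k)
        - ∑ k ∈ Finset.range (b + 1), (-η) ^ (k + 1) *
          ((p ^ (2 * ((k + 1 : ℕ) : ℤ) - 2 - a - b) - p ^ (b - a))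
            * coeff p a b c (((k + 1 : ℕ) : ℤ) - 1)) := by
    rw [Finset.mul_sum, Finset.mul_sum, ← Finset.sum_sub_distrib, ← Finset.sum_sub_distrib]
    refine Finset.sum_congr rfl fun k _ => ?_
    have e1 : p ^ (2 * ((k + 1 : ℕ) : ℤ) - 2 - a - b)
        = p ^ c * p ^ (-(a + b + c)) * p ^ (2 * (k : ℤ)) := by
      rw [← zpow_add₀ hp0, ← zpow_add₀ hp0]
      push_cast
      ring_nf
    rw [e1, zpow_add₀ hp0 c, show ((k + 1 : ℕ) : ℤ) - 1 = k by push_cast; ring, pow_succ]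
    ring
  rw [e, ← h, ← Finset.sum_sub_distrib, Finset.mul_sum]
  refine Finset.sum_congr rfl fun k _ => ?_
  have hk := coeff_lower hp hp1 a b c k
  linear_combination (-η) ^ k * hk

/-- The value `a = -1` stands for `M = J + 1`: this is why `H₊` annihilates the highest vector. -/
theorem poly_neg_one (b : ℕ) (c : ℤ) (η : ℝ) : poly p (-1) b c η = 0 := by
  refine Finset.sum_eq_zero fun k _ => ?_
  rw [coeff, invFact_of_neg (by omega : (-1 : ℤ) - k < 0)]
  ring

theorem poly_eq_zero_of_lt {b : ℕ} {a c : ℤ} (h : c + b < 0) (η : ℝ) : poly p a b c η = 0 := by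
  refine Finset.sum_eq_zero fun k hk => ?_
  have := Finset.mem_range.1 hk
  rw [coeff, invFact_of_neg (by omega : c + (k : ℤ) < 0)]
  ring

theorem poly_zero (b : ℕ) (c : ℤ) (η : ℝ) :
    poly p 0 b c η = (qfact p b)⁻¹ * invFact p c := by
  rw [poly, Finset.sum_range_succ', Finset.sum_eq_zero]
  · have h0 : invFact p 0 = 1 := by
      have := invFact_natCast p 0
      simpa [qfact] using this
    simp [coeff, h0, invFact_natCast]
  · intro k _
    rw [coeff, invFact_of_neg (by push_cast; omega : (0 : ℤ) - ((k + 1 : ℕ) : ℤ) < 0)]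
    ring

end poly

/-! ### The basis functions -/

/-- A radial function times a power of `z̄`. -/
noncomputable def radial (g : ℝ → ℝ) (c : ℤ) (z w : ℂ) : ℂ := ((g (z * w).re : ℝ) : ℂ) * w ^ c

theorem zpow_le_of_le {t ρ : ℝ} (ht : 0 < t) (h1 : t ≤ ρ) (h2 : t⁻¹ ≤ ρ) (c : ℤ) :
    t ^ c ≤ ρ ^ c.natAbs := by
  rcases Int.natAbs_eq c with h | h
  · rw [h, zpow_natCast, Int.natAbs_natCast]
    gcongr
  · rw [h, zpow_neg, zpow_natCast, Int.natAbs_neg, Int.natAbs_natCast, ← inv_pow]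
    have := inv_pos.2 ht
    gcongr

/-- For fixed `z w = η` only the power of `w = η / z` varies, which is holomorphic off the origin. A
bounded ratio of moduli makes `|w|` comparable to `√η`, so a bound on the plane suffices.
Measurability is asked of `g (max x 0)` because only nonnegative arguments occur. -/
theorem regular_radial {g : ℝ → ℝ} (hm : Measurable fun x => g (max x 0)) {c : ℤ} {B : ℝ}
    (hB : ∀ η, 0 < η → |g η| * √η ^ c ≤ B) : Regular (radial g c) where
  holo η hη := by
    have h : DifferentiableOn ℂ (fun z : ℂ => ((g η : ℝ) : ℂ) * ((η : ℂ) / z) ^ c)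
        {z | z ≠ 0} := by
      intro z hz
      have hz : z ≠ 0 := hz
      have hne : (η : ℂ) / z ≠ 0 := div_ne_zero (by exact_mod_cast hη.ne') hz
      have h1 : DifferentiableAt ℂ (fun z : ℂ => (η : ℂ) / z) z := by
        fun_prop (disch := exact hz)
      exact ((h1.zpow (.inl hne)).const_mul _).differentiableWithinAt
    refine h.congr fun z hz => ?_
    have hz : z ≠ 0 := hz
    simp [radial, mul_div_cancel₀ (η : ℂ) hz]
  bdd r := by
    refine ⟨√r ^ c.natAbs * B, fun z w h1 h2 h3 => ?_⟩
    have hz : 0 < ‖z‖ := norm_pos_iff.2 (by rintro rfl; simp at h1)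
    have hw : 0 < ‖w‖ := norm_pos_iff.2 (by rintro rfl; simp at h1)
    obtain ⟨η, hη, hzw⟩ : ∃ η : ℝ, 0 < η ∧ z * w = η := by
      rw [Complex.pos_iff] at h1
      exact ⟨(z * w).re, h1.1, Complex.ext rfl (by simpa using h1.2.symm)⟩
    have hn : ‖z‖ * ‖w‖ = η := by
      rw [← norm_mul, hzw, Complex.norm_real, Real.norm_eq_abs, abs_of_pos hη]
    have hs : 0 < √η := Real.sqrt_pos.2 hη
    have e1 : ‖w‖ / √η ≤ √r := by
      refine Real.le_sqrt_of_sq_le ?_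
      rw [div_pow, Real.sq_sqrt hη.le, div_le_iff₀ hη, ← hn]
      nlinarith
    have e2 : (‖w‖ / √η)⁻¹ ≤ √r := by
      refine Real.le_sqrt_of_sq_le ?_
      rw [inv_div, div_pow, Real.sq_sqrt hη.le, div_le_iff₀ (by positivity), ← hn]
      nlinarith
    have h4 := zpow_le_of_le (div_pos hw hs) e1 e2 c
    have e3 : ‖radial g c z w‖ = (‖w‖ / √η) ^ c * (|g η| * √η ^ c) := by
      rw [radial, hzw, norm_mul, Complex.norm_real, norm_zpow, Complex.ofReal_re,
        Real.norm_eq_abs, div_zpow]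
      have : √η ^ c ≠ 0 := (zpow_pos hs c).ne'
      field_simp
    rw [e3]
    have := zpow_pos hs c
    exact mul_le_mul h4 (hB η hη) (by positivity) (by positivity)
  meas s t hs ht := by
    have e : (fun z : ℂ => radial g c ((s : ℂ) * z) ((t : ℂ) * conj z))
        = fun z : ℂ => (((fun x => g (max x 0)) (s * t * ‖z‖ ^ 2) : ℝ) : ℂ)
          * ((t : ℂ) * conj z) ^ c := by
      funext z
      have h1 : (s : ℂ) * z * ((t : ℂ) * conj z) = ((s * t * ‖z‖ ^ 2 : ℝ) : ℂ) := by
        rw [show (s : ℂ) * z * ((t : ℂ) * conj z) = s * t * (z * conj z) by ring,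
          Complex.mul_conj, Complex.normSq_eq_norm_sq]
        push_cast
        ring
      rw [radial, h1, Complex.ofReal_re]
      simp only
      rw [max_eq_left (by positivity)]
    rw [e]
    have h1 : Measurable fun z : ℂ => (fun x => g (max x 0)) (s * t * ‖z‖ ^ 2) :=
      hm.comp (by fun_prop)
    have h2 : Measurable fun z : ℂ => ((t : ℂ) * conj z) ^ c :=
      (measurable_const.mul Complex.continuous_conj.measurable).pow_const c
    exact ((Complex.measurable_ofReal.comp h1).mul h2).aestronglyMeasurable

/-! #### Labels -/

theorem IsLabel.exists_nat {N J M : ℝ} (hN : ∃ k : ℤ, 2 * N = k) (h : IsLabel N J M) :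
    ∃ a b d e : ℕ, J - M = a ∧ J - N = b ∧ J + M = d ∧ J + N = e := by
  obtain ⟨n, hn⟩ := hN
  obtain ⟨⟨k, hk⟩, ⟨d, hd⟩, hMJ⟩ := h
  obtain ⟨b, e, hb, he⟩ : ∃ b e : ℕ, J - N = b ∧ J + N = e := by
    rcases le_total 0 N with h0 | h0
    · rw [abs_of_nonneg h0] at hk
      have hn0 : 0 ≤ n := by
        have : (0 : ℝ) ≤ n := by linarith
        exact_mod_cast this
      lift n to ℕ using hn0
      refine ⟨k, n + k, by linarith, ?_⟩
      push_cast at hn ⊢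
      linarith
    · rw [abs_of_nonpos h0] at hk
      have hn0 : 0 ≤ -n := by
        have : (0 : ℝ) ≤ -n := by linarith
        exact_mod_cast this
      obtain ⟨m, hm⟩ := Int.eq_ofNat_of_zero_le hn0
      have hm' : -(n : ℝ) = m := by exact_mod_cast hm
      refine ⟨m + k, k, ?_, by linarith⟩
      push_cast
      linarith
  have hle : d ≤ b + e := by
    have : (d : ℝ) ≤ b + e := by linarith
    exact_mod_cast this
  refine ⟨b + e - d, b, d, e, ?_, hb, by linarith, he⟩
  rw [Nat.cast_sub hle]
  push_cast
  linarith

theorem IsLabel.succ {N J M : ℝ} (h : IsLabel N J M) {a : ℕ} (ha : J - M = (a : ℝ) + 1) :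
    IsLabel N J (M + 1) := by
  obtain ⟨h1, ⟨d, hd⟩, -⟩ := h
  refine ⟨h1, ⟨d + 1, by push_cast; linarith⟩, ?_⟩
  have := a.cast_nonneg (α := ℝ)
  linarith

theorem IsLabel.pred {N J M : ℝ} (h : IsLabel N J M) {d : ℕ} (hd : J + M = (d : ℝ) + 1) :
    IsLabel N J (M - 1) := by
  obtain ⟨h1, -, h2⟩ := h
  exact ⟨h1, ⟨d, by linarith⟩, by linarith⟩

/-- The constant factor of `Psi` in terms of `poly`. -/
noncomputable def psiConst (J M N p : ℝ) : ℝ :=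
  normConst J M N p * p ^ (-(N * M / 2)) * (qfact p (J - N) * qfact p (J - M))

theorem Psi_eq {J M N : ℝ} {a b e : ℕ} (ha : J - M = a) (hb : J - N = b) (he : J + N = e)
    (p : ℝ) :
    Psi J M N p = radial (fun η => psiConst J M N p * (Q J p η * poly p a b (e - a) η))
      (e - a) := by
  have hc : M + N = (((e : ℤ) - a : ℤ) : ℝ) := by push_cast; linarith
  funext z w
  rw [Psi, radial, R_eq ha hb hc, hc, Int.floor_intCast, psiConst, ha, hb]
  congr 2
  ring

theorem half_integer {J N : ℝ} {b e : ℕ} (hb : J - N = b) (he : J + N = e) :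
    2 * J = ((b + e : ℕ) : ℝ) := by
  push_cast; linarith

/-! #### Action of the generators -/

theorem H3_radial (N : ℝ) {ψ : Family} {p : ℝ} {g : ℝ → ℝ} {c : ℤ} (hψ : ψ p = radial g c)
    (z w : ℂ) : H3 N ψ p z w = ((c : ℂ) - N) * ψ p z w := by
  have h : (fun s : ℂ => ψ p (Complex.exp (-s) * z) (Complex.exp s * w))
      = fun s : ℂ => ((g (z * w).re : ℝ) : ℂ) * w ^ c * Complex.exp (c * s) := by
    funext s
    have e1 : Complex.exp (-s) * z * (Complex.exp s * w) = z * w := by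
      rw [show Complex.exp (-s) * z * (Complex.exp s * w)
        = (Complex.exp (-s) * Complex.exp s) * (z * w) by ring, ← Complex.exp_add,
        neg_add_cancel, Complex.exp_zero, one_mul]
    rw [hψ, radial, e1, mul_zpow, ← Complex.exp_int_mul]
    ring
  have h2 : HasDerivAt (fun s : ℂ => ((g (z * w).re : ℝ) : ℂ) * w ^ c * Complex.exp (c * s))
      (((g (z * w).re : ℝ) : ℂ) * w ^ c * (Complex.exp (c * 0) * (c * 1))) 0 :=
    (((hasDerivAt_id (0 : ℂ)).const_mul (c : ℂ)).cexp).const_mul _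
  rw [H3, h, h2.deriv, hψ, radial]
  simp
  ring

/-- `Q_dilate` eliminates the dilated `Q`, the two `(p, p⁻¹)`-type dilations do not change `η`, and
what is left is `poly_raise`. -/
theorem Hplus_radial {N J K p : ℝ} {ψ : Family} {a b : ℕ} {c : ℤ} {n : ℕ} (hp : 0 < p)
    (hp1 : p ≠ 1) (hJ : 2 * J = n) (hn : (n : ℤ) = a + b + c)
    (hN : 2 * N = ((a - b + c : ℤ) : ℝ))
    (hψ : ψ p = radial (fun η => K * (Q J p η * poly p a b c η)) c) {z w : ℂ} (hzw : 0 < z * w) :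
    Hplus N ψ p z w = radial (fun η => K * (p ^ (N / 2))⁻¹ * qnum p ((b + c + 1 : ℤ) : ℝ) *
      (Q J p η * poly p (a - 1) b (c + 1) η)) (c + 1) z w := by
  have hw : w ≠ 0 := by rintro rfl; simp at hzw
  have hp' : (p : ℂ) ≠ 0 := by exact_mod_cast hp.ne'
  obtain ⟨η, hη, h⟩ : ∃ η : ℝ, 0 < η ∧ z * w = η := by
    rw [Complex.pos_iff] at hzw
    exact ⟨(z * w).re, hzw.1, Complex.ext rfl (by simpa using hzw.2.symm)⟩
  have hz : z⁻¹ = w * (η : ℂ)⁻¹ := by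
    have : z ≠ 0 := by rintro rfl; simp at hzw
    rw [← h]
    field_simp
  set s : ℝ := p ^ (N / 2) with hs
  have hs0 : 0 < s := Real.rpow_pos_of_pos hp _
  -- Here `s ^ 4 = p^{2N}`, and `2N = a - b + c`.
  have hs4 : s ^ 4 = p ^ (a - b : ℤ) * p ^ c := by
    rw [hs, ← zpow_add₀ hp.ne', ← Real.rpow_natCast, ← Real.rpow_mul hp.le, ← Real.rpow_intCast]
    congr 1
    rw [← hN]
    push_cast
    ring
  have hd := sub_inv_ne_zero hp hp1
  have hpc : p ^ c ≠ 0 := (zpow_pos hp c).ne'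
  have f1 := Q_dilate hp hp1 hJ hη.le
  have f2 := poly_raise hp hp1 a b c η
  rw [← hn, zpow_neg, zpow_natCast] at f2
  have e1 : ((p : ℂ) * z * (p * w)).re = p ^ 2 * η := by
    rw [show (p : ℂ) * z * (p * w) = p ^ 2 * (z * w) by ring, h, ← Complex.ofReal_pow,
      ← Complex.ofReal_mul, Complex.ofReal_re]
  have e2 : ((p : ℂ)⁻¹ * z * (p * w)).re = η := by
    rw [show (p : ℂ)⁻¹ * z * (p * w) = z * w by field_simp, h, Complex.ofReal_re]
  have e3 : ((p : ℂ) * z * ((p : ℂ)⁻¹ * w)).re = η := by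
    rw [show (p : ℂ) * z * ((p : ℂ)⁻¹ * w) = z * w by field_simp, h, Complex.ofReal_re]
  have e4 : (z * w).re = η := by rw [h, Complex.ofReal_re]
  rw [Hplus_apply N ψ hp z w hs, hψ]
  simp only [radial, e1, e2, e3, e4, mul_zpow, inv_zpow]
  generalize Q J p (p ^ 2 * η) = Q₁ at *
  generalize Q J p η = Q₀ at *
  generalize poly p a b c (p ^ 2 * η) = P₁ at *
  generalize poly p a b c η = P₀ at *
  generalize poly p (a - 1) b (c + 1) η = P at *
  generalize qnum p ((b + c + 1 : ℤ) : ℝ) = x at *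
  rw [zpow_add₀ hw, zpow_one, hz]
  have main : -(s⁻¹ * (η⁻¹ + 1) * (K * (Q₁ * P₁) * p ^ c) - s⁻¹ * η⁻¹ * (K * (Q₀ * P₀) * p ^ c)
      - s ^ 3 * (K * (Q₀ * P₀) * (p ^ c)⁻¹)) / (p - p⁻¹) = K * s⁻¹ * x * (Q₀ * P) := by
    rw [div_eq_iff hd]
    have hs3 : s ^ 3 * (p ^ c)⁻¹ = s⁻¹ * p ^ (a - b : ℤ) := by
      field_simp
      rw [hs4, mul_comm]
    have : η⁻¹ + 1 = η⁻¹ * (1 + η) := by field_simp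
    rw [show s ^ 3 * (K * (Q₀ * P₀) * (p ^ c)⁻¹) = K * (Q₀ * P₀) * (s ^ 3 * (p ^ c)⁻¹) by ring,
      hs3, this]
    have hη' : η * η⁻¹ = 1 := mul_inv_cancel₀ hη.ne'
    linear_combination (-(s⁻¹ * η⁻¹ * K * P₁ * p ^ c)) * f1 - s⁻¹ * η⁻¹ * K * Q₀ * f2
      + (K * Q₀ * s⁻¹ * ((p - p⁻¹) * x * P - p ^ (a - b : ℤ) * P₀)) * hη'
  have mainC := congrArg (fun t : ℝ => (t : ℂ)) main
  push_cast at mainC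
  push_cast
  rw [show (K : ℂ) * (s : ℂ)⁻¹ * x * (Q₀ * P) * (w ^ c * w) = (K * (s : ℂ)⁻¹ * x * (Q₀ * P)) * (w ^ c * w)
    by ring, ← mainC]
  ring

theorem Hminus_radial {N J K p : ℝ} {ψ : Family} {a b : ℕ} {c : ℤ} {n : ℕ} (hp : 0 < p)
    (hp1 : p ≠ 1) (hJ : 2 * J = n) (hn : (n : ℤ) = a + b + c)
    (hN : 2 * N = ((a - b + c : ℤ) : ℝ))
    (hψ : ψ p = radial (fun η => K * (Q J p η * poly p a b c η)) c) {z w : ℂ} (hzw : 0 < z * w) :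
    Hminus N ψ p z w = radial (fun η => K * p ^ (N / 2) * qnum p ((a + 1 : ℤ) : ℝ) *
      (Q J p η * poly p (a + 1) b (c - 1) η)) (c - 1) z w := by
  have hw : w ≠ 0 := by rintro rfl; simp at hzw
  have hp' : (p : ℂ) ≠ 0 := by exact_mod_cast hp.ne'
  obtain ⟨η, hη, h⟩ : ∃ η : ℝ, 0 < η ∧ z * w = η := by
    rw [Complex.pos_iff] at hzw
    exact ⟨(z * w).re, hzw.1, Complex.ext rfl (by simpa using hzw.2.symm)⟩
  have hz : z = w⁻¹ * η := by
    rw [← h]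
    field_simp
  set s : ℝ := p ^ (N / 2) with hs
  have hs0 : 0 < s := Real.rpow_pos_of_pos hp _
  have hs4 : s ^ 4 = p ^ (a - b : ℤ) * p ^ c := by
    rw [hs, ← zpow_add₀ hp.ne', ← Real.rpow_natCast, ← Real.rpow_mul hp.le, ← Real.rpow_intCast]
    congr 1
    rw [← hN]
    push_cast
    ring
  have hd := sub_inv_ne_zero hp hp1
  have hpc : p ^ c ≠ 0 := (zpow_pos hp c).ne'
  have f1 := Q_dilate hp hp1 hJ hη.le
  have f2 := poly_lower hp hp1 a b c η
  rw [← hn, zpow_neg, zpow_natCast, zpow_neg] at f2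
  have e1 : ((p : ℂ) * z * (p * w)).re = p ^ 2 * η := by
    rw [show (p : ℂ) * z * (p * w) = p ^ 2 * (z * w) by ring, h, ← Complex.ofReal_pow,
      ← Complex.ofReal_mul, Complex.ofReal_re]
  have e2 : ((p : ℂ)⁻¹ * z * (p * w)).re = η := by
    rw [show (p : ℂ)⁻¹ * z * (p * w) = z * w by field_simp, h, Complex.ofReal_re]
  have e3 : ((p : ℂ) * z * ((p : ℂ)⁻¹ * w)).re = η := by
    rw [show (p : ℂ) * z * ((p : ℂ)⁻¹ * w) = z * w by field_simp, h, Complex.ofReal_re]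
  have e4 : (z * w).re = η := by rw [h, Complex.ofReal_re]
  rw [Hminus_apply N ψ hp z w hs, hψ]
  simp only [radial, e1, e2, e3, e4, mul_zpow, inv_zpow]
  generalize Q J p (p ^ 2 * η) = Q₁ at *
  generalize Q J p η = Q₀ at *
  generalize poly p a b c (p ^ 2 * η) = P₁ at *
  generalize poly p a b c η = P₀ at *
  generalize poly p (a + 1) b (c - 1) η = P at *
  generalize qnum p ((a + 1 : ℤ) : ℝ) = x at *
  rw [zpow_sub₀ hw, zpow_one, hz]
  have main : (s * (η + 1) * (K * (Q₁ * P₁) * p ^ c) - s⁻¹ ^ 3 * η * (K * (Q₀ * P₀) * p ^ c)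
      - s * (K * (Q₀ * P₀) * (p ^ c)⁻¹)) / (p - p⁻¹) = K * s * x * (Q₀ * P) := by
    rw [div_eq_iff hd]
    have hs3 : s⁻¹ ^ 3 * p ^ c = s * p ^ (b - a : ℤ) := by
      have : p ^ (b - a : ℤ) = (p ^ (a - b : ℤ))⁻¹ := by rw [← zpow_neg, neg_sub]
      have h0 : p ^ (a - b : ℤ) ≠ 0 := (zpow_pos hp _).ne'
      rw [this]
      field_simp
      rw [hs4]
      ring
    rw [show s⁻¹ ^ 3 * η * (K * (Q₀ * P₀) * p ^ c) = η * (K * (Q₀ * P₀)) * (s⁻¹ ^ 3 * p ^ c) by ring,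
      hs3]
    linear_combination (s * K * P₁ * p ^ c) * f1 + s * K * Q₀ * f2
  have mainC := congrArg (fun t : ℝ => (t : ℂ)) main
  push_cast at mainC
  push_cast
  rw [← mainC]
  field_simp

theorem Psi_H3 {J M N : ℝ} {a b e : ℕ} (ha : J - M = a) (hb : J - N = b) (he : J + N = e)
    (p : ℝ) (z w : ℂ) : H3 N (Psi J M N) p z w = (M : ℂ) * Psi J M N p z w := by
  rw [H3_radial N (Psi_eq ha hb he p)]
  have hM : M = (e : ℝ) - a - N := by linarith
  rw [hM]
  push_cast
  rfl

/-- The factor `q^{-NM/2}` in the basis functions absorbs the `p^{-N/2}` produced by `H₊`, and the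
square roots of the normalization turn `[J + M + 1]` into the symmetric matrix element. -/
theorem psiConst_raise {J M N p : ℝ} {a d : ℕ} (hp : 0 < p) (ha : J - M = (a : ℝ) + 1)
    (hd : J + M = d) :
    psiConst J M N p * (p ^ (N / 2))⁻¹ * qnum p ((d : ℝ) + 1)
      = √(qnum p ((a : ℝ) + 1) * qnum p ((d : ℝ) + 1)) * psiConst J (M + 1) N p := by
  have ha' : J - (M + 1) = a := by linarith
  have hd' : J + (M + 1) = (d : ℝ) + 1 := by linarith
  have h1 := qnum_natCast_succ_pos hp a
  have h2 := qnum_natCast_succ_pos hp d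
  have h3 := qfact_pos hp (a : ℝ)
  have h4 := qfact_pos hp (d : ℝ)
  have h5 := qfact_pos hp (2 * J)
  have hpow : p ^ (-(N * (M + 1) / 2)) = p ^ (-(N * M / 2)) * (p ^ (N / 2))⁻¹ := by
    rw [← Real.rpow_neg hp.le, ← Real.rpow_add hp]
    ring_nf
  unfold psiConst normConst
  rw [hpow, ha, hd, ha', hd', qfact_natCast_succ, qfact_natCast_succ]
  set x := qnum p ((a : ℝ) + 1)
  set y := qnum p ((d : ℝ) + 1)
  set A := qfact p (a : ℝ)
  set D := qfact p (d : ℝ)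
  set T := qfact p (2 * J)
  have e1 : √(D / (x * A * T)) * x * y = √(x * y) * √(y * D / (A * T)) := by
    rw [← Real.sqrt_mul (by positivity)]
    have : √(D / (x * A * T)) * x * y = √(D / (x * A * T) * (x * y) ^ 2) := by
      rw [Real.sqrt_mul (by positivity), Real.sqrt_sq (by positivity)]
      ring
    rw [this]
    congr 1
    field_simp
  linear_combination (1 / √(2 * Real.pi) * √(qfact p (J + N) * qfact p (2 * J + 1)
    / qfact p (J - N)) * p ^ (-(N * M / 2)) * qfact p (J - N) * A * (p ^ (N / 2))⁻¹) * e1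

theorem Psi_Hplus {J M N p : ℝ} {a b d e : ℕ} (hp : 0 < p) (hp1 : p ≠ 1)
    (ha : J - M = (a : ℝ) + 1) (hb : J - N = b) (hd : J + M = d) (he : J + N = e) {z w : ℂ}
    (hzw : 0 < z * w) :
    Hplus N (Psi J M N) p z w
      = (√(qnum p ((a : ℝ) + 1) * qnum p ((d : ℝ) + 1)) : ℂ) * Psi J (M + 1) N p z w := by
  have ha0 : J - M = ((a + 1 : ℕ) : ℝ) := by push_cast; exact ha
  have had : a + 1 + d = b + e := by
    have : (a : ℝ) + 1 + d = b + e := by linarith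
    exact_mod_cast this
  rw [Hplus_radial hp hp1 (half_integer hb he) (by push_cast; ring)
    (by push_cast; linarith) (Psi_eq ha0 hb he p) hzw,
    Psi_eq (a := a) (by linarith) hb he]
  have e1 : ((a + 1 : ℕ) : ℤ) - 1 = a := by push_cast; ring
  have e2 : (e : ℤ) - ((a + 1 : ℕ) : ℤ) + 1 = e - a := by push_cast; ring
  have e3 : (((b : ℤ) + ((e : ℤ) - ((a + 1 : ℕ) : ℤ)) + 1 : ℤ) : ℝ) = (d : ℝ) + 1 := by
    have : (b : ℤ) + ((e : ℤ) - ((a + 1 : ℕ) : ℤ)) + 1 = d + 1 := by push_cast; omega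
    rw [this]
    push_cast
    rfl
  rw [e1, e2, e3, psiConst_raise hp ha hd]
  simp only [radial]
  push_cast
  ring

theorem Psi_Hplus_top {J N p : ℝ} {b e : ℕ} (hp : 0 < p) (hp1 : p ≠ 1)
    (hb : J - N = b) (he : J + N = e) {z w : ℂ} (hzw : 0 < z * w) :
    Hplus N (Psi J J N) p z w = 0 := by
  have ha : J - J = ((0 : ℕ) : ℝ) := by simp
  rw [Hplus_radial hp hp1 (half_integer hb he) (by push_cast; ring)
    (by push_cast; linarith) (Psi_eq ha hb he p) hzw]
  simp only [radial, Nat.cast_zero, zero_sub, poly_neg_one]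
  simp

theorem psiConst_lower {J M N p : ℝ} {a d : ℕ} (hp : 0 < p) (ha : J - M = a)
    (hd : J + M = (d : ℝ) + 1) :
    psiConst J M N p * p ^ (N / 2) * qnum p ((a : ℝ) + 1)
      = √(qnum p ((a : ℝ) + 1) * qnum p ((d : ℝ) + 1)) * psiConst J (M - 1) N p := by
  have h := psiConst_raise (N := N) (J := J) (M := M - 1) (a := a) (d := d) hp (by linarith)
    (by linarith)
  rw [sub_add_cancel] at h
  have h1 := qnum_natCast_succ_pos hp a
  have h2 := qnum_natCast_succ_pos hp d
  have h3 := Real.mul_self_sqrt (mul_pos h1 h2).le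
  set r := √(qnum p ((a : ℝ) + 1) * qnum p ((d : ℝ) + 1))
  have hr : 0 < r := Real.sqrt_pos.2 (mul_pos h1 h2)
  have hs : 0 < p ^ (N / 2) := Real.rpow_pos_of_pos hp _
  refine mul_left_cancel₀ hr.ne' ?_
  rw [show r * (psiConst J M N p * p ^ (N / 2) * qnum p ((a : ℝ) + 1))
    = r * psiConst J M N p * (p ^ (N / 2) * qnum p ((a : ℝ) + 1)) by ring, ← h, ← mul_assoc r r, h3]
  field_simp

theorem Psi_Hminus {J M N p : ℝ} {a b d e : ℕ} (hp : 0 < p) (hp1 : p ≠ 1)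
    (ha : J - M = a) (hb : J - N = b) (hd : J + M = (d : ℝ) + 1) (he : J + N = e) {z w : ℂ}
    (hzw : 0 < z * w) :
    Hminus N (Psi J M N) p z w
      = (√(qnum p ((a : ℝ) + 1) * qnum p ((d : ℝ) + 1)) : ℂ) * Psi J (M - 1) N p z w := by
  rw [Hminus_radial hp hp1 (half_integer hb he) (by push_cast; ring)
    (by push_cast; linarith) (Psi_eq ha hb he p) hzw,
    Psi_eq (M := M - 1) (a := a + 1) (by push_cast; linarith) hb he]
  have e2 : (e : ℤ) - a - 1 = e - ((a + 1 : ℕ) : ℤ) := by push_cast; ring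
  have e3 : (((a : ℤ) + 1 : ℤ) : ℝ) = (a : ℝ) + 1 := by push_cast; rfl
  rw [e2, e3, psiConst_lower hp ha hd, ← Nat.cast_succ]
  simp only [radial]
  push_cast
  ring

theorem Psi_Hminus_bot {J N p : ℝ} {b e : ℕ} (hp : 0 < p) (hp1 : p ≠ 1)
    (hb : J - N = b) (he : J + N = e) {z w : ℂ} (hzw : 0 < z * w) :
    Hminus N (Psi J (-J) N) p z w = 0 := by
  have ha : J - -J = ((b + e : ℕ) : ℝ) := by push_cast; linarith
  rw [Hminus_radial hp hp1 (half_integer hb he) (by push_cast; ring)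
    (by push_cast; linarith) (Psi_eq ha hb he p) hzw]
  simp only [radial]
  rw [poly_eq_zero_of_lt (by push_cast; omega)]
  simp

/-! #### Bounds for the basis functions -/

/-- A nonzero coefficient needs `a - e ≤ k ≤ min a b`, so each term is a power of `√η` with exponent
between `0` and `b + e = 2J`. This is exactly what the decay of `Q` compensates. -/
theorem abs_poly_mul_le {p : ℝ} {a b e : ℕ} {η : ℝ} (hη : 0 < η) :
    |poly p a b (e - a) η| * √η ^ ((e : ℤ) - a)
      ≤ (∑ k ∈ Finset.range (b + 1), |coeff p a b (e - a) k|) * √(1 + η) ^ (b + e) := by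
  have hs : 0 < √η := Real.sqrt_pos.2 hη
  have hpos : 0 < √η ^ ((e : ℤ) - a) := zpow_pos hs _
  rw [Finset.sum_mul]
  refine (mul_le_mul_of_nonneg_right (Finset.abs_sum_le_sum_abs _ _) hpos.le).trans ?_
  rw [Finset.sum_mul]
  refine Finset.sum_le_sum fun k hk => ?_
  have hkb : k ≤ b := by have := Finset.mem_range.1 hk; omega
  by_cases h0 : (e : ℤ) - a + k < 0
  · rw [coeff, invFact_of_neg h0]
    simp
  by_cases h1 : (a : ℤ) - k < 0
  · rw [coeff, invFact_of_neg h1]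
    simp
  obtain ⟨m, hm⟩ : ∃ m : ℕ, (2 * (k : ℤ)) + (e - a) = m := ⟨(2 * (k : ℤ) + (e - a)).toNat, by omega⟩
  have hmle : m ≤ b + e := by omega
  have e1 : η ^ k * √η ^ ((e : ℤ) - a) = √η ^ m := by
    rw [← zpow_natCast (√η) m, ← hm, zpow_add₀ hs.ne', zpow_mul, zpow_natCast]
    norm_cast
    rw [Real.sq_sqrt hη.le]
  have hle : √η ≤ √(1 + η) := Real.sqrt_le_sqrt (by linarith)
  have h1le : 1 ≤ √(1 + η) := Real.one_le_sqrt.2 (by linarith)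
  calc |(-η) ^ k * coeff p a b (e - a) k| * √η ^ ((e : ℤ) - a)
      = |coeff p a b (e - a) k| * (η ^ k * √η ^ ((e : ℤ) - a)) := by
        rw [abs_mul, abs_pow, abs_neg, abs_of_pos hη]; ring
    _ ≤ |coeff p a b (e - a) k| * √(1 + η) ^ (b + e) := by
        rw [e1]
        gcongr
        exact (pow_le_pow_left₀ hs.le hle m).trans (pow_le_pow_right₀ h1le hmle)

theorem Q_mul_sqrt_le {J p η : ℝ} {n : ℕ} (hp : 0 < p) (hJ : 2 * J = n) (hη : 0 ≤ η) :
    Q J p η * √(1 + η) ^ n ≤ √((spread p ^ (2 * n + 2)) ^ n) := by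
  refine Real.le_sqrt_of_sq_le ?_
  rw [mul_pow, ← pow_mul, mul_comm n 2, pow_mul, Real.sq_sqrt (by positivity)]
  exact Q_sq_mul_le hp hJ hη

/-- A bound for `Psi` on the plane. -/
noncomputable def psiBound (J M N : ℝ) (a b e : ℕ) (p : ℝ) : ℝ :=
  |psiConst J M N p| * (∑ k ∈ Finset.range (b + 1), |coeff p a b (e - a) k|)
    * √((spread p ^ (2 * (b + e) + 2)) ^ (b + e))

section Psi

variable {J M N p : ℝ} {a b e : ℕ}

theorem abs_psi_mul_le (hp : 0 < p) (hb : J - N = b) (he : J + N = e) {η : ℝ} (hη : 0 < η) :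
    |psiConst J M N p * (Q J p η * poly p a b (e - a) η)| * √η ^ ((e : ℤ) - a)
      ≤ psiBound J M N a b e p := by
  have h1 := abs_poly_mul_le (p := p) (a := a) (b := b) (e := e) hη
  have h2 := Q_mul_sqrt_le hp (half_integer hb he) hη.le
  have hQ := Q_pos hp (half_integer hb he) hη.le
  rw [abs_mul, abs_mul, abs_of_pos hQ, psiBound, mul_assoc, mul_assoc, mul_assoc]
  gcongr |psiConst J M N p| * ?_
  calc Q J p η * (|poly p a b (e - a) η| * √η ^ ((e : ℤ) - a))
      ≤ Q J p η * ((∑ k ∈ Finset.range (b + 1), |coeff p a b (e - a) k|) * √(1 + η) ^ (b + e)) := by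
        gcongr
    _ = (∑ k ∈ Finset.range (b + 1), |coeff p a b (e - a) k|) * (Q J p η * √(1 + η) ^ (b + e)) := by
        ring
    _ ≤ _ := by
        gcongr

theorem measurable_psi (hp : 0 < p) (hb : J - N = b) (he : J + N = e) :
    Measurable fun x => (fun η => psiConst J M N p * (Q J p η * poly p a b (e - a) η)) (max x 0) := by
  have hQ : Measurable fun x => Q J p (max x 0) :=
    -- Monotonicity replaces a measurability argument for the infinite product.
    Antitone.measurable fun x y hxy =>
      Q_antitone hp (half_integer hb he) (le_max_right x 0) (max_le_max hxy le_rfl)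
  have hP : Measurable fun x => poly p a b (e - a) (max x 0) := by
    unfold poly
    fun_prop
  exact measurable_const.mul (hQ.mul hP)

theorem regular_Psi (hp : 0 < p) (ha : J - M = a) (hb : J - N = b) (he : J + N = e) :
    Regular (Psi J M N p) := by
  rw [Psi_eq ha hb he]
  exact regular_radial (measurable_psi hp hb he) fun η hη => abs_psi_mul_le hp hb he hη

theorem norm_Psi_le (hp : 0 < p) (ha : J - M = a) (hb : J - N = b) (he : J + N = e) {z : ℂ}
    (hz : z ≠ 0) : ‖Psi J M N p z (conj z)‖ ≤ psiBound J M N a b e p := by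
  have hz' : 0 < ‖z‖ := norm_pos_iff.2 hz
  have h := abs_psi_mul_le (M := M) (a := a) hp hb he (η := ‖z‖ ^ 2) (by positivity)
  rw [Real.sqrt_sq hz'.le] at h
  rw [Psi_eq ha hb he, radial, Complex.mul_conj, Complex.normSq_eq_norm_sq, Complex.ofReal_re,
    norm_mul, Complex.norm_real, norm_zpow, Complex.norm_conj, Real.norm_eq_abs]
  exact h

/-! #### Behaviour near the parameter `1` -/

theorem continuousAt_invFact (n : ℤ) : ContinuousAt (fun p => invFact p n) 1 := by
  unfold invFact
  by_cases h : n < 0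
  · simp only [if_pos h]
    exact continuousAt_const
  · simp only [if_neg h]
    exact (continuousAt_qfact _).inv₀ (qfact_pos one_pos _).ne'

theorem continuousAt_coeff (a b c k : ℤ) : ContinuousAt (fun p => coeff p a b c k) 1 :=
  (((continuousAt_invFact _).mul (continuousAt_invFact _)).mul (continuousAt_invFact _)).mul
    (continuousAt_invFact _)

theorem continuousAt_psiConst (J M N : ℝ) : ContinuousAt (psiConst J M N) 1 := by
  have hc := fun x => (qfact_pos one_pos x).ne'
  have h1 : ContinuousAt (fun p : ℝ => p ^ (-(N * M / 2))) 1 :=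
    Real.continuousAt_rpow_const _ _ (.inl one_ne_zero)
  have h2 : ContinuousAt (normConst J M N) 1 := by
    unfold normConst
    refine (continuousAt_const.mul ?_).mul ?_
    · exact (((continuousAt_qfact _).mul (continuousAt_qfact _)).div (continuousAt_qfact _)
        (hc _)).sqrt
    · exact ((continuousAt_qfact _).div ((continuousAt_qfact _).mul (continuousAt_qfact _))
        (mul_ne_zero (hc _) (hc _))).sqrt
  exact (h2.mul h1).mul ((continuousAt_qfact _).mul (continuousAt_qfact _))

theorem continuousAt_psiBound (J M N : ℝ) (a b e : ℕ) :
    ContinuousAt (psiBound J M N a b e) 1 := by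
  have hS : ContinuousAt spread 1 := by
    have : spread 1 = 1 := by simp [spread]
    rw [ContinuousAt, this]
    exact tendsto_spread
  refine ((continuousAt_psiConst J M N).abs.mul ?_).mul ((hS.pow _).pow _).sqrt
  exact tendsto_finsetSum _ fun k _ => (continuousAt_coeff _ _ _ _).abs

theorem hasClassicalLimit_Psi (ha : J - M = a) (hb : J - N = b) (he : J + N = e) :
    HasClassicalLimit (Psi J M N) where
  meas := (lt_mem_nhds one_pos).mono fun _ hp => (regular_Psi hp ha hb he).aestronglyMeasurable
  bdd := by
    refine ⟨psiBound J M N a b e 1 + 1, ?_⟩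
    have h := (continuousAt_psiBound J M N a b e).eventually (gt_mem_nhds (lt_add_one _))
    filter_upwards [h, lt_mem_nhds one_pos] with p h1 hp z hz
    exact (norm_Psi_le hp ha hb he hz).trans h1.le
  cont := by
    filter_upwards [ae_ne_zero] with z hz
    have hz' : 0 < ‖z‖ ^ 2 := by have := norm_pos_iff.2 hz; positivity
    have hfst : ContinuousAt (fun x : ℝ × ℂ => x.1) (1, z) := continuousAt_fst
    have hη : ContinuousAt (fun x : ℝ × ℂ => ‖x.2‖ ^ 2) (1, z) :=
      (continuousAt_snd.norm).pow 2
    have hQ : ContinuousAt (fun x : ℝ × ℂ => Q J x.1 (‖x.2‖ ^ 2)) (1, z) :=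
      ContinuousAt.comp (g := fun x : ℝ × ℝ => Q J x.1 x.2)
        (f := fun x : ℝ × ℂ => (x.1, ‖x.2‖ ^ 2)) (x := (1, z))
        (continuousAt_Q (half_integer hb he) hz') (hfst.prodMk hη)
    have hK : ContinuousAt (fun x : ℝ × ℂ => psiConst J M N x.1) (1, z) :=
      ContinuousAt.comp (g := psiConst J M N) (f := fun x : ℝ × ℂ => x.1) (x := (1, z))
        (continuousAt_psiConst J M N) hfst
    have hP : ContinuousAt (fun x : ℝ × ℂ => poly x.1 a b (e - a) (‖x.2‖ ^ 2)) (1, z) := by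
      refine tendsto_finsetSum _ fun k _ => ?_
      have hC : ContinuousAt (fun x : ℝ × ℂ => coeff x.1 a b (e - a) k) (1, z) :=
        ContinuousAt.comp (g := fun p => coeff p a b (e - a) k) (f := fun x : ℝ × ℂ => x.1)
          (x := (1, z)) (continuousAt_coeff _ _ _ _) hfst
      exact (hη.neg.pow k).mul hC
    have hW : ContinuousAt (fun x : ℝ × ℂ => conj x.2 ^ ((e : ℤ) - a)) (1, z) :=
      (Complex.continuous_conj.continuousAt.comp continuousAt_snd).zpow₀ _
        (.inl (by simpa using hz))
    have h := (Complex.continuous_ofReal.continuousAt.comp (hK.mul (hQ.mul hP))).mul hW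
    refine h.congr (Filter.Eventually.of_forall fun x => ?_)
    change _ = Psi J M N x.1 x.2 (conj x.2)
    rw [Psi_eq ha hb he, radial, Complex.mul_conj, Complex.normSq_eq_norm_sq, Complex.ofReal_re]
    rfl

end Psi

/-! ### The span of the basis functions -/

theorem IsAdmissible.add {q : ℝ} {ψ φ : Family} (hψ : IsAdmissible q ψ) (hφ : IsAdmissible q φ) :
    IsAdmissible q (ψ + φ) := by
  rw [isAdmissible_iff] at *
  exact ⟨hψ.1.add hφ.1, hψ.2.add hφ.2⟩

theorem IsAdmissible.smul {q : ℝ} {ψ : Family} (hψ : IsAdmissible q ψ) (c : ℂ) :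
    IsAdmissible q (c • ψ) := by
  rw [isAdmissible_iff] at *
  exact ⟨(Regular.const c).mul hψ.1, (Regular.const c).mul hψ.2⟩

theorem isAdmissible_zero (q : ℝ) : IsAdmissible q 0 := by
  rw [isAdmissible_iff]
  exact ⟨Regular.const 0, Regular.const 0⟩

theorem HasClassicalLimit.add {ψ φ : Family} (hψ : HasClassicalLimit ψ)
    (hφ : HasClassicalLimit φ) : HasClassicalLimit (ψ + φ) where
  meas := by
    filter_upwards [hψ.meas, hφ.meas] with p h1 h2
    exact h1.add h2
  bdd := by
    obtain ⟨C, hC⟩ := hψ.bdd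
    obtain ⟨D, hD⟩ := hφ.bdd
    refine ⟨C + D, ?_⟩
    filter_upwards [hC, hD] with p h1 h2 z hz
    exact (norm_add_le _ _).trans (add_le_add (h1 z hz) (h2 z hz))
  cont := by
    filter_upwards [hψ.cont, hφ.cont] with z h1 h2
    exact h1.add h2

theorem HasClassicalLimit.smul {ψ : Family} (hψ : HasClassicalLimit ψ) (c : ℂ) :
    HasClassicalLimit (c • ψ) where
  meas := by
    filter_upwards [hψ.meas] with p h1
    exact h1.const_mul c
  bdd := by
    obtain ⟨C, hC⟩ := hψ.bdd
    refine ⟨‖c‖ * C, ?_⟩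
    filter_upwards [hC] with p h1 z hz
    exact (norm_mul _ _).le.trans (mul_le_mul_of_nonneg_left (h1 z hz) (norm_nonneg _))
  cont := by
    filter_upwards [hψ.cont] with z h1
    exact h1.const_mul c

theorem hasClassicalLimit_zero : HasClassicalLimit 0 where
  meas := Filter.Eventually.of_forall fun _ => aestronglyMeasurable_const
  bdd := ⟨0, Filter.Eventually.of_forall fun _ _ _ => by simp⟩
  cont := Filter.Eventually.of_forall fun _ => continuousAt_const

section Span

variable {N q : ℝ}

theorem isAdmissible_Psi (hN : ∃ k : ℤ, 2 * N = k) (hq : 0 < q) {J M : ℝ} (h : IsLabel N J M) :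
    IsAdmissible q (Psi J M N) := by
  obtain ⟨a, b, d, e, ha, hb, hd, he⟩ := h.exists_nat hN
  exact isAdmissible_iff.2 ⟨regular_Psi hq ha hb he, regular_Psi (inv_pos.2 hq) ha hb he⟩

theorem isAdmissible_of_mem_basisSpan (hN : ∃ k : ℤ, 2 * N = k) (hq : 0 < q) {v : Family}
    (hv : v ∈ basisSpan N) : IsAdmissible q v := by
  induction hv using Submodule.span_induction with
  | mem v hv =>
    obtain ⟨J, M, h, rfl⟩ := hv
    exact isAdmissible_Psi hN hq h
  | zero => exact isAdmissible_zero q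
  | add v w _ _ h1 h2 => exact h1.add h2
  | smul c v _ h => exact h.smul c

theorem hasClassicalLimit_of_mem_basisSpan (hN : ∃ k : ℤ, 2 * N = k) {v : Family}
    (hv : v ∈ basisSpan N) : HasClassicalLimit v := by
  induction hv using Submodule.span_induction with
  | mem v hv =>
    obtain ⟨J, M, h, rfl⟩ := hv
    obtain ⟨a, b, d, e, ha, hb, hd, he⟩ := h.exists_nat hN
    exact hasClassicalLimit_Psi ha hb he
  | zero => exact hasClassicalLimit_zero
  | add v w _ _ h1 h2 => exact h1.add h2
  | smul c v _ h => exact h.smul c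

theorem Psi_mem_basisSpan {J M : ℝ} (h : IsLabel N J M) : Psi J M N ∈ basisSpan N :=
  Submodule.subset_span ⟨J, M, h, rfl⟩

/-- A linear operator maps the span into itself if it does so on the basis functions. -/
theorem mapsSpan_of_basis {A : Family → Family}
    (hadd : ∀ v ∈ basisSpan N, ∀ w ∈ basisSpan N, ∀ p : ℝ, p = q ∨ p = q⁻¹ → ∀ x y : ℂ, 0 < x * y →
      A (v + w) p x y = A v p x y + A w p x y)
    (hsmul : ∀ (c : ℂ), ∀ v ∈ basisSpan N, ∀ p : ℝ, p = q ∨ p = q⁻¹ → ∀ x y : ℂ, 0 < x * y →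
      A (c • v) p x y = c * A v p x y)
    (hbasis : ∀ J M : ℝ, IsLabel N J M → ∃ v' ∈ basisSpan N, ∀ p : ℝ, p = q ∨ p = q⁻¹ →
      ∀ x y : ℂ, 0 < x * y → A (Psi J M N) p x y = v' p x y) :
    MapsSpan q A (basisSpan N) := by
  intro v hv
  induction hv using Submodule.span_induction with
  | mem v hv =>
    obtain ⟨J, M, h, rfl⟩ := hv
    exact hbasis J M h
  | zero =>
    refine ⟨0, Submodule.zero_mem _, fun p hp x y hxy => ?_⟩
    have := hsmul 0 0 (Submodule.zero_mem _) p hp x y hxy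
    rw [zero_smul, zero_mul] at this
    exact this
  | add v w hv hw h1 h2 =>
    obtain ⟨v', hv', h1⟩ := h1
    obtain ⟨w', hw', h2⟩ := h2
    refine ⟨v' + w', Submodule.add_mem _ hv' hw', fun p hp x y hxy => ?_⟩
    rw [hadd v hv w hw p hp x y hxy, h1 p hp x y hxy, h2 p hp x y hxy]
    rfl
  | smul c v hv h =>
    obtain ⟨v', hv', h⟩ := h
    refine ⟨c • v', Submodule.smul_mem _ c hv', fun p hp x y hxy => ?_⟩
    rw [hsmul c v hv p hp x y hxy, h p hp x y hxy]
    rfl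

theorem pos_of_eq_or (hq : 0 < q) {p : ℝ} (hp : p = q ∨ p = q⁻¹) : 0 < p := by
  rcases hp with rfl | rfl
  exacts [hq, inv_pos.2 hq]

theorem ne_one_of_eq_or (hq1 : q ≠ 1) {p : ℝ} (hp : p = q ∨ p = q⁻¹) : p ≠ 1 := by
  rcases hp with rfl | rfl
  exacts [hq1, by simpa using hq1]

theorem qnum_of_eq_or (hq : 0 < q) {p : ℝ} (hp : p = q ∨ p = q⁻¹) (x : ℝ) :
    qnum p x = qnum q x := by
  rcases hp with rfl | rfl
  exacts [rfl, qnum_inv hq x]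

theorem mapsSpan_H3 (hN : ∃ k : ℤ, 2 * N = k) (hq : 0 < q) :
    MapsSpan q (H3 N) (basisSpan N) := by
  have hreg : ∀ v ∈ basisSpan N, ∀ p : ℝ, p = q ∨ p = q⁻¹ → Regular (v p) := by
    intro v hv p hp
    have h := isAdmissible_iff.1 (isAdmissible_of_mem_basisSpan hN hq hv)
    rcases hp with rfl | rfl
    exacts [h.1, h.2]
  refine mapsSpan_of_basis ?_ ?_ ?_
  · intro v hv w hw p hp x y hxy
    have h := deriv_fun_add ((hreg v hv p hp).differentiable_flow hxy 0)
      ((hreg w hw p hp).differentiable_flow hxy 0)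
    simp only [H3, Pi.add_apply, h]
    ring
  · intro c v hv p hp x y hxy
    have h := deriv_const_mul c ((hreg v hv p hp).differentiable_flow hxy 0)
    simp only [H3, Pi.smul_apply, smul_eq_mul, h]
    ring
  · intro J M h
    obtain ⟨a, b, d, e, ha, hb, hd, he⟩ := h.exists_nat hN
    exact ⟨(M : ℂ) • Psi J M N, Submodule.smul_mem _ _ (Psi_mem_basisSpan h),
      fun p _ x y _ => Psi_H3 ha hb he p x y⟩

theorem Hplus_basis (hN : ∃ k : ℤ, 2 * N = k) {J M : ℝ} (h : IsLabel N J M) :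
    (M = J ∧ ∀ p : ℝ, 0 < p → p ≠ 1 → ∀ x y : ℂ, 0 < x * y → Hplus N (Psi J M N) p x y = 0) ∨
    (IsLabel N J (M + 1) ∧ ∃ a d : ℕ, J - M = (a : ℝ) + 1 ∧ J + M = d ∧ ∀ p : ℝ, 0 < p → p ≠ 1 →
      ∀ x y : ℂ, 0 < x * y → Hplus N (Psi J M N) p x y
        = (√(qnum p ((a : ℝ) + 1) * qnum p ((d : ℝ) + 1)) : ℂ) * Psi J (M + 1) N p x y) := by
  obtain ⟨a, b, d, e, ha, hb, hd, he⟩ := h.exists_nat hN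
  cases a with
  | zero =>
    have hMJ : M = J := by
      push_cast at ha
      linarith
    subst hMJ
    exact .inl ⟨rfl, fun p hp hp1 x y hxy => Psi_Hplus_top hp hp1 hb he hxy⟩
  | succ a =>
    push_cast at ha
    exact .inr ⟨h.succ ha, a, d, ha, hd, fun p hp hp1 x y hxy => Psi_Hplus hp hp1 ha hb hd he hxy⟩

theorem mapsSpan_Hplus (hN : ∃ k : ℤ, 2 * N = k) (hq : 0 < q) (hq1 : q ≠ 1) :
    MapsSpan q (Hplus N) (basisSpan N) := by
  refine mapsSpan_of_basis ?_ ?_ ?_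
  · intro v _ w _ p hp x y _
    have hp0 := pos_of_eq_or hq hp
    rw [Hplus_apply N _ hp0 x y rfl, Hplus_apply N _ hp0 x y rfl, Hplus_apply N _ hp0 x y rfl]
    simp only [Pi.add_apply]
    ring
  · intro c v _ p hp x y _
    have hp0 := pos_of_eq_or hq hp
    rw [Hplus_apply N _ hp0 x y rfl, Hplus_apply N _ hp0 x y rfl]
    simp only [Pi.smul_apply, smul_eq_mul]
    ring
  · intro J M h
    rcases Hplus_basis hN h with ⟨-, h'⟩ | ⟨hl, a, d, -, -, h'⟩
    · exact ⟨0, Submodule.zero_mem _, fun p hp x y hxy =>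
        h' p (pos_of_eq_or hq hp) (ne_one_of_eq_or hq1 hp) x y hxy⟩
    · refine ⟨(√(qnum q ((a : ℝ) + 1) * qnum q ((d : ℝ) + 1)) : ℂ) • Psi J (M + 1) N,
        Submodule.smul_mem _ _ (Psi_mem_basisSpan hl), fun p hp x y hxy => ?_⟩
      rw [h' p (pos_of_eq_or hq hp) (ne_one_of_eq_or hq1 hp) x y hxy, qnum_of_eq_or hq hp,
        qnum_of_eq_or hq hp]
      rfl

theorem mapsSpan_Hminus (hN : ∃ k : ℤ, 2 * N = k) (hq : 0 < q) (hq1 : q ≠ 1) :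
    MapsSpan q (Hminus N) (basisSpan N) := by
  refine mapsSpan_of_basis ?_ ?_ ?_
  · intro v _ w _ p hp x y _
    have hp0 := pos_of_eq_or hq hp
    rw [Hminus_apply N _ hp0 x y rfl, Hminus_apply N _ hp0 x y rfl, Hminus_apply N _ hp0 x y rfl]
    simp only [Pi.add_apply]
    ring
  · intro c v _ p hp x y _
    have hp0 := pos_of_eq_or hq hp
    rw [Hminus_apply N _ hp0 x y rfl, Hminus_apply N _ hp0 x y rfl]
    simp only [Pi.smul_apply, smul_eq_mul]
    ring
  · intro J M h
    obtain ⟨a, b, d, e, ha, hb, hd, he⟩ := h.exists_nat hN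
    cases d with
    | zero =>
      have hMJ : M = -J := by
        push_cast at hd
        linarith
      subst hMJ
      exact ⟨0, Submodule.zero_mem _, fun p hp x y hxy =>
        Psi_Hminus_bot (pos_of_eq_or hq hp) (ne_one_of_eq_or hq1 hp) hb he hxy⟩
    | succ d =>
      push_cast at hd
      refine ⟨(√(qnum q ((a : ℝ) + 1) * qnum q ((d : ℝ) + 1)) : ℂ) • Psi J (M - 1) N,
        Submodule.smul_mem _ _ (Psi_mem_basisSpan (h.pred hd)), fun p hp x y hxy => ?_⟩
      rw [Psi_Hminus (pos_of_eq_or hq hp) (ne_one_of_eq_or hq1 hp) ha hb hd he hxy,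
        qnum_of_eq_or hq hp, qnum_of_eq_or hq hp]
      rfl

end Span

/-! ### The `q`-beta integral -/

/-- The denominator `(1 + η)(1 + u η) ⋯ (1 + u^{n+1} η)`. -/
noncomputable def betaDen (u : ℝ) (n : ℕ) (η : ℝ) : ℝ :=
  ∏ i ∈ Finset.range (n + 2), (1 + u ^ i * η)

/-- The integral of `η^l / ((1 + η)(1 + u η) ⋯ (1 + u^{n+1} η))` over the plane, `η = |z|²`. -/
noncomputable def betaInt (u : ℝ) (n l : ℕ) : ℝ :=
  ∫ z : ℂ, (‖z‖ ^ 2) ^ l / betaDen u n (‖z‖ ^ 2)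

section beta

variable {u : ℝ}

theorem betaDen_pos (hu : 0 < u) (n : ℕ) {η : ℝ} (hη : 0 ≤ η) : 0 < betaDen u n η :=
  Finset.prod_pos fun _ _ => by positivity

theorem measurable_betaDen (u : ℝ) (n : ℕ) : Measurable (betaDen u n) := by
  unfold betaDen
  fun_prop

theorem le_betaDen (hu : 0 < u) (hu1 : u < 1) (n : ℕ) {η : ℝ} (hη : 0 ≤ η) :
    (u ^ (n + 1) * (1 + η)) ^ (n + 2) ≤ betaDen u n η := by
  have h : ∏ i ∈ Finset.range (n + 2), (u ^ (n + 1) * (1 + η)) ≤ betaDen u n η := by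
    refine Finset.prod_le_prod (fun _ _ => by positivity) fun i hi => ?_
    have hi : i ≤ n + 1 := by have := Finset.mem_range.1 hi; omega
    rw [mul_add, mul_one]
    have h1 : u ^ (n + 1) ≤ 1 := pow_le_one₀ hu.le hu1.le
    have h2 : u ^ (n + 1) ≤ u ^ i := pow_le_pow_of_le_one hu.le hu1.le hi
    gcongr
  simpa using h

theorem integrable_beta (hu : 0 < u) (hu1 : u < 1) {n l : ℕ} (hl : l ≤ n) :
    Integrable fun z : ℂ => (‖z‖ ^ 2) ^ l / betaDen u n (‖z‖ ^ 2) := by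
  refine (integrable_inv_one_add_sq_sq.const_mul ((u ^ (n + 1)) ^ (n + 2))⁻¹).mono'
    (Measurable.aestronglyMeasurable (Measurable.div (by fun_prop)
      ((measurable_betaDen u n).comp (by fun_prop)))) (Filter.Eventually.of_forall fun z => ?_)
  set η := ‖z‖ ^ 2 with hη'
  have hη : 0 ≤ η := by positivity
  have hD := betaDen_pos hu n hη
  rw [Real.norm_eq_abs, abs_of_nonneg (by positivity), div_le_iff₀ hD]
  calc η ^ l ≤ (1 + η) ^ l := by gcongr; linarith
    _ ≤ (1 + η) ^ n := pow_le_pow_right₀ (by linarith) hl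
    _ = ((u ^ (n + 1)) ^ (n + 2))⁻¹ * ((1 + η) ^ 2)⁻¹ * (u ^ (n + 1) * (1 + η)) ^ (n + 2) := by
      rw [mul_pow, pow_add (1 + η) n 2]
      field_simp
    _ ≤ _ := by
      gcongr
      exact le_betaDen hu hu1 n hη

theorem integral_scale_real {f : ℂ → ℝ} {a : ℝ} (ha : 0 < a) :
    ∫ z : ℂ, f ((a : ℂ) * z) = (a ^ 2)⁻¹ * ∫ z, f z := by
  have h := Measure.integral_comp_smul (volume : Measure ℂ) f a
  simp only [Complex.finrank_real_complex, Complex.real_smul] at h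
  rw [h, abs_of_pos (by positivity), smul_eq_mul]

theorem integral_radial_scale {f : ℝ → ℝ} (hu : 0 < u) :
    ∫ z : ℂ, f (u * ‖z‖ ^ 2) = u⁻¹ * ∫ z : ℂ, f (‖z‖ ^ 2) := by
  have h := integral_scale_real (f := fun z => f (‖z‖ ^ 2)) (Real.sqrt_pos.2 hu)
  simpa [mul_pow, Real.sq_sqrt hu.le] using h

/-- Apply the scaling `η ↦ u η` to `η^l` over the first `n + 1` factors. Both sides, brought to the
full denominator by its first or its last factor, are combinations of the integrals for `l` and `l +
1`. -/
theorem betaInt_succ_right (hu : 0 < u) (hu1 : u < 1) {n l : ℕ} (hl : l + 1 ≤ n) :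
    betaInt u n (l + 1) * (u ^ (l + 1) - u ^ (n + 1)) = betaInt u n l * (1 - u ^ (l + 1)) := by
  have i1 := integrable_beta hu hu1 (n := n) (l := l) (by omega)
  have i2 := integrable_beta hu hu1 hl
  have h := integral_radial_scale (f := fun η => η ^ l / ∏ i ∈ Finset.range (n + 1), (1 + u ^ i * η)) hu
  have e1 : ∀ z : ℂ, (u * ‖z‖ ^ 2) ^ l
      / ∏ i ∈ Finset.range (n + 1), (1 + u ^ i * (u * ‖z‖ ^ 2))
      = u ^ l * ((‖z‖ ^ 2) ^ l / betaDen u n (‖z‖ ^ 2))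
        + u ^ l * ((‖z‖ ^ 2) ^ (l + 1) / betaDen u n (‖z‖ ^ 2)) := by
    intro z
    have hη : 0 ≤ ‖z‖ ^ 2 := by positivity
    have hD : betaDen u n (‖z‖ ^ 2)
        = (∏ i ∈ Finset.range (n + 1), (1 + u ^ i * (u * ‖z‖ ^ 2))) * (1 + ‖z‖ ^ 2) := by
      rw [betaDen, Finset.prod_range_succ', pow_zero, one_mul]
      simp only [pow_succ, mul_assoc]
    have hP : 0 < ∏ i ∈ Finset.range (n + 1), (1 + u ^ i * (u * ‖z‖ ^ 2)) :=
      Finset.prod_pos fun _ _ => by positivity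
    rw [hD]
    field_simp
    ring
  have e2 : ∀ z : ℂ, (‖z‖ ^ 2) ^ l / ∏ i ∈ Finset.range (n + 1), (1 + u ^ i * ‖z‖ ^ 2)
      = ((‖z‖ ^ 2) ^ l / betaDen u n (‖z‖ ^ 2))
        + u ^ (n + 1) * ((‖z‖ ^ 2) ^ (l + 1) / betaDen u n (‖z‖ ^ 2)) := by
    intro z
    have hη : 0 ≤ ‖z‖ ^ 2 := by positivity
    have hD : betaDen u n (‖z‖ ^ 2)
        = (∏ i ∈ Finset.range (n + 1), (1 + u ^ i * ‖z‖ ^ 2)) * (1 + u ^ (n + 1) * ‖z‖ ^ 2) := by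
      rw [betaDen, Finset.prod_range_succ]
    have hP : 0 < ∏ i ∈ Finset.range (n + 1), (1 + u ^ i * ‖z‖ ^ 2) :=
      Finset.prod_pos fun _ _ => by positivity
    rw [hD]
    field_simp
    ring
  simp only [e1, e2] at h
  rw [integral_add (i1.const_mul _) (i2.const_mul _), integral_add i1 (i2.const_mul _),
    integral_const_mul, integral_const_mul, integral_const_mul] at h
  change u ^ l * betaInt u n l + u ^ l * betaInt u n (l + 1)
    = u⁻¹ * (betaInt u n l + u ^ (n + 1) * betaInt u n (l + 1)) at h
  rw [eq_inv_mul_iff_mul_eq₀ hu.ne'] at h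
  rw [pow_succ u l]
  linear_combination h

/-- Multiplying numerator and denominator by the next factor expresses the smaller integral through
two larger ones, and `betaInt_succ_right` at `l = 0` eliminates one of them. -/
theorem betaInt_succ_left (hu : 0 < u) (hu1 : u < 1) (n : ℕ) :
    betaInt u (n + 1) 0 * (1 - u ^ (n + 2)) = betaInt u n 0 * (1 - u ^ (n + 1)) := by
  have i1 := integrable_beta hu hu1 (n := n + 1) (l := 0) (by omega)
  have i2 := integrable_beta hu hu1 (n := n + 1) (l := 1) (by omega)
  have h1 := betaInt_succ_right hu hu1 (n := n + 1) (l := 0) (by omega)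
  have h2 : betaInt u n 0 = betaInt u (n + 1) 0 + u ^ (n + 2) * betaInt u (n + 1) 1 := by
    unfold betaInt
    rw [← integral_const_mul, ← integral_add i1 (i2.const_mul _)]
    refine integral_congr_ae (Filter.Eventually.of_forall fun z => ?_)
    have hη : 0 ≤ ‖z‖ ^ 2 := by positivity
    have hD : betaDen u (n + 1) (‖z‖ ^ 2)
        = betaDen u n (‖z‖ ^ 2) * (1 + u ^ (n + 2) * ‖z‖ ^ 2) := by
      rw [betaDen, Finset.prod_range_succ, betaDen]
    have hP := betaDen_pos hu n hη
    simp only [hD, pow_zero, pow_one]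
    field_simp
  simp only [zero_add, pow_one] at h1
  rw [h2]
  have hpow : u ^ (n + 2) = u * u ^ (n + 1) := by ring
  have : u ^ (n + 1) * (betaInt u (n + 1) 1 * (u - u ^ (n + 1 + 1)))
    = u ^ (n + 1) * (betaInt u (n + 1) 0 * (1 - u)) := by rw [h1]
  rw [hpow] at *
  linear_combination -this

/-- In the radial variable there is an elementary primitive, a logarithm of `(1 + y²) / (1 + u y²)`.
It is the source of the `ln q` in the prefactor of the form. -/
theorem betaInt_zero_zero (hu : 0 < u) (hu1 : u < 1) :
    betaInt u 0 0 = Real.pi * -Real.log u / (1 - u) := by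
  have h1u : 0 < 1 - u := by linarith
  have hf : ∀ z : ℂ, (‖z‖ ^ 2) ^ 0 / betaDen u 0 (‖z‖ ^ 2)
      = (fun y : ℝ => ((1 + y ^ 2) * (1 + u * y ^ 2))⁻¹) ‖z‖ := fun z => by
    simp [betaDen, Finset.prod_range_succ]
  unfold betaInt
  simp only [hf]
  rw [integral_fun_norm_addHaar (volume : Measure ℂ)
    (f := fun y : ℝ => ((1 + y ^ 2) * (1 + u * y ^ 2))⁻¹), Complex.finrank_real_complex]
  have hvol : (volume : Measure ℂ).real (Metric.ball 0 1) = Real.pi := by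
    rw [Measure.real, Complex.volume_ball]
    simp
  have hlim : Filter.Tendsto (fun y : ℝ => Real.log ((1 + y ^ 2) / (1 + u * y ^ 2)) / (2 * (1 - u)))
      Filter.atTop (𝓝 (Real.log u⁻¹ / (2 * (1 - u)))) := by
    have h1 : Filter.Tendsto (fun y : ℝ => 1 + u * y ^ 2) Filter.atTop Filter.atTop :=
      Filter.tendsto_atTop_add_const_left _ _
        ((Filter.tendsto_pow_atTop two_ne_zero).const_mul_atTop hu)
    have h2 : Filter.Tendsto (fun y : ℝ => u⁻¹ + (1 - u⁻¹) * (1 + u * y ^ 2)⁻¹) Filter.atTop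
        (𝓝 u⁻¹) := by
      simpa using (h1.inv_tendsto_atTop.const_mul (1 - u⁻¹)).const_add u⁻¹
    refine ((Real.continuousAt_log (inv_ne_zero hu.ne')).tendsto.comp (h2.congr fun y => ?_)).div_const _
    have : 0 < 1 + u * y ^ 2 := by positivity
    field_simp
    ring
  have hderiv : ∀ y ∈ Set.Ioi (0 : ℝ),
      HasDerivAt (fun y : ℝ => Real.log ((1 + y ^ 2) / (1 + u * y ^ 2)) / (2 * (1 - u)))
        (y ^ (2 - 1) • ((1 + y ^ 2) * (1 + u * y ^ 2))⁻¹) y := by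
    intro y _
    have p1 : 0 < 1 + y ^ 2 := by positivity
    have p2 : 0 < 1 + u * y ^ 2 := by positivity
    have d1 : HasDerivAt (fun y : ℝ => 1 + y ^ 2) (2 * y) y := by
      simpa using (hasDerivAt_pow 2 y).const_add 1
    have d2 : HasDerivAt (fun y : ℝ => 1 + u * y ^ 2) (u * (2 * y)) y := by
      simpa using ((hasDerivAt_pow 2 y).const_mul u).const_add 1
    have d := (((d1.fun_div d2 p2.ne').log (div_pos p1 p2).ne')).div_const (2 * (1 - u))
    refine d.congr_deriv ?_
    rw [smul_eq_mul]
    have : y ^ (2 - 1) = y := by norm_num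
    rw [this]
    field_simp
    ring
  have hcont : ContinuousWithinAt
      (fun y : ℝ => Real.log ((1 + y ^ 2) / (1 + u * y ^ 2)) / (2 * (1 - u))) (Set.Ici 0) 0 := by
    refine ContinuousAt.continuousWithinAt ?_
    have : ContinuousAt (fun y : ℝ => (1 + y ^ 2) / (1 + u * y ^ 2)) 0 :=
      ContinuousAt.div (by fun_prop) (by fun_prop) (by simp)
    exact (this.log (by simp)).div_const _
  rw [integral_Ioi_of_hasDerivAt_of_nonneg hcont hderiv
    (fun y hy => by have : (0 : ℝ) < y := hy; positivity) hlim, hvol]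
  simp only [Real.log_inv]
  simp
  field_simp

theorem one_sub_sq_pow {q : ℝ} (hq : 0 < q) (hq1 : q < 1) (n : ℕ) :
    1 - (q ^ 2) ^ (n + 1) = q ^ (n + 1) * (q⁻¹ - q) * qnum q ((n : ℝ) + 1) := by
  have h := qnum_mul hq hq1.ne ((n : ℤ) + 1)
  have e : ((((n : ℤ) + 1 : ℤ)) : ℝ) = (n : ℝ) + 1 := by push_cast; rfl
  have e2 : q ^ ((n : ℤ) + 1) = q ^ (n + 1) := by norm_cast
  rw [e, zpow_neg, e2] at h
  have e3 : q ^ (n + 1) * (q⁻¹ - q) * qnum q ((n : ℝ) + 1)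
    = -(q ^ (n + 1) * ((q - q⁻¹) * qnum q ((n : ℝ) + 1))) := by ring
  have e4 : q ^ (n + 1) * (q ^ (n + 1))⁻¹ = 1 := mul_inv_cancel₀ (by positivity)
  rw [e3, h, ← pow_mul, mul_comm 2, pow_mul, mul_sub, e4]
  ring

theorem betaInt_zero {q : ℝ} (hq : 0 < q) (hq1 : q < 1) (b : ℕ) :
    betaInt (q ^ 2) b 0 * (q ^ (b + 1) * (q⁻¹ - q) * qnum q ((b : ℝ) + 1))
      = 2 * Real.pi * -Real.log q := by
  have hu : 0 < q ^ 2 := by positivity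
  have hu1 : q ^ 2 < 1 := by nlinarith
  rw [← one_sub_sq_pow hq hq1]
  induction b with
  | zero =>
    have h1u : 1 - q ^ 2 ≠ 0 := by linarith
    rw [betaInt_zero_zero hu hu1, Real.log_pow]
    field_simp
    push_cast
    ring
  | succ b ih => rw [betaInt_succ_left hu hu1, ih]

/-- The `q`-beta integral. -/
theorem betaInt_eq {q : ℝ} (hq : 0 < q) (hq1 : q < 1) (l b : ℕ) :
    betaInt (q ^ 2) (l + b) l * (q ^ ((l + b + 1) * (l + 1)) * (q⁻¹ - q)
        * qfact q ((l + b : ℕ) + 1 : ℝ))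
      = 2 * Real.pi * -Real.log q * (qfact q l * qfact q b) := by
  have hu : 0 < q ^ 2 := by positivity
  have hu1 : q ^ 2 < 1 := by nlinarith
  have hd : 0 < q⁻¹ - q := by
    have := (one_lt_inv₀ hq).2 hq1
    linarith
  induction l generalizing b with
  | zero =>
    have h := betaInt_zero hq hq1 b
    have h0 : qfact q ((0 : ℕ) : ℝ) = 1 := by simp [qfact]
    rw [h0, zero_add, qfact_natCast_succ, zero_add, mul_one, one_mul, ← h]
    ring
  | succ l ih =>
    -- Raising `l` lowers `b`, so the sum `l + b`, hence the denominator of the integral, stays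
    -- fixed.
    have h := ih (b + 1)
    have hr := betaInt_succ_right hu hu1 (n := l + (b + 1)) (l := l) (by omega)
    have e : (q ^ 2) ^ (l + 1) - (q ^ 2) ^ (l + (b + 1) + 1)
        = (q ^ 2) ^ (l + 1) * (1 - (q ^ 2) ^ (b + 1)) := by
      rw [mul_sub, mul_one, ← pow_add]
      congr 2
      omega
    rw [e, one_sub_sq_pow hq hq1, one_sub_sq_pow hq hq1] at hr
    rw [show l + 1 + b = l + (b + 1) by omega, Nat.cast_succ l, qfact_natCast_succ q l]
    rw [Nat.cast_succ b, qfact_natCast_succ q b] at h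
    have p1 := qnum_natCast_succ_pos hq l
    have p2 := qnum_natCast_succ_pos hq b
    set x := qnum q ((l : ℝ) + 1)
    set y := qnum q ((b : ℝ) + 1)
    set F := qfact q ((l + (b + 1) : ℕ) + 1 : ℝ)
    set I := betaInt (q ^ 2) (l + (b + 1)) l
    set I' := betaInt (q ^ 2) (l + (b + 1)) (l + 1)
    have hr' : I' * (q ^ (l + (b + 1) + 1) * y) = I * x := by
      have hq' : q ^ (l + 1) * (q⁻¹ - q) ≠ 0 := by positivity
      refine mul_left_cancel₀ hq' ?_
      rw [← pow_mul] at hr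
      have e3 : q ^ (l + 1) * q ^ (l + (b + 1) + 1) = q ^ (2 * (l + 1)) * q ^ (b + 1) := by
        rw [← pow_add, ← pow_add]
        congr 1
        omega
      linear_combination hr + I' * (q⁻¹ - q) * y * e3
    refine mul_left_cancel₀ p2.ne' ?_
    have e4 : q ^ ((l + (b + 1) + 1) * (l + 1 + 1))
        = q ^ ((l + (b + 1) + 1) * (l + 1)) * q ^ (l + (b + 1) + 1) := by
      rw [← pow_add]
      ring_nf
    rw [e4]
    linear_combination q ^ ((l + (b + 1) + 1) * (l + 1)) * (q⁻¹ - q) * F * hr' + x * h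

end beta

/-! ### Norms of the vectors of highest weight -/

/-- For `M = J` the polynomial is constant, the factors `q^{-NM/2}` at `q` and `q⁻¹` cancel, and
`Q_inv_mul_Q` cancels the weight and leaves a `q`-beta integrand in a scaled variable. -/
theorem half_Psi_top {J N q : ℝ} {b e : ℕ} (hq : 0 < q) (hq1 : q < 1) (hb : J - N = b)
    (he : J + N = e) (z : ℂ) :
    half q (Psi J J N) (Psi J J N) z
      = ((qfact q ((e + b : ℕ) + 1 : ℝ) / (2 * Real.pi * qfact q b * qfact q e)
        * (q ^ (e + 1))⁻¹ * ((‖z‖ ^ 2) ^ e / betaDen (q ^ 2) (e + b) ((q ^ (e + b + 2))⁻¹ * ‖z‖ ^ 2))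
        : ℝ) : ℂ) := by
  have hqi : 0 < q⁻¹ := inv_pos.2 hq
  have ha : J - J = ((0 : ℕ) : ℝ) := by simp
  have hJ : 2 * J = ((e + b : ℕ) : ℝ) := by rw [half_integer hb he, add_comm]
  set η := ‖z‖ ^ 2 with hη'
  have hη : 0 ≤ η := by positivity
  have hzz : z * conj z = (η : ℂ) := by
    rw [Complex.mul_conj, Complex.normSq_eq_norm_sq]
  have hzz2 : ((q : ℂ)⁻¹ * z * ((q : ℂ)⁻¹ * conj z)).re = (q ^ 2)⁻¹ * η := by
    rw [show (q : ℂ)⁻¹ * z * ((q : ℂ)⁻¹ * conj z) = ((q : ℂ) ^ 2)⁻¹ * (z * conj z) by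
      ring, hzz]
    norm_cast
  have hQ := Q_inv_mul_Q hq hq1 hJ hη
  have hD := betaDen_pos (u := q ^ 2) (by positivity) (e + b)
    (η := (q ^ (e + b + 2))⁻¹ * η) (by positivity)
  rw [show (∏ i ∈ Finset.range (e + b + 2), (1 + (q ^ 2) ^ i * ((q ^ (e + b + 2))⁻¹ * η)))
    = betaDen (q ^ 2) (e + b) ((q ^ (e + b + 2))⁻¹ * η) from rfl] at hQ
  have hc : ∀ p : ℝ, 0 < p → psiConst J J N p * (qfact p b)⁻¹ * (qfact p e)⁻¹
      = p ^ (-(N * J / 2)) * (1 / √(2 * Real.pi) * √(qfact p e * qfact p ((e + b : ℕ) + 1 : ℝ) / qfact p b)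
        * (qfact p e)⁻¹) := by
    intro p hp
    have h0 : qfact p 0 = 1 := by simp [qfact]
    have h1 := (qfact_pos hp (b : ℝ)).ne'
    have h2 := (qfact_pos hp ((e + b : ℕ) : ℝ)).ne'
    rw [psiConst, normConst, sub_self, hb, he, ← two_mul, hJ, h0, one_mul, div_self h2,
      Real.sqrt_one]
    field_simp
  have hcq := hc q hq
  have hcqi := hc q⁻¹ hqi
  simp only [qfact_inv hq] at hcqi
  have hpow : q⁻¹ ^ (-(N * J / 2)) * q ^ (-(N * J / 2)) = 1 := by
    rw [Real.inv_rpow hq.le]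
    exact inv_mul_cancel₀ (Real.rpow_pos_of_pos hq _).ne'
  have f1 := qfact_pos hq (b : ℝ)
  have f2 := qfact_pos hq (e : ℝ)
  have f3 := qfact_pos hq ((e + b : ℕ) + 1 : ℝ)
  have hconst : (psiConst J J N q⁻¹ * (qfact q b)⁻¹ * (qfact q e)⁻¹)
      * (psiConst J J N q * (qfact q b)⁻¹ * (qfact q e)⁻¹)
      = qfact q ((e + b : ℕ) + 1 : ℝ) / (2 * Real.pi * qfact q b * qfact q e) := by
    rw [hcq, hcqi]
    set S := √(qfact q e * qfact q ((e + b : ℕ) + 1 : ℝ) / qfact q b)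
    have hS : S * S = qfact q e * qfact q ((e + b : ℕ) + 1 : ℝ) / qfact q b :=
      Real.mul_self_sqrt (by positivity)
    have hT : √(2 * Real.pi) * √(2 * Real.pi) = 2 * Real.pi :=
      Real.mul_self_sqrt (by positivity)
    have hT0 : √(2 * Real.pi) ≠ 0 := by positivity
    calc _ = (q⁻¹ ^ (-(N * J / 2)) * q ^ (-(N * J / 2))) * (S * S) / (√(2 * Real.pi) * √(2 * Real.pi))
          * ((qfact q e)⁻¹ * (qfact q e)⁻¹) := by field_simp
      _ = _ := by
        rw [hpow, hS, hT]
        field_simp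
  have hreal : (psiConst J J N q⁻¹ * (Q J q⁻¹ η * ((qfact q b)⁻¹ * (qfact q e)⁻¹))) * weight q η
      * (psiConst J J N q * (Q J q ((q ^ 2)⁻¹ * η) * ((qfact q b)⁻¹ * (qfact q e)⁻¹)))
      * ((q ^ e)⁻¹ * η ^ e)
      = qfact q ((e + b : ℕ) + 1 : ℝ) / (2 * Real.pi * qfact q b * qfact q e)
        * (q ^ (e + 1))⁻¹ * (η ^ e / betaDen (q ^ 2) (e + b) ((q ^ (e + b + 2))⁻¹ * η)) := by
    rw [← hconst]
    calc _ = (psiConst J J N q⁻¹ * (qfact q b)⁻¹ * (qfact q e)⁻¹)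
        * (psiConst J J N q * (qfact q b)⁻¹ * (qfact q e)⁻¹) * (q ^ e)⁻¹ * η ^ e
        * (weight q η * (Q J q⁻¹ η * Q J q ((q ^ 2)⁻¹ * η))) := by ring
      _ = (psiConst J J N q⁻¹ * (qfact q b)⁻¹ * (qfact q e)⁻¹)
        * (psiConst J J N q * (qfact q b)⁻¹ * (qfact q e)⁻¹) * (q ^ e)⁻¹ * η ^ e
        * (q⁻¹ * (betaDen (q ^ 2) (e + b) ((q ^ (e + b + 2))⁻¹ * η))⁻¹) := by
          rw [hQ, weight]
          have : 0 < 1 + (q ^ 2)⁻¹ * η := by positivity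
          have : 0 < 1 + η := by positivity
          congr 1
          rw [div_mul_eq_mul_div, div_eq_iff (by positivity)]
          ring
      _ = _ := by
          rw [pow_succ q e, mul_inv]
          ring
  rw [← hreal, half, Psi_eq ha hb he, Psi_eq ha hb he]
  simp only [radial, hzz, hzz2, Complex.ofReal_re, Nat.cast_zero, poly_zero, sub_zero,
    invFact_natCast, zpow_natCast, qfact_inv hq]
  push_cast
  simp only [map_mul, map_pow, Complex.conj_conj, map_inv₀, Complex.conj_ofReal]
  rw [mul_pow, inv_pow, ← hzz, mul_pow]
  ring

/-- The value is half the inverse of the prefactor of the form, so the two halves together give norm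
one. -/
theorem integral_half_Psi_top {J N q : ℝ} {b e : ℕ} (hq : 0 < q) (hq1 : q < 1) (hb : J - N = b)
    (he : J + N = e) :
    ∫ z, half q (Psi J J N) (Psi J J N) z = ((-Real.log q / (q⁻¹ - q) : ℝ) : ℂ) := by
  simp only [half_Psi_top hq hq1 hb he]
  rw [integral_complex_ofReal, integral_const_mul]
  congr 1
  set r : ℝ := (q ^ (e + b + 2))⁻¹ with hr
  have hr0 : 0 < r := by positivity
  have hd : 0 < q⁻¹ - q := by
    have := (one_lt_inv₀ hq).2 hq1
    linarith
  have h := integral_radial_scale (f := fun η => η ^ e / betaDen (q ^ 2) (e + b) η) hr0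
  have e1 : ∀ z : ℂ, (r * ‖z‖ ^ 2) ^ e / betaDen (q ^ 2) (e + b) (r * ‖z‖ ^ 2)
      = r ^ e * ((‖z‖ ^ 2) ^ e / betaDen (q ^ 2) (e + b) (r * ‖z‖ ^ 2)) := fun z => by
    rw [mul_pow, mul_div_assoc]
  simp only [e1] at h
  rw [integral_const_mul] at h
  change _ = r⁻¹ * betaInt (q ^ 2) (e + b) e at h
  have hB := betaInt_eq hq hq1 e b
  set X := ∫ z : ℂ, (‖z‖ ^ 2) ^ e / betaDen (q ^ 2) (e + b) (r * ‖z‖ ^ 2)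
  set B := betaInt (q ^ 2) (e + b) e
  have f1 := qfact_pos hq (b : ℝ)
  have f2 := qfact_pos hq (e : ℝ)
  have f3 := qfact_pos hq ((e + b : ℕ) + 1 : ℝ)
  set F := qfact q ((e + b : ℕ) + 1 : ℝ)
  have hX : X = q ^ ((e + b + 2) * (e + 1)) * B := by
    have : r ^ (e + 1) * X = B := by
      rw [pow_succ, mul_comm (r ^ e), mul_assoc, h, mul_inv_cancel_left₀ hr0.ne']
    rw [← this, hr, inv_pow, ← pow_mul, mul_inv_cancel_left₀ (by positivity)]
  have hpow : q ^ ((e + b + 2) * (e + 1)) = q ^ ((e + b + 1) * (e + 1)) * q ^ (e + 1) := by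
    rw [← pow_add]
    ring_nf
  rw [hX, hpow, eq_div_iff hd.ne']
  have hpi := Real.pi_pos
  generalize q⁻¹ - q = δ at *
  field_simp
  linear_combination hB

/-! ### Orthonormality and positivity -/

section Basis

variable {N q : ℝ} {ψ ψ' φ φ' : Family}

/-- The form only sees the parameters `q`, `q⁻¹` and, up to the null set `{0}`, points with `0 < z
w`; the formulas for the generators are available there. -/
theorem form_congr (hψ : ∀ p : ℝ, p = q ∨ p = q⁻¹ → ∀ x y : ℂ, 0 < x * y → ψ p x y = ψ' p x y)
    (hφ : ∀ p : ℝ, p = q ∨ p = q⁻¹ → ∀ x y : ℂ, 0 < x * y → φ p x y = φ' p x y) (hq : 0 < q) :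
    form q ψ φ = form q ψ' φ' := by
  have hq' : (q : ℂ) ≠ 0 := by exact_mod_cast hq.ne'
  unfold form
  congr 1
  refine integral_congr_ae (ae_ne_zero.mono fun z hz => ?_)
  have h0 := Regular.mul_conj_pos hz
  have h1 := Regular.mul_conj_pos (mul_ne_zero hq' hz)
  have h2 := Regular.mul_conj_pos (mul_ne_zero (inv_ne_zero hq') hz)
  simp only [map_mul, map_inv₀, Complex.conj_ofReal] at h1 h2
  simp only [formIntegrand]
  rw [hψ _ (.inl rfl) _ _ h0, hψ _ (.inr rfl) _ _ h0, hφ _ (.inl rfl) _ _ h2,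
    hφ _ (.inr rfl) _ _ h1]

theorem form_smul_right (q : ℝ) (ψ φ : Family) (c : ℂ) :
    form q ψ (c • φ) = c * form q ψ φ := by
  have e : ∀ z, formIntegrand q ψ (c • φ) z = c * formIntegrand q ψ φ z := fun z => by
    simp only [formIntegrand, Pi.smul_apply, smul_eq_mul]
    ring
  simp only [form, e]
  rw [integral_const_mul, mul_left_comm]

theorem form_smul_left (q : ℝ) (ψ φ : Family) (c : ℂ) :
    form q (c • ψ) φ = conj c * form q ψ φ := by
  have e : ∀ z, formIntegrand q (c • ψ) φ z = conj c * formIntegrand q ψ φ z := fun z => by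
    simp only [formIntegrand, Pi.smul_apply, smul_eq_mul, map_mul]
    ring
  simp only [form, e]
  rw [integral_const_mul, mul_left_comm]

theorem form_zero_left (q : ℝ) (φ : Family) : form q 0 φ = 0 := by
  simpa using form_smul_left q 0 φ 0

theorem form_zero_right (q : ℝ) (ψ : Family) : form q ψ 0 = 0 := by
  simpa using form_smul_right q ψ 0 0

theorem form_Psi_top_of_lt_one {J : ℝ} {b e : ℕ} (hq : 0 < q) (hq1 : q < 1) (hb : J - N = b)
    (he : J + N = e) : form q (Psi J J N) (Psi J J N) = 1 := by
  have ha : J - J = ((0 : ℕ) : ℝ) := by simp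
  have hadm : IsAdmissible q (Psi J J N) :=
    isAdmissible_iff.2 ⟨regular_Psi hq ha hb he, regular_Psi (inv_pos.2 hq) ha hb he⟩
  obtain ⟨i1, i2⟩ := hadm.integrable_half hq hadm
  rw [form_eq i1 i2, integral_half_symm hq, integral_half_Psi_top hq hq1 hb he,
    Complex.conj_ofReal]
  have hlog : Real.log q < 0 := Real.log_neg hq hq1
  have hd : q - q⁻¹ < 0 := by
    have := (one_lt_inv₀ hq).2 hq1
    linarith
  norm_cast
  rw [formConst, ← neg_sub q q⁻¹, neg_div_neg_eq]
  generalize q - q⁻¹ = δ at *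
  have := hlog.ne
  have := hd.ne
  field_simp
  norm_num

theorem form_Psi_top {J : ℝ} {b e : ℕ} (hq : 0 < q) (hq1 : q ≠ 1) (hb : J - N = b)
    (he : J + N = e) : form q (Psi J J N) (Psi J J N) = 1 := by
  rcases hq1.lt_or_gt with h | h
  · exact form_Psi_top_of_lt_one hq h hb he
  · rw [← form_inv]
    exact form_Psi_top_of_lt_one (inv_pos.2 hq) (inv_lt_one_of_one_lt₀ h) hb he

theorem sqrt_qnum_mul_pos (hq : 0 < q) (a d : ℕ) :
    0 < √(qnum q ((a : ℝ) + 1) * qnum q ((d : ℝ) + 1)) :=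
  Real.sqrt_pos.2 (mul_pos (qnum_natCast_succ_pos hq a) (qnum_natCast_succ_pos hq d))

/-- The lowering generator moved to the left argument of the form. -/
theorem form_Psi_eq_form_Hplus (hN : ∃ k : ℤ, 2 * N = k) (hq : 0 < q) (hq1 : q ≠ 1) {J M : ℝ}
    (h : IsLabel N J M) {a d : ℕ} (ha : J - M = (a : ℝ) + 1) (hd : J + M = d)
    (hψ : IsAdmissible q ψ) :
    (√(qnum q ((a : ℝ) + 1) * qnum q ((d : ℝ) + 1)) : ℂ) * form q ψ (Psi J M N)
      = form q (Hplus N ψ) (Psi J (M + 1) N) := by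
  obtain ⟨-, b, -, e, -, hb, -, he⟩ := h.exists_nat hN
  rw [← (adjointAt_Hminus N hq hψ (isAdmissible_Psi hN hq (h.succ ha))).2.2, ← form_smul_right]
  refine form_congr (fun _ _ _ _ _ => rfl) (fun p hp x y hxy => ?_) hq
  rw [Psi_Hminus (a := a) (d := d) (pos_of_eq_or hq hp) (ne_one_of_eq_or hq1 hp) (by linarith) hb
    (by linarith) he hxy, qnum_of_eq_or hq hp, qnum_of_eq_or hq hp, add_sub_cancel_right]
  rfl

/-- Eigenvectors of the symmetric `H₃` for distinct real eigenvalues are orthogonal. -/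
theorem form_Psi_of_ne_right (hN : ∃ k : ℤ, 2 * N = k) (hq : 0 < q) {J M J' M' : ℝ}
    (h : IsLabel N J M) (h' : IsLabel N J' M') (hM : M ≠ M') :
    form q (Psi J M N) (Psi J' M' N) = 0 := by
  have key := (adjointAt_H3 N hq (isAdmissible_Psi hN hq h) (isAdmissible_Psi hN hq h')).2.2
  have e : ∀ {J M : ℝ}, IsLabel N J M → H3 N (Psi J M N) = (M : ℂ) • Psi J M N := by
    intro J M h
    obtain ⟨a, b, d, e, ha, hb, hd, he⟩ := h.exists_nat hN
    funext p z w
    exact Psi_H3 ha hb he p z w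
  rw [e h, e h', form_smul_left, form_smul_right, Complex.conj_ofReal] at key
  have hM' : (M : ℂ) ≠ M' := by exact_mod_cast hM
  by_contra h0
  exact hM' (mul_right_cancel₀ h0 key).symm

/-- Raising both arguments of the form. -/
theorem form_Psi_succ (hN : ∃ k : ℤ, 2 * N = k) (hq : 0 < q) (hq1 : q ≠ 1) {J J' M : ℝ}
    (h : IsLabel N J M) (h' : IsLabel N J' M) {a d a' d' : ℕ} (ha : J - M = (a : ℝ) + 1)
    (hd : J + M = d) (ha' : J' - M = (a' : ℝ) + 1) (hd' : J' + M = d') :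
    (√(qnum q ((a' : ℝ) + 1) * qnum q ((d' : ℝ) + 1)) : ℂ) * form q (Psi J M N) (Psi J' M N)
      = (√(qnum q ((a : ℝ) + 1) * qnum q ((d : ℝ) + 1)) : ℂ)
        * form q (Psi J (M + 1) N) (Psi J' (M + 1) N) := by
  obtain ⟨-, b, -, e, -, hb, -, he⟩ := h.exists_nat hN
  rw [form_Psi_eq_form_Hplus hN hq hq1 h' ha' hd' (isAdmissible_Psi hN hq h)]
  conv_rhs => rw [← Complex.conj_ofReal, ← form_smul_left]
  refine form_congr (fun p hp x y hxy => ?_) (fun _ _ _ _ _ => rfl) hq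
  rw [Psi_Hplus (pos_of_eq_or hq hp) (ne_one_of_eq_or hq1 hp) ha hb hd he hxy,
    qnum_of_eq_or hq hp, qnum_of_eq_or hq hp]
  rfl

/-- Raise both arguments until the one with the smaller `J` is a highest vector. There the lowering
operator that reaches the other vector moves to the left as `H₊` and annihilates it. -/
theorem form_Psi_of_lt (hN : ∃ k : ℤ, 2 * N = k) (hq : 0 < q) (hq1 : q ≠ 1) {J J' : ℝ}
    (hJ : J < J') : ∀ (a : ℕ) (M : ℝ), J - M = a → IsLabel N J M → IsLabel N J' M →
      form q (Psi J M N) (Psi J' M N) = 0 := by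
  intro a
  induction a with
  | zero =>
    intro M ha h h'
    obtain ⟨-, b, -, e, -, hb, -, he⟩ := h.exists_nat hN
    obtain ⟨a', b', d', e', ha', hb', hd', he'⟩ := h'.exists_nat hN
    obtain rfl : M = J := by simp at ha; linarith
    cases a' with
    | zero => simp at ha'; linarith
    | succ a' =>
      push_cast at ha'
      have key := form_Psi_eq_form_Hplus hN hq hq1 h' ha' hd' (isAdmissible_Psi hN hq h)
      rw [form_congr (ψ' := 0) (fun p hp x y hxy => Psi_Hplus_top (pos_of_eq_or hq hp)
        (ne_one_of_eq_or hq1 hp) hb he hxy) (fun _ _ _ _ _ => rfl) hq, form_zero_left] at key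
      exact (mul_eq_zero.1 key).resolve_left
        (Complex.ofReal_ne_zero.2 (sqrt_qnum_mul_pos hq a' d').ne')
  | succ a ih =>
    intro M ha h h'
    obtain ⟨-, -, d, -, -, -, hd, -⟩ := h.exists_nat hN
    obtain ⟨a', b', d', e', ha', hb', hd', he'⟩ := h'.exists_nat hN
    push_cast at ha
    have := a.cast_nonneg (α := ℝ)
    cases a' with
    | zero => simp at ha'; linarith
    | succ a' =>
      push_cast at ha'
      have key := form_Psi_succ hN hq hq1 h h' ha hd ha' hd'
      rw [ih (M + 1) (by linarith) (h.succ ha) (h'.succ ha'), mul_zero] at key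
      exact (mul_eq_zero.1 key).resolve_left
        (Complex.ofReal_ne_zero.2 (sqrt_qnum_mul_pos hq a' d').ne')

theorem form_Psi_self (hN : ∃ k : ℤ, 2 * N = k) (hq : 0 < q) (hq1 : q ≠ 1) {J : ℝ} :
    ∀ (a : ℕ) (M : ℝ), J - M = a → IsLabel N J M → form q (Psi J M N) (Psi J M N) = 1 := by
  intro a
  induction a with
  | zero =>
    intro M ha h
    obtain ⟨-, b, -, e, -, hb, -, he⟩ := h.exists_nat hN
    obtain rfl : M = J := by simp at ha; linarith
    exact form_Psi_top hq hq1 hb he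
  | succ a ih =>
    intro M ha h
    obtain ⟨-, -, d, -, -, -, hd, -⟩ := h.exists_nat hN
    push_cast at ha
    have key := form_Psi_succ hN hq hq1 h h ha hd ha hd
    rw [ih (M + 1) (by linarith) (h.succ ha)] at key
    exact mul_left_cancel₀ (Complex.ofReal_ne_zero.2 (sqrt_qnum_mul_pos hq a d).ne') key

theorem form_Psi_eq_one (hN : ∃ k : ℤ, 2 * N = k) (hq : 0 < q) (hq1 : q ≠ 1) {J M : ℝ}
    (h : IsLabel N J M) : form q (Psi J M N) (Psi J M N) = 1 := by
  obtain ⟨a, -, -, -, ha, -⟩ := h.exists_nat hN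
  exact form_Psi_self hN hq hq1 a M ha h

theorem form_Psi_eq_zero (hN : ∃ k : ℤ, 2 * N = k) (hq : 0 < q) (hq1 : q ≠ 1) {J M J' M' : ℝ}
    (h : IsLabel N J M) (h' : IsLabel N J' M') (hne : ¬(J = J' ∧ M = M')) :
    form q (Psi J M N) (Psi J' M' N) = 0 := by
  by_cases hM : M = M'
  · subst hM
    obtain ⟨a, -, -, -, ha, -⟩ := h.exists_nat hN
    obtain ⟨a', -, -, -, ha', -⟩ := h'.exists_nat hN
    rcases lt_trichotomy J J' with hJ | hJ | hJ
    · exact form_Psi_of_lt hN hq hq1 hJ a M ha h h'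
    · exact absurd ⟨hJ, rfl⟩ hne
    · rw [form_conj_of_isAdmissible hq (isAdmissible_Psi hN hq h') (isAdmissible_Psi hN hq h),
        form_Psi_of_lt hN hq hq1 hJ a' M ha' h' h, map_zero]
  · exact form_Psi_of_ne_right hN hq h h' hM

theorem form_sum_right {ι : Type*} (hq : 0 < q) (hψ : IsAdmissible q ψ) {e : ι → Family}
    (he : ∀ i, IsAdmissible q (e i)) (c : ι → ℂ) (s : Finset ι) :
    IsAdmissible q (∑ i ∈ s, c i • e i) ∧
      form q ψ (∑ i ∈ s, c i • e i) = ∑ i ∈ s, c i * form q ψ (e i) := by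
  classical
  induction s using Finset.induction_on with
  | empty => exact ⟨isAdmissible_zero q, form_zero_right q ψ⟩
  | insert i s hi ih =>
    rw [Finset.sum_insert hi, Finset.sum_insert hi]
    exact ⟨((he i).smul _).add ih.1, by rw [form_smul_add hq hψ (he i) ih.1, ih.2]⟩

theorem form_self_pos (hN : ∃ k : ℤ, 2 * N = k) (hq : 0 < q) (hq1 : q ≠ 1) {v : Family}
    (hv : v ∈ basisSpan N) (hv0 : v ≠ 0) : 0 < form q v v := by
  set e : {x : ℝ × ℝ // IsLabel N x.1 x.2} → Family := fun x => Psi x.1.1 x.1.2 N with he_def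
  have hspan : {ψ | ∃ J M : ℝ, IsLabel N J M ∧ ψ = Psi J M N} = Set.range e := by
    ext ψ
    constructor
    · rintro ⟨J, M, h, rfl⟩
      exact ⟨⟨(J, M), h⟩, rfl⟩
    · rintro ⟨⟨⟨J, M⟩, h⟩, rfl⟩
      exact ⟨J, M, h, rfl⟩
  rw [basisSpan, hspan, Finsupp.mem_span_range_iff_exists_finsupp] at hv
  obtain ⟨c, rfl⟩ := hv
  have hadm : ∀ i, IsAdmissible q (e i) := fun i => isAdmissible_Psi hN hq i.2
  have horth : ∀ i j, form q (e i) (e j) = if i = j then 1 else 0 := by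
    intro i j
    split_ifs with hij
    · subst hij
      exact form_Psi_eq_one hN hq hq1 i.2
    · exact form_Psi_eq_zero hN hq hq1 i.2 j.2 fun h => hij (Subtype.ext (Prod.ext h.1 h.2))
  -- No linear independence is needed in advance: any coefficients representing a nonzero vector are
  -- not all zero.
  have hc : c ≠ 0 := by
    rintro rfl
    simp at hv0
  rw [Finsupp.sum]
  have hadmv := (form_sum_right hq (isAdmissible_zero q) hadm c c.support).1
  have h1 : ∀ j ∈ c.support, form q (e j) (∑ i ∈ c.support, c i • e i) = c j := fun j hj => by
    rw [(form_sum_right hq (hadm j) hadm c c.support).2]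
    simp [horth, hj]
  rw [(form_sum_right hq hadmv hadm c c.support).2]
  obtain ⟨i, hi⟩ := Finsupp.support_nonempty_iff.2 hc
  -- By orthonormality the form equals the sum of `c j * conj (c j)` over the support, where every
  -- term is positive.
  refine Finset.sum_pos (fun j hj => ?_) ⟨i, hi⟩
  rw [form_conj_of_isAdmissible hq (hadm j) hadmv, h1 j hj]
  exact Regular.mul_conj_pos (Finsupp.mem_support_iff.1 hj)

end Basis

/-! ### The classical limit -/

/-- The constant is `(q + 1) / (2q)` divided by the difference quotient of `log` at `1`, and both
tend to `1`. -/
theorem tendsto_formConst : Filter.Tendsto formConst (𝓝[≠] 1) (𝓝 1) := by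
  have h1 : Filter.Tendsto (fun q : ℝ => (q - 1)⁻¹ * Real.log q) (𝓝[≠] 1) (𝓝 1) := by
    have h := (Real.hasDerivAt_log one_ne_zero).tendsto_slope
    simpa [slope_fun_def] using h
  have h2 : Filter.Tendsto (fun q : ℝ => (q + 1) / (2 * q)) (𝓝[≠] 1) (𝓝 1) := by
    have h : ContinuousAt (fun q : ℝ => (q + 1) / (2 * q)) 1 :=
      ContinuousAt.div (by fun_prop) (by fun_prop) (by norm_num)
    have h' := h.tendsto
    norm_num at h'
    exact h'.mono_left nhdsWithin_le_nhds
  have h3 := h2.div h1 one_ne_zero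
  rw [div_one] at h3
  refine h3.congr' ?_
  filter_upwards [self_mem_nhdsWithin, nhdsWithin_le_nhds (lt_mem_nhds one_pos)] with q hq1 hq
  have hlog : Real.log q ≠ 0 := Real.log_ne_zero_of_pos_of_ne_one hq hq1
  have hq1' : q - 1 ≠ 0 := sub_ne_zero.2 hq1
  simp only [Pi.div_apply, formConst]
  field_simp
  ring

section Classical

variable {ψ φ : Family}

theorem continuousAt_half (hψ : HasClassicalLimit ψ) (hφ : HasClassicalLimit φ) :
    ∀ᵐ z : ℂ, ContinuousAt (fun p : ℝ => half p ψ φ z) 1 := by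
  filter_upwards [hψ.cont, hφ.cont] with z h1 h2
  have g1 : ContinuousAt (fun p : ℝ => ψ p⁻¹ z (conj z)) 1 := by
    refine ContinuousAt.comp (f := fun p : ℝ => (p⁻¹, z)) (x := (1 : ℝ))
      (g := fun x : ℝ × ℂ => ψ x.1 x.2 (conj x.2)) ?_ ?_
    · simpa using h1
    · exact (continuousAt_inv₀ one_ne_zero).prodMk continuousAt_const
  have gi : ContinuousAt (fun p : ℝ => (p : ℂ)⁻¹ * z) 1 :=
    (Complex.continuous_ofReal.continuousAt.inv₀ (by simp)).mul continuousAt_const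
  have g2 : ContinuousAt (fun p : ℝ => φ p ((p : ℂ)⁻¹ * z) ((p : ℂ)⁻¹ * conj z)) 1 := by
    have h := ContinuousAt.comp (f := fun p : ℝ => (p, (p : ℂ)⁻¹ * z)) (x := (1 : ℝ))
      (g := fun x : ℝ × ℂ => φ x.1 x.2 (conj x.2)) (by simpa using h2) (continuousAt_id.prodMk gi)
    simpa [Function.comp_def] using h
  have g3 : ContinuousAt (fun p : ℝ => weight p (‖z‖ ^ 2)) 1 := by
    unfold weight
    refine ContinuousAt.div (continuousAt_inv₀ one_ne_zero) ?_ (by positivity)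
    exact continuousAt_const.mul (continuousAt_const.add
      (((continuousAt_id.pow 2).inv₀ (by norm_num)).mul continuousAt_const))
  exact ((Complex.continuous_conj.continuousAt.comp g1).mul
    (Complex.continuous_ofReal.continuousAt.comp g3)).mul g2

theorem eventually_aestronglyMeasurable_half (hψ : HasClassicalLimit ψ)
    (hφ : HasClassicalLimit φ) :
    ∀ᶠ p in 𝓝 (1 : ℝ), AEStronglyMeasurable (half p ψ φ) := by
  have hinv : Filter.Tendsto (fun p : ℝ => p⁻¹) (𝓝 1) (𝓝 1) := by
    simpa using (continuousAt_inv₀ (one_ne_zero (α := ℝ))).tendsto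
  filter_upwards [hinv.eventually hψ.meas, hφ.meas, lt_mem_nhds one_pos] with p h1 h2 hp
  have h3 := aestronglyMeasurable_scale (inv_pos.2 hp) h2
  have hw : AEStronglyMeasurable fun z : ℂ => (weight p (‖z‖ ^ 2) : ℂ) :=
    (integrable_weight hp).aestronglyMeasurable
  have h4 := ((Complex.continuous_conj.comp_aestronglyMeasurable h1).mul hw).mul h3
  exact h4.congr (Filter.Eventually.of_forall fun z => by simp [half])

theorem eventually_norm_half_le (hψ : HasClassicalLimit ψ) (hφ : HasClassicalLimit φ) :
    ∃ C : ℝ, ∀ᶠ p in 𝓝 (1 : ℝ), ∀ᵐ z : ℂ, ‖half p ψ φ z‖ ≤ C * ((1 + ‖z‖ ^ 2) ^ 2)⁻¹ := by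
  have hinv : Filter.Tendsto (fun p : ℝ => p⁻¹) (𝓝 1) (𝓝 1) := by
    simpa using (continuousAt_inv₀ (one_ne_zero (α := ℝ))).tendsto
  have hw : ContinuousAt (fun p : ℝ => p⁻¹ * (1 + p ^ 2)) 1 :=
    (continuousAt_inv₀ one_ne_zero).mul (by fun_prop)
  obtain ⟨C, hC⟩ := hψ.bdd
  obtain ⟨D, hD⟩ := hφ.bdd
  -- The weight is at most `p⁻¹ (1 + p²)` times `(1 + η)⁻²`; this constant equals `2` at `p = 1`, so
  -- it stays below `3` nearby.
  refine ⟨C * 3 * D, ?_⟩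
  filter_upwards [hinv.eventually hC, hD, lt_mem_nhds one_pos,
    hw.eventually (gt_mem_nhds (show (1 : ℝ)⁻¹ * (1 + 1 ^ 2) < 3 by norm_num))] with p h1 h2 hp h3
  filter_upwards [ae_ne_zero] with z hz
  have hp' : (p : ℂ)⁻¹ ≠ 0 := inv_ne_zero (by exact_mod_cast hp.ne')
  have b1 := h1 z hz
  have b2 := h2 _ (mul_ne_zero hp' hz)
  simp only [map_mul, map_inv₀, Complex.conj_ofReal] at b2
  have b3 : |weight p (‖z‖ ^ 2)| ≤ 3 * ((1 + ‖z‖ ^ 2) ^ 2)⁻¹ :=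
    (abs_weight_le hp (by positivity)).trans (by gcongr)
  have hC0 : 0 ≤ C := (norm_nonneg _).trans b1
  simp only [half, norm_mul, RCLike.norm_conj, Complex.norm_real, Real.norm_eq_abs]
  calc _ ≤ C * (3 * ((1 + ‖z‖ ^ 2) ^ 2)⁻¹) * D := by gcongr
    _ = _ := by ring

theorem tendsto_integral_half (hψ : HasClassicalLimit ψ) (hφ : HasClassicalLimit φ) :
    Filter.Tendsto (fun p : ℝ => ∫ z : ℂ, half p ψ φ z) (𝓝 1) (𝓝 (∫ z : ℂ, half 1 ψ φ z)) := by
  obtain ⟨C, hC⟩ := eventually_norm_half_le hψ hφ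
  exact tendsto_integral_filter_of_dominated_convergence _
    (eventually_aestronglyMeasurable_half hψ hφ) hC (integrable_inv_one_add_sq_sq.const_mul C)
    (continuousAt_half hψ hφ)

theorem eventually_integrable_half (hψ : HasClassicalLimit ψ) (hφ : HasClassicalLimit φ) :
    ∀ᶠ p in 𝓝 (1 : ℝ), Integrable (half p ψ φ) := by
  obtain ⟨C, hC⟩ := eventually_norm_half_le hψ hφ
  filter_upwards [hC, eventually_aestronglyMeasurable_half hψ hφ] with p h1 h2
  exact (integrable_inv_one_add_sq_sq.const_mul C).mono' h2 h1

theorem classicalForm_eq (ψ φ : Family) :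
    classicalForm (ψ 1) (φ 1) = 2 * ∫ z : ℂ, half 1 ψ φ z := by
  rw [classicalForm]
  congr 2
  ext z
  simp only [half, weight, inv_one, one_mul, one_div, Complex.ofReal_one, sq]
  ring

/-- Inversion fixes the parameter `1`, so both halves have the same limit; this is the factor `2` in
the classical scalar product. -/
theorem tendsto_form_classicalForm (hψ : HasClassicalLimit ψ) (hφ : HasClassicalLimit φ) :
    Filter.Tendsto (fun q : ℝ => form q ψ φ) (𝓝[≠] 1) (𝓝 (classicalForm (ψ 1) (φ 1))) := by
  have hinv : Filter.Tendsto (fun p : ℝ => p⁻¹) (𝓝 1) (𝓝 1) := by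
    simpa using (continuousAt_inv₀ (one_ne_zero (α := ℝ))).tendsto
  have h := tendsto_integral_half hψ hφ
  have hint := eventually_integrable_half hψ hφ
  have h2 := (h.add (h.comp hinv)).mono_left (nhdsWithin_le_nhds (s := {1}ᶜ))
  have h3 := ((Complex.continuous_ofReal.tendsto 1).comp tendsto_formConst).mul h2
  rw [classicalForm_eq, two_mul]
  rw [Complex.ofReal_one, one_mul] at h3
  refine h3.congr' (nhdsWithin_le_nhds ?_)
  filter_upwards [hint, hinv.eventually hint] with q i1 i2
  exact (form_eq i1 i2).symm

end Classical

end SUq2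

theorem proposition2 (N : ℝ) (hN : ∃ k : ℤ, 2 * N = k) :
    (∀ q : ℝ, 0 < q → q ≠ 1 →
      -- the form is a convergent Hermitian sesquilinear form
      (∀ ψ φ : SUq2.Family, SUq2.IsAdmissible q ψ → SUq2.IsAdmissible q φ →
        MeasureTheory.Integrable (SUq2.formIntegrand q ψ φ) ∧
        SUq2.form q φ ψ = conj (SUq2.form q ψ φ)) ∧
      (∀ ψ φ χ : SUq2.Family, SUq2.IsAdmissible q ψ → SUq2.IsAdmissible q φ →
        SUq2.IsAdmissible q χ → ∀ c : ℂ,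
          SUq2.form q ψ (c • φ + χ) = c * SUq2.form q ψ φ + SUq2.form q ψ χ) ∧
      -- the generators satisfy the Hermiticity conditions
      (∀ ψ φ : SUq2.Family, SUq2.IsAdmissible q ψ → SUq2.IsAdmissible q φ →
        SUq2.AdjointAt q (SUq2.H3 N) (SUq2.H3 N) ψ φ ∧
        SUq2.AdjointAt q (SUq2.Hplus N) (SUq2.Hminus N) ψ φ ∧
        SUq2.AdjointAt q (SUq2.Hminus N) (SUq2.Hplus N) ψ φ) ∧
      -- the span of the basis functions is admissible, invariant, and the form is
      -- positive definite on it
      (∀ v ∈ SUq2.basisSpan N, SUq2.IsAdmissible q v) ∧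
      SUq2.MapsSpan q (SUq2.H3 N) (SUq2.basisSpan N) ∧
      SUq2.MapsSpan q (SUq2.Hplus N) (SUq2.basisSpan N) ∧
      SUq2.MapsSpan q (SUq2.Hminus N) (SUq2.basisSpan N) ∧
      (∀ v ∈ SUq2.basisSpan N, v ≠ 0 → 0 < SUq2.form q v v) ∧
      -- the basis functions are orthonormal
      (∀ J M J' M' : ℝ, SUq2.IsLabel N J M → SUq2.IsLabel N J' M' →
        (J = J' ∧ M = M' → SUq2.form q (SUq2.Psi J M N) (SUq2.Psi J' M' N) = 1) ∧
        (¬ (J = J' ∧ M = M') → SUq2.form q (SUq2.Psi J M N) (SUq2.Psi J' M' N) = 0))) ∧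
    -- the classical limit
    (∀ ψ φ : SUq2.Family, SUq2.HasClassicalLimit ψ → SUq2.HasClassicalLimit φ →
      Filter.Tendsto (fun q : ℝ => SUq2.form q ψ φ) (𝓝[≠] 1)
        (𝓝 (SUq2.classicalForm (ψ 1) (φ 1)))) ∧
    (∀ v ∈ SUq2.basisSpan N, ∀ u ∈ SUq2.basisSpan N,
      Filter.Tendsto (fun q : ℝ => SUq2.form q v u) (𝓝[≠] 1)
        (𝓝 (SUq2.classicalForm (v 1) (u 1)))) := by
  have limit := fun ψ φ hψ hφ => SUq2.tendsto_form_classicalForm (ψ := ψ) (φ := φ) hψ hφ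
  refine ⟨fun q hq hq1 => ⟨fun ψ φ hψ hφ => ⟨?_, SUq2.form_conj_of_isAdmissible hq hψ hφ⟩,
    fun ψ φ χ hψ hφ hχ c => SUq2.form_smul_add hq hψ hφ hχ c,
    fun ψ φ hψ hφ => ⟨SUq2.adjointAt_H3 N hq hψ hφ, SUq2.adjointAt_Hplus N hq hψ hφ,
      SUq2.adjointAt_Hminus N hq hψ hφ⟩,
    fun v hv => SUq2.isAdmissible_of_mem_basisSpan hN hq hv,
    SUq2.mapsSpan_H3 hN hq, SUq2.mapsSpan_Hplus hN hq hq1, SUq2.mapsSpan_Hminus hN hq hq1,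
    fun v hv hv0 => SUq2.form_self_pos hN hq hq1 hv hv0, fun J M J' M' h h' => ⟨?_, ?_⟩⟩,
    limit, fun v hv u hu => limit v u (SUq2.hasClassicalLimit_of_mem_basisSpan hN hv)
      (SUq2.hasClassicalLimit_of_mem_basisSpan hN hu)⟩
  · obtain ⟨i1, i2⟩ := hψ.integrable_half hq hφ
    exact SUq2.integrable_formIntegrand i1 i2
  · rintro ⟨rfl, rfl⟩
    exact SUq2.form_Psi_eq_one hN hq hq1 h
  · exact SUq2.form_Psi_eq_zero hN hq hq1 h h'
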